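/- **Setting.** Let $m\ge 2$ agents be connected by a network and consider $\min_{x\in\mathbb R^{d_x}}\max_{y\in\mathcal Y} f(x,y)$, $f=\frac1m\sum_{i=1}^m f_i$, $f_i(x,y)=\mathbb E[F_i(x,y;\xi_i)]$, where $d_y\ge1$, $\mathcal Y\subseteq\mathbb R^{d_y}$ is closed and convex, and $P(x)=\max_{y\in\mathcal Y}f(x,y)$. In the offline case $\xi_i$ is uniform on $n\ge 1$ indices, i.e. $f_i=\frac1n\sum_{j=1}^nF_{ij}$; in the online case its law is arbitrary. Assume, for constants $L,\mu>0$ and $\kappa=L/\mu$: * $P^*=\inf_xP(x)>-\infty$; * each $F_i(\cdot;\xi)$ is differentiable and $\mathbb E\|\nabla F_i(z;\xi_i)-\nabla F_i(z';\xi_i)\|^2\le L^2\|z-z'\|^2$ for all $z,z'$; * $f_i(x,y)\le f_i(x,y')+\nabla_yf_i(x,y')^\top(y-y')-\frac\mu2\|y-y'\|^2$ for all $i$, $x\in\mathbb R^{d_x}$ and $y,y'\in\mathbb R^{d_y}$; * $\mathbb E[\nabla F_i(z;\xi_i)]=\nabla f_i(z)$ and, in the online case only, $\mathbb E\|\nabla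 f_i(z)-\nabla F_i(z;\xi_i)\|^2\le\sigma^2$ with $\sigma>0$, for all $i$ and $z$; * $W\in\mathbb R^{m\times m}$ is symmetric, doubly stochastic, irreducible and positive semidefinite, and for $i\ne j$ one has $W_{ij}>0$ if and only if $i,j$ are neighbours. Put $\delta=1-\lambda_2(W)$, where $\lambda_2(W)$ is the second largest eigenvalue. **FastMix.** For an array $a=a^{(0)}=a^{(-1)}$ with $m$ rows, $\mathrm{FastMix}(a,K)=a^{(K)}$ with $a^{(k+1)}=(1+\eta_a)Wa^{(k)}-\eta_aa^{(k-1)}$ and $\eta_a=1/(1+\sqrt{1-\lambda_2(W)^2})$; it costs $K$ communication rounds. **DREAM.** Start from $x_0\in\mathbb R^{d_x}$, $y_0\in\mathcal Y$: set $\mathbf x_0(i)=x_0$, $\mathbf y_0(i)=y_0$ for all $i$. Let $\mathbf g_0(i)$ be the average of $\nabla F_i(\mathbf z_0(i);\xi)$ over a large batch, which consists of $b'$ i.i.d. samples of $\xi_i$ (online) or of all $n=b'$ data points (offline), and $\mathbf s_0=\mathrm{FastMix}(\mathbf g_0,K_0)$. Write $\mathbf z_t=[\mathbf x_t,\mathbf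 y_t]$, $\mathbf s_t=[\mathbf u_t,\mathbf v_t]$, and let $\Pi$ be the projection to $\mathcal Y$, applied to every row. For $t=0,\dots,T-1$ draw $\zeta_t\sim\mathrm{Bernoulli}(p)$ and set $$\mathbf x_{t+1}=\mathrm{FastMix}(\mathbf x_t-\gamma\eta\mathbf u_t,K),\qquad \mathbf y_{t+1}=\mathrm{FastMix}(\Pi(\mathbf y_t+\eta\mathbf v_t),K).$$ If $\zeta_t=1$, $\mathbf g_{t+1}(i)$ is the average of $\nabla F_i(\mathbf z_{t+1}(i);\xi)$ over a fresh large batch. If $\zeta_t=0$, each agent draws $\omega_t(i)\sim\mathrm{Bernoulli}(q)$ and $b$ i.i.d. samples $\xi_{i,j}$ of $\xi_i$ and sets $\mathbf g_{t+1}(i)=\mathbf g_t(i)+\frac{\omega_t(i)}{bq}\sum_{j=1}^b\big(\nabla F_i(\mathbf z_{t+1}(i);\xi_{i,j})-\nabla F_i(\mathbf z_t(i);\xi_{i,j})\big)$. Finally $\mathbf s_{t+1}=\mathrm{FastMix}(\mathbf s_t+\mathbf g_{t+1}-\mathbf g_t,K'')$ with $K''=K'$ if $\zeta_t=1$ and $K''=K$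 if $\zeta_t=0$. All draws are independent. The output $x_{\rm out}$ is uniform on $\{\mathbf x_t(i):0\le t<T,\ 1\le i\le m\}$. **Parameters.** Let $\varepsilon>0$, $\alpha=\frac18$, $c_1=\sqrt{14}$, $c_2=1-\frac1{\sqrt2}$, $\Psi_0=P(x_0)-P^*+\alpha(P(x_0)-f(x_0,y_0))$ and $$\eta=\frac1{48L},\quad \gamma=\frac{\alpha}{128(1+\alpha)\kappa^2},\quad b=\Big\lceil\sqrt{b'/m}\Big\rceil,\quad q=\frac1b\sqrt{b'/m},\quad p=\frac{bq}{bq+b'},\quad T=\Big\lceil\frac{16\Psi_0}{\gamma\eta\varepsilon^2}+\frac2p\Big\rceil,$$ $$K_0=\Big\lceil\frac{\log(16c_1/(\gamma m\varepsilon^2))}{c_2\sqrt\delta}\Big\rceil,\quad K=\Big\lceil\frac{5\log(c_1(m/b'+1))}{c_2\sqrt\delta}\Big\rceil,\quad K'=\Big\lceil\frac{5\log(c_1m)}{c_2\sqrt\delta}\Big\rceil,$$ where $K_0=0$ if the expression is negative, $b'=\lceil32\sigma^2/(\gamma m\varepsilon^2)\rceil$ online and $b'=n$ offline. Put $H=\sum_{i=1}^m\|\nabla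 f_i(x_0,y_0)-\nabla f(x_0,y_0)\|^2$. **Theorem.** $P$ is differentiable, and there is an absolute constant $C$ such that the following holds. 1. (Accuracy) $\mathbb E\|\nabla P(x_{\rm out})\|\le\varepsilon$ for all sufficiently small $\varepsilon$, namely whenever $m\varepsilon^2(H+m\sigma^2)\le\kappa^2$ (online), $m\varepsilon^2H\le\kappa^2$ (offline). 2. (SFO complexity) The expected number of stochastic gradients evaluated by all agents is at most $C(\kappa^2\sigma^2\varepsilon^{-2}+\Psi_0\kappa^3L\sigma\varepsilon^{-3})$ in the online case if $m\varepsilon^2\le\kappa^2\sigma^2$, and at most $C(mn+\sqrt{mn}\,\Psi_0\kappa^2L\varepsilon^{-2})$ in the offline case for every $\varepsilon>0$. 3. (Communication complexity) The expected number of communication rounds is at most $C(1+\Psi_0)\kappa^2L\varepsilon^{-2}\log(m)/\sqrt\delta$ for all sufficiently small $\varepsilon$, namely whenever $\varepsilon^2\big(\sqrt m+\kappa\sigma/\varepsilon+\log(1+\kappa^2/\varepsilon^2)\big)\le\kappa^2L$ (online), $\varepsilon^2\big(\sqrt{mn}+\log(1+\kappa^2/\varepsilon^2)\big)\le\kappa^2L$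 (offline). -/

import Mathlib

open MeasureTheory

namespace Dream

noncomputable section

/-! ### The minimax problem -/

/-- The space `ℝ^dx × ℝ^dy` of pairs `z = (x, y)` with its Euclidean norm
`‖z‖² = ‖x‖² + ‖y‖²` and the corresponding inner product. -/
abbrev ZSpace (dx dy : ℕ) : Type :=
  WithLp 2 (EuclideanSpace ℝ (Fin dx) × EuclideanSpace ℝ (Fin dy))

/-- The point `(x, y)` of `ZSpace dx dy`. -/
abbrev pair {dx dy : ℕ} (x : EuclideanSpace ℝ (Fin dx)) (y : EuclideanSpace ℝ (Fin dy)) :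
    ZSpace dx dy := WithLp.toLp 2 (x, y)

/-- The local objective `f_i(z) = 𝔼[F_i(z; ξ)]`, where `ξ` has law `D`. -/
def localObj {dx dy : ℕ} {Ξ : Type*} [MeasurableSpace Ξ] (D : Measure Ξ)
    (F : ZSpace dx dy → Ξ → ℝ) (z : ZSpace dx dy) : ℝ := ∫ ξ, F z ξ ∂D

/-- The global objective `f = (1/m) ∑ i, f_i`. -/
def globalObj {m dx dy : ℕ} {Ξ : Type*} [MeasurableSpace Ξ] (D : Fin m → Measure Ξ)
    (F : Fin m → ZSpace dx dy → Ξ → ℝ) (z : ZSpace dx dy) : ℝ :=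
  (1 / (m : ℝ)) * ∑ i, localObj (D i) (F i) z

/-- The primal function `P(x) = max_{y ∈ Y} f(x, y)`. -/
def primal {dx dy : ℕ} (Y : Set (EuclideanSpace ℝ (Fin dy))) (f : ZSpace dx dy → ℝ)
    (x : EuclideanSpace ℝ (Fin dx)) : ℝ :=
  sSup ((fun y => f (pair x y)) '' Y)

/-- The stochastic gradient `∇F(z; ξ)`, the gradient being taken in `z = (x, y)`. -/
def stochGrad {dx dy : ℕ} {Ξ : Type*} (F : ZSpace dx dy → Ξ → ℝ) (z : ZSpace dx dy) (ξ : Ξ) :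
    ZSpace dx dy := gradient (fun w => F w ξ) z

/-- The assumptions on the minimax problem that are common to the online and the offline case.
(In the offline case, where `Ξ` is finite, the fields `measurable`, `integrable` and `unbiased`
are automatic.) -/
structure ProblemAssumptions {m dx dy : ℕ} {Ξ : Type*} [MeasurableSpace Ξ]
    (D : Fin m → Measure Ξ) (F : Fin m → ZSpace dx dy → Ξ → ℝ)
    (Y : Set (EuclideanSpace ℝ (Fin dy))) (L μ : ℝ) : Prop where
  isClosed : IsClosed Y
  convex : Convex ℝ Y
  L_pos : 0 < L
  mu_pos : 0 < μ
  /-- `ξ ↦ F_i(z; ξ)` is measurable. -/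
  measurable : ∀ i z, Measurable (F i z)
  /-- `f_i(z) = 𝔼[F_i(z; ξ_i)]` is well defined. -/
  integrable : ∀ i z, Integrable (F i z) (D i)
  /-- Each component `F_i(·; ξ)` is differentiable. -/
  differentiable : ∀ i ξ, Differentiable ℝ (fun z => F i z ξ)
  /-- `P` is lower bounded. -/
  lowerBounded : BddBelow (Set.range (primal Y (globalObj D F)))
  /-- `L`-average smoothness:
  `𝔼‖∇F_i(z; ξ_i) - ∇F_i(z'; ξ_i)‖² ≤ L² ‖z - z'‖²`. -/
  averageSmooth : ∀ i z z',
    ∫⁻ ξ, ‖stochGrad (F i) z ξ - stochGrad (F i) z' ξ‖ₑ ^ 2 ∂(D i)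
      ≤ ENNReal.ofReal (L ^ 2 * ‖z - z'‖ ^ 2)
  /-- Each `f_i` is differentiable and `𝔼[∇F_i(z; ξ_i)] = ∇f_i(z)`. -/
  unbiased : ∀ i z,
    HasGradientAt (localObj (D i) (F i)) (∫ ξ, stochGrad (F i) z ξ ∂(D i)) z
  /-- Each `f_i` is `μ`-strongly concave in `y`. -/
  stronglyConcave : ∀ i x y y',
    localObj (D i) (F i) (pair x y) ≤ localObj (D i) (F i) (pair x y')
      + inner ℝ (gradient (localObj (D i) (F i)) (pair x y')).snd (y - y')
      - μ / 2 * ‖y - y'‖ ^ 2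

/-- The stochastic gradients have variance at most `σ²`. -/
def BoundedVariance {m dx dy : ℕ} {Ξ : Type*} [MeasurableSpace Ξ]
    (D : Fin m → Measure Ξ) (F : Fin m → ZSpace dx dy → Ξ → ℝ) (σ : ℝ) : Prop :=
  ∀ i z, ∫⁻ ξ, ‖gradient (localObj (D i) (F i)) z - stochGrad (F i) z ξ‖ₑ ^ 2 ∂(D i)
    ≤ ENNReal.ofReal (σ ^ 2)

/-! ### The network -/

/-- `W` is a mixing matrix for the network `G`. -/
structure MixingMatrix {m : ℕ} (G : SimpleGraph (Fin m)) (W : Matrix (Fin m) (Fin m) ℝ) :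
    Prop where
  supported : ∀ i j, i ≠ j → (0 < W i j ↔ G.Adj i j)
  irreducible : W.IsIrreducible
  symmetric : W.IsSymm
  doublyStochastic : W ∈ _root_.doublyStochastic ℝ (Fin m)
  posSemidef : W.PosSemidef

/-- The second largest eigenvalue `λ₂(W)` (eigenvalues counted with multiplicity). -/
def lambda2 {m : ℕ} {W : Matrix (Fin m) (Fin m) ℝ} (hW : W.IsHermitian) (hm : 2 ≤ m) : ℝ :=
  hW.eigenvalues₀ ⟨1, by rw [Fintype.card_fin]; omega⟩

/-- The product of an `m × m` matrix with an aggregated variable, whose `i`-th row is `a i`. -/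
def mix {m : ℕ} {V : Type*} [AddCommGroup V] [Module ℝ V] (W : Matrix (Fin m) (Fin m) ℝ)
    (a : Fin m → V) : Fin m → V := fun i => ∑ j, W i j • a j

/-- The pair `(a^(k-1), a^(k))` of consecutive iterates of FastMix: `a^(-1) = a^(0)` and
`a^(k+1) = (1 + η_a) W a^(k) - η_a a^(k-1)` with `η_a = 1 / (1 + √(1 - λ₂²))`. -/
def fastMixIter {m : ℕ} {V : Type*} [AddCommGroup V] [Module ℝ V]
    (W : Matrix (Fin m) (Fin m) ℝ) (lam2 : ℝ) (a : Fin m → V) :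
    ℕ → (Fin m → V) × (Fin m → V)
  | 0 => (a, a)
  | k + 1 =>
    let prev := (fastMixIter W lam2 a k).1
    let cur := (fastMixIter W lam2 a k).2
    let etaA : ℝ := 1 / (1 + √(1 - lam2 ^ 2))
    (cur, (1 + etaA) • mix W cur - etaA • prev)

/-- `FastMix(a, K)`, which outputs `a^(K)`, at the price of `K` communication rounds. -/
def fastMix {m : ℕ} {V : Type*} [AddCommGroup V] [Module ℝ V]
    (W : Matrix (Fin m) (Fin m) ℝ) (lam2 : ℝ) (a : Fin m → V) (K : ℕ) : Fin m → V :=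
  (fastMixIter W lam2 a K).2

/-- The projection `Π(y) = argmin_{y' ∈ Y} ‖y' - y‖` (it exists and is unique when `Y` is
nonempty, closed and convex). -/
def proj {dy : ℕ} (Y : Set (EuclideanSpace ℝ (Fin dy))) (y : EuclideanSpace ℝ (Fin dy)) :
    EuclideanSpace ℝ (Fin dy) :=
  Classical.epsilon fun y' => y' ∈ Y ∧ ∀ w ∈ Y, ‖y' - y‖ ≤ ‖w - y‖

/-! ### The algorithm -/

/-- The parameters of DREAM; `bigB` is the large batch size `b'` and `bigK` is `K'`. -/
structure Params where
  η : ℝ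
  γ : ℝ
  p : ℝ
  q : ℝ
  b : ℕ
  bigB : ℕ
  K₀ : ℕ
  K : ℕ
  bigK : ℕ
  T : ℕ

/-- The state of DREAM after `t` iterations: the aggregated variables `x_t`, `y_t`, `g_t` and the
gradient tracker `s_t = [u_t, v_t]`, together with the numbers of stochastic gradients that all
agents have evaluated and of communication rounds that have been used so far. -/
structure State (m dx dy : ℕ) where
  x : Fin m → EuclideanSpace ℝ (Fin dx)
  y : Fin m → EuclideanSpace ℝ (Fin dy)
  g : Fin m → ZSpace dx dy
  s : Fin m → ZSpace dx dy
  sfo : ℕ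
  comm : ℕ

/-- A large batch: `b'` samples for each agent. -/
abbrev BigBatch (m bigB : ℕ) (Ξ : Type*) := Fin m → Fin bigB → Ξ

/-- The random choices of one iteration: `ζ_t`, the `ω_t(i)`, the large batches `S_t'(i)` and the
small batches `S_t(i)`. -/
abbrev Seed (m b bigB : ℕ) (Ξ : Type*) :=
  Bool × (Fin m → Bool) × BigBatch m bigB Ξ × (Fin m → Fin b → Ξ)

/-- The large batch estimator `(1/b') ∑_j ∇F_i(z; ξ_{i,j})`. -/
def bigGrad {m dx dy bigB : ℕ} {Ξ : Type*} (F : Fin m → ZSpace dx dy → Ξ → ℝ)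
    (S : BigBatch m bigB Ξ) (z : Fin m → ZSpace dx dy) (i : Fin m) : ZSpace dx dy :=
  (1 / (bigB : ℝ)) • ∑ j, stochGrad (F i) (z i) (S i j)

/-- The initialization of DREAM at `(x₀, y₀)`. -/
def initState {m dx dy : ℕ} {Ξ : Type*} (P : Params) (W : Matrix (Fin m) (Fin m) ℝ) (lam2 : ℝ)
    (F : Fin m → ZSpace dx dy → Ξ → ℝ)
    (x₀ : EuclideanSpace ℝ (Fin dx)) (y₀ : EuclideanSpace ℝ (Fin dy))
    (S₀ : BigBatch m P.bigB Ξ) : State m dx dy :=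
  let g₀ := bigGrad F S₀ (fun _ => pair x₀ y₀)
  { x := fun _ => x₀
    y := fun _ => y₀
    g := g₀
    s := fastMix W lam2 g₀ P.K₀
    sfo := m * P.bigB
    comm := P.K₀ }

/-- One iteration of DREAM. An agent with `ω_t(i) = 1` evaluates `2b` stochastic gradients (`b` at
each of `z_{t+1}(i)` and `z_t(i)`), an agent with `ω_t(i) = 0` none. -/
def step {m dx dy : ℕ} {Ξ : Type*} (P : Params) (W : Matrix (Fin m) (Fin m) ℝ) (lam2 : ℝ)
    (Y : Set (EuclideanSpace ℝ (Fin dy))) (F : Fin m → ZSpace dx dy → Ξ → ℝ)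
    (st : State m dx dy) (r : Seed m P.b P.bigB Ξ) : State m dx dy :=
  let ζ := r.1
  let ω := r.2.1
  let S' := r.2.2.1
  let S := r.2.2.2
  let x' := fastMix W lam2 (fun i => st.x i - (P.γ * P.η) • (st.s i).fst) P.K
  let y' := fastMix W lam2 (fun i => proj Y (st.y i + P.η • (st.s i).snd)) P.K
  let z : Fin m → ZSpace dx dy := fun i => pair (st.x i) (st.y i)
  let z' : Fin m → ZSpace dx dy := fun i => pair (x' i) (y' i)
  let g' : Fin m → ZSpace dx dy := fun i =>
    if ζ then bigGrad F S' z' i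
    else st.g i + ((if ω i then (1 : ℝ) else 0) / ((P.b : ℝ) * P.q)) •
      ∑ j, (stochGrad (F i) (z' i) (S i j) - stochGrad (F i) (z i) (S i j))
  { x := x'
    y := y'
    g := g'
    s := fastMix W lam2 (fun i => st.s i + g' i - st.g i) (if ζ then P.bigK else P.K)
    sfo := st.sfo + (if ζ then m * P.bigB else ∑ i, if ω i then 2 * P.b else 0)
    comm := st.comm + P.K + P.K + (if ζ then P.bigK else P.K) }

/-- The state of DREAM after `t` iterations, given its initial large batch and its random
choices. -/
def run {m dx dy : ℕ} {Ξ : Type*} (P : Params) (W : Matrix (Fin m) (Fin m) ℝ) (lam2 : ℝ)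
    (Y : Set (EuclideanSpace ℝ (Fin dy))) (F : Fin m → ZSpace dx dy → Ξ → ℝ)
    (x₀ : EuclideanSpace ℝ (Fin dx)) (y₀ : EuclideanSpace ℝ (Fin dy))
    (S₀ : BigBatch m P.bigB Ξ) (r : ℕ → Seed m P.b P.bigB Ξ) : ℕ → State m dx dy
  | 0 => initState P W lam2 F x₀ y₀ S₀
  | t + 1 => step P W lam2 Y F (run P W lam2 Y F x₀ y₀ S₀ r t) (r t)

/-- All random choices of DREAM: the initial large batch, those of the iterations, and the index
`(t, i)` of the output. -/
abbrev Outcome (m : ℕ) (P : Params) (Ξ : Type*) :=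
  BigBatch m P.bigB Ξ × (ℕ → Seed m P.b P.bigB Ξ) × (Fin P.T × Fin m)

/-- The output `x_out = x_t(i)`. -/
def output {m dx dy : ℕ} {Ξ : Type*} (P : Params) (W : Matrix (Fin m) (Fin m) ℝ) (lam2 : ℝ)
    (Y : Set (EuclideanSpace ℝ (Fin dy))) (F : Fin m → ZSpace dx dy → Ξ → ℝ)
    (x₀ : EuclideanSpace ℝ (Fin dx)) (y₀ : EuclideanSpace ℝ (Fin dy))
    (o : Outcome m P Ξ) : EuclideanSpace ℝ (Fin dx) :=
  (run P W lam2 Y F x₀ y₀ o.1 o.2.1 o.2.2.1).x o.2.2.2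

/-- The total number of stochastic gradient evaluations of all agents in a run. -/
def sfoCost {m dx dy : ℕ} {Ξ : Type*} (P : Params) (W : Matrix (Fin m) (Fin m) ℝ) (lam2 : ℝ)
    (Y : Set (EuclideanSpace ℝ (Fin dy))) (F : Fin m → ZSpace dx dy → Ξ → ℝ)
    (x₀ : EuclideanSpace ℝ (Fin dx)) (y₀ : EuclideanSpace ℝ (Fin dy))
    (o : Outcome m P Ξ) : ℝ :=
  ((run P W lam2 Y F x₀ y₀ o.1 o.2.1 P.T).sfo : ℝ)

/-- The total number of communication rounds in a run. -/
def commCost {m dx dy : ℕ} {Ξ : Type*} (P : Params) (W : Matrix (Fin m) (Fin m) ℝ) (lam2 : ℝ)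
    (Y : Set (EuclideanSpace ℝ (Fin dy))) (F : Fin m → ZSpace dx dy → Ξ → ℝ)
    (x₀ : EuclideanSpace ℝ (Fin dx)) (y₀ : EuclideanSpace ℝ (Fin dy))
    (o : Outcome m P Ξ) : ℝ :=
  ((run P W lam2 Y F x₀ y₀ o.1 o.2.1 P.T).comm : ℝ)

/-- The Bernoulli law with success probability `p ∈ [0, 1]` (a real `p` outside `[0, 1]` is moved
to the nearest end point). -/
def bernoulliLaw (p : ℝ) : Measure Bool :=
  ProbabilityTheory.bernoulliMeasure true false (Set.projIcc (0 : ℝ) 1 zero_le_one p)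

/-- The law of the random choices of one iteration: `ζ_t ∼ Bernoulli(p)`, `ω_t(i) ∼ Bernoulli(q)`,
large batches with law `Q` and i.i.d. small batches, all independent. -/
def seedLaw {m : ℕ} {Ξ : Type*} [MeasurableSpace Ξ] (P : Params) (D : Fin m → Measure Ξ)
    (Q : Measure (BigBatch m P.bigB Ξ)) : Measure (Seed m P.b P.bigB Ξ) :=
  (bernoulliLaw P.p).prod ((Measure.pi fun _ : Fin m => bernoulliLaw P.q).prod
    (Q.prod (Measure.pi fun i : Fin m => Measure.pi fun _ : Fin P.b => D i)))

/-- The law of all random choices: independent iterations, and an independent uniform output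
index. -/
def law {m : ℕ} {Ξ : Type*} [MeasurableSpace Ξ] (P : Params) (D : Fin m → Measure Ξ)
    (Q : Measure (BigBatch m P.bigB Ξ)) : Measure (Outcome m P Ξ) :=
  Q.prod ((Measure.infinitePi fun _ : ℕ => seedLaw P D Q).prod
    (ProbabilityTheory.uniformOn Set.univ))

/-- Large batches of the online case: `b'` i.i.d. samples of law `D i` for each agent `i`. -/
def onlineBatch {m : ℕ} {Ξ : Type*} [MeasurableSpace Ξ] (D : Fin m → Measure Ξ) (bigB : ℕ) :
    Measure (BigBatch m bigB Ξ) :=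
  Measure.pi fun i : Fin m => Measure.pi fun _ : Fin bigB => D i

/-- Large batches of the offline case: always the full data set `{ξ_{i,1}, …, ξ_{i,n}}`. -/
def offlineBatch (m n : ℕ) : Measure (BigBatch m n (Fin n)) :=
  Measure.dirac fun _ j => j

/-- The law of `ξ_i` in the offline case: uniform on the indices `1, …, n`. -/
def offlineLaw (m n : ℕ) : Fin m → Measure (Fin n) :=
  fun _ => ProbabilityTheory.uniformOn Set.univ

/-! ### The choice of the parameters -/

/-- `c₁ = √14`. -/
def c₁ : ℝ := √14

/-- `c₂ = 1 - 1/√2`. -/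
def c₂ : ℝ := 1 - 1 / √2

/-- `α = 1/8`. -/
def alpha : ℝ := 1 / 8

/-- The stepsize ratio `γ = α / (128 (1 + α) κ²)`. -/
def gammaOf (κ : ℝ) : ℝ := alpha / ((1 + alpha) * 128 * κ ^ 2)

/-- `Ψ₀ = P(x₀) - P^* + α (P(x₀) - f(x₀, y₀))`. -/
def psi0 {dx dy : ℕ} (Y : Set (EuclideanSpace ℝ (Fin dy))) (f : ZSpace dx dy → ℝ)
    (x₀ : EuclideanSpace ℝ (Fin dx)) (y₀ : EuclideanSpace ℝ (Fin dy)) : ℝ :=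
  primal Y f x₀ - (⨅ x, primal Y f x) + alpha * (primal Y f x₀ - f (pair x₀ y₀))

/-- The large batch size `⌈32 σ² / (γ m ε²)⌉` of the online case. -/
def onlineBigB (m : ℕ) (κ σ ε : ℝ) : ℕ := ⌈32 * σ ^ 2 / (gammaOf κ * m * ε ^ 2)⌉₊

/-- The parameters of DREAM for the large batch size `bigB`. -/
def params (m : ℕ) (L κ δ Ψ₀ ε : ℝ) (bigB : ℕ) : Params :=
  let η : ℝ := 1 / (48 * L)
  let γ : ℝ := gammaOf κ
  let b : ℕ := ⌈√((bigB : ℝ) / m)⌉₊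
  let q : ℝ := 1 / (b : ℝ) * √((bigB : ℝ) / m)
  let p : ℝ := b * q / (b * q + bigB)
  { η := η
    γ := γ
    p := p
    q := q
    b := b
    bigB := bigB
    K₀ := ⌈Real.log (16 * c₁ / (γ * m * ε ^ 2)) / (c₂ * √δ)⌉₊
    K := ⌈5 * Real.log (c₁ * ((m : ℝ) / bigB + 1)) / (c₂ * √δ)⌉₊
    bigK := ⌈5 * Real.log (c₁ * m) / (c₂ * √δ)⌉₊
    T := ⌈16 * Ψ₀ / (γ * η * ε ^ 2) + 2 / p⌉₊ }

/-- The heterogeneity `∑ i, ‖∇f_i(z₀) - ∇f(z₀)‖²` of the local gradients at `z₀`. -/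
def heterogeneity {m dx dy : ℕ} {Ξ : Type*} [MeasurableSpace Ξ] (D : Fin m → Measure Ξ)
    (F : Fin m → ZSpace dx dy → Ξ → ℝ) (z₀ : ZSpace dx dy) : ℝ :=
  ∑ i, ‖gradient (localObj (D i) (F i)) z₀ - gradient (globalObj D F) z₀‖ ^ 2

/-- `𝔼[X]` is well defined and at most `c`. -/
def ExpectationLE {Ω : Type*} [MeasurableSpace Ω] (ν : Measure Ω) (X : Ω → ℝ) (c : ℝ) : Prop :=
  Integrable X ν ∧ ∫ o, X o ∂ν ≤ c

end

end Dream

/-! The analysis follows the averages of the agents' variables. FastMix with a doubly stochastic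
matrix preserves averages, and gradient tracking keeps the mean of `s` equal to the mean of `g`
(`Setup.invariant_step`). So the mean iterate performs an inexact projected gradient descent ascent
step on f. It deviates from an exact step through the noise of the mean gradient estimator, the
disagreement of the iterates and the disagreement of the trackers.

Optimisation: strong concavity makes the maximiser y*(x) κ-Lipschitz, hence P is differentiable with
the 2κL-Lipschitz gradient ∇ₓf(x, y*(x)) (`primal_sub_le`). An inexact step decreases P + α(P − f)
by γη‖∇P‖²/2 and by multiples of the squared steps in x and y, up to the errors (`merit_descent`).
The choice γ ~ κ⁻² makes x so slow that the contraction 1 − ημ/2 of the gap P − f dominates the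
drift of the maximiser. The mean of the agents' projections is not a projection, but it satisfies
the variational inequality up to a quarter of the mean consensus error (`inner_avg_proj_le`).

Noise: the small batch estimator is recursive and its increments are unbiased and independent across
agents. The noise therefore grows by at most 2L²/(mbq) times the mean squared displacement, and is
reset with probability p (`expectationLE_noise_step`). Since (1 − p)/(mbq) = p, weighting the noise
by η/(5p) leaves a term L/120 times the displacement, paid for by the squared steps gained in the
descent. Besides the mean error, `noise` contains the local errors with weight 1/m², because a
refresh of the estimators feeds the old local errors into the trackers.

Consensus: in an eigenbasis of W, FastMix is a scalar two-term recursion whose characteristic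
quadratic form shrinks by exactly the momentum at each step. This yields the rate 1 − c₂√δ
(`cons_fastMix_le`). The round numbers K and K' bring the contraction factor down to 14⁻⁴, K' even
after multiplication by m², and K to at most 2·14⁻⁴ after multiplication by 1 + 1/(bq).

These estimates combine into one potential with negative expected drift (`Setup.potential_drift`),
which telescopes along the independent iterations (`expectationLE_run`) and bounds the mean of
𝔼‖∇P‖² over time and agents. For the costs put S = √(mb'). Then p = 1/(1 + S), an iteration costs at
most 3S gradients in expectation, and T is of order Ψ₀κ²L/ε² + S. -/

namespace Dream

noncomputable section

/-! ### Aggregated variables -/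

/-- The mean row of an aggregated variable. -/
def avg {m : ℕ} {V : Type*} [AddCommGroup V] [Module ℝ V] (a : Fin m → V) : V :=
  (1 / (m : ℝ)) • ∑ i, a i

/-- The consensus error `∑ i, ‖a i - avg a‖²`. -/
def cons {m : ℕ} {V : Type*} [NormedAddCommGroup V] [Module ℝ V] (a : Fin m → V) : ℝ :=
  ∑ i, ‖a i - avg a‖ ^ 2

section Avg

variable {m : ℕ} {V : Type*} [AddCommGroup V] [Module ℝ V]

theorem avg_add (a b : Fin m → V) : avg (a + b) = avg a + avg b := by
  simp [avg, Finset.sum_add_distrib]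

theorem avg_sub (a b : Fin m → V) : avg (a - b) = avg a - avg b := by
  simp [avg, Finset.sum_sub_distrib, smul_sub]

theorem avg_smul (c : ℝ) (a : Fin m → V) : avg (c • a) = c • avg a := by
  simp [avg, ← Finset.smul_sum, smul_comm c]

theorem avg_const (hm : m ≠ 0) (v : V) : avg (fun _ : Fin m => v) = v := by
  have : (m : ℝ) ≠ 0 := by exact_mod_cast hm
  simp only [avg, Finset.sum_const, Finset.card_univ, Fintype.card_fin]
  rw [← Nat.cast_smul_eq_nsmul ℝ, smul_smul, one_div, inv_mul_cancel₀ this, one_smul]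

theorem sum_eq_smul_avg (hm : m ≠ 0) (a : Fin m → V) : ∑ i, a i = (m : ℝ) • avg a := by
  have : (m : ℝ) ≠ 0 := by exact_mod_cast hm
  rw [avg, smul_smul, mul_one_div_cancel this, one_smul]

theorem sum_sub_avg (hm : m ≠ 0) (a : Fin m → V) : ∑ i, (a i - avg a) = 0 := by
  rw [Finset.sum_sub_distrib, sum_eq_smul_avg hm a]
  simp [← Nat.cast_smul_eq_nsmul ℝ]

theorem avg_mix {W : Matrix (Fin m) (Fin m) ℝ} (hW : W ∈ doublyStochastic ℝ (Fin m))
    (a : Fin m → V) : avg (mix W a) = avg a := by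
  simp only [avg, mix]
  rw [Finset.sum_comm]
  congr 1
  refine Finset.sum_congr rfl fun j _ => ?_
  rw [← Finset.sum_smul, sum_col_of_mem_doublyStochastic hW, one_smul]

theorem avg_fastMixIter {W : Matrix (Fin m) (Fin m) ℝ} (hW : W ∈ doublyStochastic ℝ (Fin m))
    (lam2 : ℝ) (a : Fin m → V) (k : ℕ) :
    avg (fastMixIter W lam2 a k).1 = avg a ∧ avg (fastMixIter W lam2 a k).2 = avg a := by
  induction k with
  | zero => exact ⟨rfl, rfl⟩
  | succ k ih =>
    refine ⟨ih.2, ?_⟩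
    simp only [fastMixIter, avg_sub, avg_smul, avg_mix hW, ih.1, ih.2]
    rw [← sub_smul]
    simp

theorem avg_fastMix {W : Matrix (Fin m) (Fin m) ℝ} (hW : W ∈ doublyStochastic ℝ (Fin m))
    (lam2 : ℝ) (a : Fin m → V) (k : ℕ) : avg (fastMix W lam2 a k) = avg a :=
  (avg_fastMixIter hW lam2 a k).2

end Avg

/-! ### The convergence rate of FastMix -/

/-- The scalar recursion followed by FastMix on an eigenspace of `W`. -/
def mixCoeff (e l : ℝ) : ℕ → ℝ × ℝ
  | 0 => (1, 1)
  | k + 1 => ((mixCoeff e l k).2, (1 + e) * l * (mixCoeff e l k).2 - e * (mixCoeff e l k).1)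

/-- The quadratic form of the characteristic polynomial z² − (1 + e)lz + e is multiplied by the
determinant e of the recursion at every step. This avoids a closed formula with complex roots. -/
theorem mixCoeff_invariant (e l : ℝ) (k : ℕ) :
    (mixCoeff e l k).2 ^ 2 - (1 + e) * l * (mixCoeff e l k).2 * (mixCoeff e l k).1
      + e * (mixCoeff e l k).1 ^ 2 = e ^ k * ((1 + e) * (1 - l)) := by
  induction k with
  | zero => simp [mixCoeff]; ring
  | succ k ih =>
    simp only [mixCoeff]
    linear_combination e * ih

/-- The momentum makes the form in `mixCoeff_invariant` positive definite for every l in [0, λ₂], so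
minimising it over the older iterate leaves a positive multiple of the newer one squared. The
constant is uniform because the factor 1 − l in the initial value of the form compensates the
degeneration of that multiple near l = 1. -/
theorem mixCoeff_sq_le {lam2 l : ℝ} (h1 : lam2 < 1) (hl : 0 ≤ l) (hl2 : l ≤ lam2) (k : ℕ) :
    (mixCoeff (1 / (1 + √(1 - lam2 ^ 2))) l k).2 ^ 2
      ≤ 14 * (1 / (1 + √(1 - lam2 ^ 2))) ^ k := by
  set s := √(1 - lam2 ^ 2) with hs
  have hs0 : 0 ≤ s := Real.sqrt_nonneg _
  have hs2 : s ^ 2 = 1 - lam2 ^ 2 := Real.sq_sqrt (by nlinarith)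
  set e := 1 / (1 + s) with he
  have he0 : 0 < e := by positivity
  have hes : e * (1 + s) = 1 := by rw [he]; field_simp
  have inv := mixCoeff_invariant e l k
  set r := (mixCoeff e l k).2
  set q := (mixCoeff e l k).1
  have hek : 0 ≤ e ^ k := by positivity
  have hq : s ^ 2 ≤ 1 - l ^ 2 := by nlinarith
  have hq0 : 0 < 1 - l ^ 2 := by nlinarith
  have hS : 0 < 4 * (1 + s) - (2 + s) ^ 2 * l ^ 2 := by nlinarith [mul_nonneg hs0 hq0.le]
  have hmain : 4 * (2 + s) * (1 - l) ≤ 14 * (4 * (1 + s) - (2 + s) ^ 2 * l ^ 2) := by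
    nlinarith [mul_nonneg hs0 hq0.le, mul_nonneg (mul_nonneg hs0 hs0) hq0.le,
      mul_nonneg hl (sub_nonneg.2 (hl2.trans h1.le)), mul_nonneg hs0
        (mul_nonneg hl (sub_nonneg.2 (hl2.trans h1.le)))]
  -- Multiply the invariant by 4e and complete the square in the older iterate q.
  have hA : (4 * e - ((1 + e) * l) ^ 2) * r ^ 2 ≤ 4 * e * (e ^ k * ((1 + e) * (1 - l))) := by
    rw [← inv]
    nlinarith [sq_nonneg ((1 + e) * l * r - 2 * e * q)]
  have e1 : 4 * e - ((1 + e) * l) ^ 2 = e ^ 2 * (4 * (1 + s) - (2 + s) ^ 2 * l ^ 2) := by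
    have : 1 + e = e * (2 + s) := by linarith
    rw [this]
    linear_combination (-4 * e) * hes
  have e2 : 4 * e * (e ^ k * ((1 + e) * (1 - l))) = e ^ 2 * (e ^ k * (4 * (2 + s) * (1 - l))) := by
    have : 1 + e = e * (2 + s) := by linarith
    rw [this]
    ring
  rw [e1, e2, mul_assoc] at hA
  have hA' := le_of_mul_le_mul_left hA (by positivity)
  have hB : e ^ k * (4 * (2 + s) * (1 - l))
      ≤ e ^ k * (14 * (4 * (1 + s) - (2 + s) ^ 2 * l ^ 2)) := by gcongr
  refine le_of_mul_le_mul_left ?_ hS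
  linarith

/-- Equivalent to 2(1 − c₂)² = 1, the property that determines c₂. -/
theorem c₂_sq : c₂ ^ 2 = 2 * c₂ - 1 / 2 := by
  have h : (1 / √2 : ℝ) ^ 2 = 1 / 2 := by rw [div_pow, Real.sq_sqrt] <;> norm_num
  rw [c₂]
  linear_combination h

theorem c₂_pos : 1 / 4 < c₂ ∧ c₂ < 1 / 2 := by
  have h2 : 0 ≤ √2 := Real.sqrt_nonneg 2
  have h3 : √2 ^ 2 = 2 := Real.sq_sqrt (by norm_num)
  have h4 : 0 < √2 := by positivity
  have : 1 / √2 = √2 / 2 := by field_simp; linarith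
  rw [c₂, this]
  constructor <;> nlinarith

theorem rate_nonneg {d : ℝ} (h1 : d ≤ 1) : 0 < 1 - c₂ * √d := by
  have : √d ≤ 1 := Real.sqrt_le_one.2 h1
  have h2 := Real.sqrt_nonneg d
  have := c₂_pos
  nlinarith

/-- With u = √(1 − λ₂), the momentum is at most 1/(1 + u). The difference (1 − c₂u)²(1 + u) − 1
vanishes at u = 0 and, by the choice of c₂, at u = 1; the remaining linear factor is nonnegative on
[0, 1]. -/
theorem momentum_le_rate_sq {lam2 : ℝ} (h0 : 0 ≤ lam2) (h1 : lam2 < 1) :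
    1 / (1 + √(1 - lam2 ^ 2)) ≤ (1 - c₂ * √(1 - lam2)) ^ 2 := by
  set u := √(1 - lam2) with hu
  have hu0 : 0 ≤ u := Real.sqrt_nonneg _
  have hu1 : u ≤ 1 := Real.sqrt_le_one.2 (by linarith)
  have hsu : u ≤ √(1 - lam2 ^ 2) := Real.sqrt_le_sqrt (by nlinarith)
  have hc := c₂_pos
  calc 1 / (1 + √(1 - lam2 ^ 2)) ≤ 1 / (1 + u) := by gcongr
    _ ≤ _ := by
      rw [div_le_iff₀ (by positivity)]
      have : (1 - c₂ * u) ^ 2 * (1 + u) - 1 = u * (1 - u) * ((1 - 2 * c₂) - c₂ ^ 2 * u) := by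
        linear_combination (2 * u ^ 2) * c₂_sq
      have h5 : 0 ≤ u * (1 - u) * ((1 - 2 * c₂) - c₂ ^ 2 * u) := by
        apply mul_nonneg (mul_nonneg hu0 (by linarith))
        rw [c₂_sq]
        have h3 : √2 ^ 2 = 2 := Real.sq_sqrt (by norm_num)
        nlinarith [c₂_sq]
      linarith

/-! ### The spectrum of the mixing matrix -/

/-- Expand the square: unit row and column sums turn both pure terms into ‖v‖², and the cross term
is the quadratic form of A at an eigenvector. Nonnegativity of the left side bounds the eigenvalues
by 1, and its vanishing characterises the eigenvalue 1. -/
theorem dirichlet_form {m : ℕ} {A : Matrix (Fin m) (Fin m) ℝ}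
    (hA : A ∈ doublyStochastic ℝ (Fin m)) {v : Fin m → ℝ} {l : ℝ}
    (hv : A.mulVec v = l • v) :
    ∑ i, ∑ k, A i k * (v i - v k) ^ 2 = 2 * (1 - l) * ∑ i, v i ^ 2 := by
  have h1 : ∑ i, ∑ k, A i k * v i ^ 2 = ∑ i, v i ^ 2 := by
    refine Finset.sum_congr rfl fun i _ => ?_
    rw [← Finset.sum_mul, sum_row_of_mem_doublyStochastic hA, one_mul]
  have h2 : ∑ i, ∑ k, A i k * v k ^ 2 = ∑ i, v i ^ 2 := by
    rw [Finset.sum_comm]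
    refine Finset.sum_congr rfl fun i _ => ?_
    rw [← Finset.sum_mul, sum_col_of_mem_doublyStochastic hA, one_mul]
  have h3 : ∑ i, ∑ k, A i k * (v i * v k) = l * ∑ i, v i ^ 2 := by
    rw [Finset.mul_sum]
    refine Finset.sum_congr rfl fun i _ => ?_
    have := congrFun hv i
    simp only [Matrix.mulVec, dotProduct, Pi.smul_apply, smul_eq_mul] at this
    calc ∑ k, A i k * (v i * v k) = v i * ∑ k, A i k * v k := by
          rw [Finset.mul_sum]; exact Finset.sum_congr rfl fun _ _ => by ring
      _ = _ := by rw [this]; ring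
  calc ∑ i, ∑ k, A i k * (v i - v k) ^ 2
      = ∑ i, ∑ k, A i k * v i ^ 2 + ∑ i, ∑ k, A i k * v k ^ 2
        - 2 * ∑ i, ∑ k, A i k * (v i * v k) := by
        simp only [Finset.mul_sum, ← Finset.sum_add_distrib, ← Finset.sum_sub_distrib]
        exact Finset.sum_congr rfl fun _ _ => Finset.sum_congr rfl fun _ _ => by ring
    _ = _ := by rw [h1, h2, h3]; ring

theorem eigenvalue_le_one {m : ℕ} {A : Matrix (Fin m) (Fin m) ℝ}
    (hA : A ∈ doublyStochastic ℝ (Fin m)) {v : Fin m → ℝ} {l : ℝ}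
    (hv : A.mulVec v = l • v) (hv0 : ∑ i, v i ^ 2 = 1) : l ≤ 1 := by
  have h := dirichlet_form hA hv
  have : 0 ≤ ∑ i, ∑ k, A i k * (v i - v k) ^ 2 :=
    Finset.sum_nonneg fun i _ => Finset.sum_nonneg fun k _ =>
      mul_nonneg (nonneg_of_mem_doublyStochastic hA) (sq_nonneg _)
  rw [hv0] at h
  linarith

theorem mulVec_pow_of_fixed {m : ℕ} {A : Matrix (Fin m) (Fin m) ℝ} {v : Fin m → ℝ}
    (hv : A.mulVec v = v) (k : ℕ) : (A ^ k).mulVec v = v := by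
  induction k with
  | zero => simp
  | succ k ih => rw [pow_succ, ← Matrix.mulVec_mulVec, hv, ih]

/-- By irreducibility some power of A has a positive (i, j) entry. That power is again doubly
stochastic and fixes v, so its Dirichlet form at v vanishes term by term. -/
theorem fixed_vector_const {m : ℕ} {A : Matrix (Fin m) (Fin m) ℝ}
    (hA : A ∈ doublyStochastic ℝ (Fin m)) (hirr : A.IsIrreducible) {v : Fin m → ℝ}
    (hv : A.mulVec v = v) (i j : Fin m) : v i = v j := by
  obtain ⟨k, -, hk⟩ := (Matrix.isIrreducible_iff_exists_pow_pos hirr.nonneg).1 hirr i j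
  have hAk : A ^ k ∈ doublyStochastic ℝ (Fin m) := pow_mem hA k
  have h := dirichlet_form (l := 1) hAk (by rw [mulVec_pow_of_fixed hv, one_smul])
  rw [sub_self, mul_zero, zero_mul] at h
  have hnn : ∀ a b, 0 ≤ (A ^ k) a b * (v a - v b) ^ 2 := fun a b =>
    mul_nonneg (nonneg_of_mem_doublyStochastic hAk) (sq_nonneg _)
  have h1 := (Finset.sum_eq_zero_iff_of_nonneg
    (fun a _ => Finset.sum_nonneg fun b _ => hnn a b)).1 h i (Finset.mem_univ i)
  have h2 := (Finset.sum_eq_zero_iff_of_nonneg (fun b _ => hnn i b)).1 h1 j (Finset.mem_univ j)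
  rcases mul_eq_zero.1 h2 with h3 | h3
  · exact absurd h3 hk.ne'
  · have := pow_eq_zero_iff (two_ne_zero) |>.1 h3
    linarith

theorem lambda2_nonneg {m : ℕ} {W : Matrix (Fin m) (Fin m) ℝ} (hW : W.PosSemidef) (hm : 2 ≤ m) :
    0 ≤ lambda2 hW.isHermitian hm := by
  set idx : Fin (Fintype.card (Fin m)) := ⟨1, by rw [Fintype.card_fin]; omega⟩
  have := hW.eigenvalues_nonneg
    ((Fintype.equivOfCardEq (Fintype.card_fin _) : Fin (Fintype.card (Fin m)) ≃ Fin m) idx)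
  simpa [Matrix.IsHermitian.eigenvalues, lambda2] using this

/-- An orthonormal eigenbasis of the mixing matrix, in which all eigenvectors but a constant one
are orthogonal to the constants and have eigenvalue at most `λ₂ < 1`. -/
theorem exists_eigenbasis {m : ℕ} {G : SimpleGraph (Fin m)} {W : Matrix (Fin m) (Fin m) ℝ}
    (hW : MixingMatrix G W) (hm : 2 ≤ m) :
    lambda2 hW.posSemidef.isHermitian hm < 1 ∧
    ∃ (e : Fin m → Fin m → ℝ) (l : Fin m → ℝ),
      (∀ i k, ∑ j, e j i * e j k = if i = k then 1 else 0) ∧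
      (∀ j, W.mulVec (e j) = l j • e j) ∧
      ∀ j, (0 ≤ l j ∧ l j ≤ lambda2 hW.posSemidef.isHermitian hm) ∨ ∃ c, ∀ i, e j i = c := by
  set H := hW.posSemidef.isHermitian
  set B := H.eigenvectorBasis
  set e : Fin m → Fin m → ℝ := fun j i => B j i with he
  set l := H.eigenvalues with hl
  have heig : ∀ j, W.mulVec (e j) = l j • e j := fun j => H.mulVec_eigenvectorBasis j
  have hinner : ∀ j j', ∑ i, e j i * e j' i = if j = j' then 1 else 0 := by
    intro j j'
    have := orthonormal_iff_ite.1 B.orthonormal j j'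
    rw [← this, PiLp.inner_apply]
    exact Finset.sum_congr rfl fun i _ => by simp [he, mul_comm]
  have hrow : ∀ i k, ∑ j, e j i * e j k = if i = k then 1 else 0 := by
    intro i k
    have := B.sum_inner_mul_inner (EuclideanSpace.single i (1 : ℝ)) (EuclideanSpace.single k 1)
    simp only [EuclideanSpace.inner_single_left, EuclideanSpace.inner_single_right] at this
    simp only [map_one, one_mul] at this
    simp only [he]
    rw [show (∑ j, (B j) i * (B j) k) = ∑ x, (B x) i * (starRingEnd ℝ) ((B x) k) by simp, this]
    simp [eq_comm]
  have hnorm : ∀ j, ∑ i, e j i ^ 2 = 1 := fun j => by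
    have := hinner j j
    simpa [sq] using this
  have hle1 : ∀ j, l j ≤ 1 := fun j => eigenvalue_le_one hW.doublyStochastic (heig j) (hnorm j)
  have hconst : ∀ j, l j = 1 → ∀ i k, e j i = e j k := fun j hj =>
    fixed_vector_const hW.doublyStochastic hW.irreducible (by rw [heig j, hj, one_smul])
  -- Two nonzero constant vectors are never orthogonal, so the eigenvalue 1 is simple.
  have huniq : ∀ j j', l j = 1 → l j' = 1 → j = j' := by
    intro j j' h h'
    by_contra hne
    have h0 := hinner j j'
    rw [if_neg hne] at h0
    have i0 : Fin m := ⟨0, by omega⟩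
    have c1 := hconst j h
    have c2 := hconst j' h'
    rw [Finset.sum_congr rfl (g := fun _ => e j i0 * e j' i0)
      (fun i _ => by rw [c1 i i0, c2 i i0])] at h0
    have n1 := hnorm j
    have n2 := hnorm j'
    rw [Finset.sum_congr rfl (g := fun _ => e j i0 ^ 2) (fun i _ => by rw [c1 i i0])] at n1
    rw [Finset.sum_congr rfl (g := fun _ => e j' i0 ^ 2) (fun i _ => by rw [c2 i i0])] at n2
    simp only [Finset.sum_const, Finset.card_univ, Fintype.card_fin, nsmul_eq_mul] at h0 n1 n2
    have hm0 : (m : ℝ) ≠ 0 := by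
      have : m ≠ 0 := by omega
      exact_mod_cast this
    rcases mul_eq_zero.1 ((mul_eq_zero.1 h0).resolve_left hm0) with h | h <;>
      simp [h] at n1 n2
  have hcard : Fintype.card (Fin (Fintype.card (Fin m))) = Fintype.card (Fin m) :=
    Fintype.card_fin _
  set eqv : Fin (Fintype.card (Fin m)) ≃ Fin m := Fintype.equivOfCardEq hcard with heqv
  have hl0 : ∀ a, H.eigenvalues₀ a = l (eqv a) := fun a => by
    simp [hl, Matrix.IsHermitian.eigenvalues, heqv]
  -- Unit column sums give e_j and W e_j the same coordinate sum.
  have hsum : ∀ j, l j ≠ 1 → ∑ i, e j i = 0 := by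
    intro j hj
    have h1 : ∑ i, (W.mulVec (e j)) i = ∑ k, e j k := by
      simp only [Matrix.mulVec, dotProduct]
      rw [Finset.sum_comm]
      refine Finset.sum_congr rfl fun k _ => ?_
      rw [← Finset.sum_mul, sum_col_of_mem_doublyStochastic hW.doublyStochastic, one_mul]
    rw [heig j] at h1
    simp only [Pi.smul_apply, smul_eq_mul, ← Finset.mul_sum] at h1
    have : (l j - 1) * ∑ i, e j i = 0 := by linarith
    exact (mul_eq_zero.1 this).resolve_left (sub_ne_zero.2 hj)
  set z0 : Fin (Fintype.card (Fin m)) := ⟨0, by rw [Fintype.card_fin]; omega⟩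
  set z1 : Fin (Fintype.card (Fin m)) := ⟨1, by rw [Fintype.card_fin]; omega⟩
  have hlam : lambda2 H hm = H.eigenvalues₀ z1 := rfl
  have hanti := H.eigenvalues₀_antitone
  have h01 : z0 ≠ z1 := by simp [z0, z1]
  have hlt : lambda2 H hm < 1 := by
    rw [hlam]
    by_contra hcon
    push Not at hcon
    have h1 : H.eigenvalues₀ z1 = 1 := le_antisymm (by rw [hl0]; exact hle1 _) hcon
    have h0 : H.eigenvalues₀ z0 = 1 :=
      le_antisymm (by rw [hl0]; exact hle1 _) (hcon.trans (hanti (by simp [z0, z1])))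
    rw [hl0] at h0 h1
    exact h01 (eqv.injective (huniq _ _ h0 h1))
  refine ⟨hlt, e, l, hrow, heig, fun j => ?_⟩
  by_cases hj : l j = 1
  · exact Or.inr ⟨e j ⟨0, by omega⟩, fun i => hconst j hj i _⟩
  left
  refine ⟨hW.posSemidef.eigenvalues_nonneg j, ?_⟩
  rw [hlam]
  have hj' : l j = H.eigenvalues₀ (eqv.symm j) := by rw [hl0]; simp
  -- The largest eigenvalue must be 1: otherwise all eigenvectors would have coordinate sum zero,
  -- against the completeness relation summed over one index. Every other position in the decreasing
  -- order is at least 1, so its eigenvalue is at most λ₂.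
  by_cases hz : (eqv.symm j) = z0
  · exfalso
    have hall : ∀ j', l j' ≠ 1 := by
      intro j' h
      have h2 : l j' ≤ l j := by
        rw [show l j' = H.eigenvalues₀ (eqv.symm j') by rw [hl0]; simp, hj', hz]
        exact hanti (by simp [z0, Fin.le_def])
      exact hj (le_antisymm (hle1 j) (h ▸ h2))
    have hm0 : 0 < m := by omega
    have i0 : Fin m := ⟨0, hm0⟩
    have h3 : ∑ k, ∑ j, e j i0 * e j k = 1 := by simp [hrow]
    rw [Finset.sum_comm] at h3
    simp [← Finset.mul_sum, fun j => hsum j (hall j)] at h3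
  · rw [hj']
    refine hanti ?_
    rw [Fin.le_def]
    have : (eqv.symm j).val ≠ 0 := fun h => hz (Fin.ext h)
    show 1 ≤ _
    omega

/-! ### FastMix in an eigenbasis of the mixing matrix. -/

section FastMix

variable {m : ℕ} {V : Type*} [NormedAddCommGroup V] [InnerProductSpace ℝ V]

theorem parseval {e : Fin m → Fin m → ℝ}
    (he : ∀ i k, ∑ j, e j i * e j k = if i = k then 1 else 0) (a : Fin m → V) :
    ∑ j, ‖∑ i, e j i • a i‖ ^ 2 = ∑ i, ‖a i‖ ^ 2 := by
  have : ∀ j, ‖∑ i, e j i • a i‖ ^ 2 = ∑ i, ∑ k, (e j i * e j k) * inner ℝ (a i) (a k) := by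
    intro j
    rw [← real_inner_self_eq_norm_sq, sum_inner]
    refine Finset.sum_congr rfl fun i _ => ?_
    rw [inner_sum]
    refine Finset.sum_congr rfl fun k _ => ?_
    rw [real_inner_smul_left, real_inner_smul_right]
    ring
  simp only [this]
  rw [Finset.sum_comm]
  refine Finset.sum_congr rfl fun i _ => ?_
  rw [Finset.sum_comm]
  simp only [← Finset.sum_mul, he]
  simp

/-- Symmetry lets W act on the coefficients v instead of on the rows. Hence every eigencomponent of
FastMix follows the scalar recursion `mixCoeff`. -/
theorem sum_smul_mix {W : Matrix (Fin m) (Fin m) ℝ} (hs : W.IsSymm) {v : Fin m → ℝ} {l : ℝ}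
    (hv : W.mulVec v = l • v) (a : Fin m → V) :
    ∑ i, v i • mix W a i = l • ∑ i, v i • a i := by
  simp only [mix, Finset.smul_sum, smul_smul]
  rw [Finset.sum_comm]
  refine Finset.sum_congr rfl fun k _ => ?_
  rw [← Finset.sum_smul]
  congr 1
  have := congrFun hv k
  simp only [Matrix.mulVec, dotProduct, Pi.smul_apply, smul_eq_mul] at this
  rw [← this]
  exact Finset.sum_congr rfl fun i _ => by rw [hs.apply, mul_comm]

theorem sum_smul_fastMixIter {W : Matrix (Fin m) (Fin m) ℝ} (hs : W.IsSymm) {v : Fin m → ℝ}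
    {l : ℝ} (hv : W.mulVec v = l • v) (lam2 : ℝ) (a : Fin m → V) (k : ℕ) :
    ∑ i, v i • (fastMixIter W lam2 a k).1 i
        = (mixCoeff (1 / (1 + √(1 - lam2 ^ 2))) l k).1 • ∑ i, v i • a i ∧
      ∑ i, v i • (fastMixIter W lam2 a k).2 i
        = (mixCoeff (1 / (1 + √(1 - lam2 ^ 2))) l k).2 • ∑ i, v i • a i := by
  induction k with
  | zero => simp [fastMixIter, mixCoeff]
  | succ k ih =>
    refine ⟨ih.2, ?_⟩
    simp only [fastMixIter, mixCoeff, Pi.sub_apply, Pi.smul_apply, smul_sub,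
      Finset.sum_sub_distrib]
    have h1 : ∀ (c : ℝ) (b : Fin m → V), ∑ i, v i • c • b i = c • ∑ i, v i • b i := by
      intro c b
      rw [Finset.smul_sum]
      exact Finset.sum_congr rfl fun i _ => smul_comm _ _ _
    rw [h1, h1, sum_smul_mix hs hv, ih.1, ih.2, smul_smul, smul_smul, smul_smul, ← sub_smul]
/-- FastMix contracts the consensus error. -/
theorem cons_fastMix_le {G : SimpleGraph (Fin m)} {W : Matrix (Fin m) (Fin m) ℝ}
    (hW : MixingMatrix G W) (hm : 2 ≤ m) (a : Fin m → V) (k : ℕ) :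
    cons (fastMix W (lambda2 hW.posSemidef.isHermitian hm) a k)
      ≤ 14 * (1 - c₂ * √(1 - lambda2 hW.posSemidef.isHermitian hm)) ^ (2 * k) * cons a := by
  obtain ⟨h1, e, l, hrow, heig, hdich⟩ := exists_eigenbasis hW hm
  have h0 := lambda2_nonneg hW.posSemidef hm
  set lam2 := lambda2 hW.posSemidef.isHermitian hm
  have hm0 : m ≠ 0 := by omega
  set b := fastMix W lam2 a k with hb
  set M := 14 * (1 - c₂ * √(1 - lam2)) ^ (2 * k)
  have hM : ∀ l', 0 ≤ l' → l' ≤ lam2 → (mixCoeff (1 / (1 + √(1 - lam2 ^ 2))) l' k).2 ^ 2 ≤ M := by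
    intro l' h0' h2'
    refine (mixCoeff_sq_le h1 h0' h2' k).trans ?_
    simp only [M]
    rw [pow_mul]
    gcongr
    exact momentum_le_rate_sq h0 h1
  have key : ∀ j, ‖∑ i, e j i • (b i - avg b)‖ ^ 2 ≤ M * ‖∑ i, e j i • (a i - avg a)‖ ^ 2 := by
    intro j
    have hM0 : 0 ≤ M := le_trans (sq_nonneg _) (hM 0 le_rfl h0)
    -- Centred rows have no component along a constant eigenvector. For the others, subtracting the
    -- mean does not change the component, and the eigenvalue lies in [0, λ₂].
    by_cases hc : ∃ c, ∀ i, e j i = c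
    · obtain ⟨c, hc⟩ := hc
      simp only [hc, ← Finset.smul_sum, sum_sub_avg hm0]
      simp
    · have hl := (hdich j).resolve_right hc
      have hsum : ∑ i, e j i = 0 := by
        have h1' : ∑ i, (W.mulVec (e j)) i = ∑ k, e j k := by
          simp only [Matrix.mulVec, dotProduct]
          rw [Finset.sum_comm]
          refine Finset.sum_congr rfl fun k _ => ?_
          rw [← Finset.sum_mul, sum_col_of_mem_doublyStochastic hW.doublyStochastic, one_mul]
        rw [heig j] at h1'
        simp only [Pi.smul_apply, smul_eq_mul, ← Finset.mul_sum] at h1'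
        have : (l j - 1) * ∑ i, e j i = 0 := by linarith
        exact (mul_eq_zero.1 this).resolve_left (by linarith [hl.2])
      have hz : ∀ (x : Fin m → V) (v : V), ∑ i, e j i • (x i - v) = ∑ i, e j i • x i := by
        intro x v
        simp only [smul_sub, Finset.sum_sub_distrib, ← Finset.sum_smul, hsum, zero_smul, sub_zero]
      rw [hz, hz, hb, fastMix, (sum_smul_fastMixIter hW.symmetric (heig j) lam2 a k).2, norm_smul,
        mul_pow, Real.norm_eq_abs, sq_abs]
      gcongr
      exact hM _ hl.1 hl.2
  unfold cons
  rw [← parseval hrow (fun i => b i - avg b), ← parseval hrow (fun i => a i - avg a),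
    Finset.mul_sum]
  exact Finset.sum_le_sum fun j _ => key j

end FastMix

end

end Dream

namespace Dream

noncomputable section

theorem continuous_of_hasGradientAt {E : Type*} [NormedAddCommGroup E] [InnerProductSpace ℝ E]
    [CompleteSpace E] {f : E → ℝ} {g : E → E} (h : ∀ z, HasGradientAt f (g z) z) :
    Continuous f :=
  continuous_iff_continuousAt.2 fun z => (h z).hasFDerivAt.continuousAt

/-! ### Projections -/

section Proj

variable {dy : ℕ} {Y : Set (EuclideanSpace ℝ (Fin dy))}

/-- The Hilbert projection theorem provides the minimiser that the choice in `proj` needs, and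
minimality over a convex set is equivalent to the obtuse angle condition. -/
theorem proj_spec (hc : IsClosed Y) (hconv : Convex ℝ Y) (hne : Y.Nonempty)
    (y : EuclideanSpace ℝ (Fin dy)) :
    proj Y y ∈ Y ∧ ∀ w ∈ Y, inner ℝ (y - proj Y y) (w - proj Y y) ≤ 0 := by
  have hex : ∃ y', y' ∈ Y ∧ ∀ w ∈ Y, ‖y' - y‖ ≤ ‖w - y‖ := by
    obtain ⟨v, hv, h⟩ := exists_norm_eq_iInf_of_complete_convex hne hc.isComplete hconv y
    refine ⟨v, hv, fun w hw => ?_⟩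
    rw [norm_sub_rev v, norm_sub_rev w, h]
    exact ciInf_le ⟨0, by rintro _ ⟨z, rfl⟩; exact norm_nonneg _⟩ (⟨w, hw⟩ : Y)
  have hp : proj Y y ∈ Y ∧ ∀ w ∈ Y, ‖proj Y y - y‖ ≤ ‖w - y‖ := Classical.epsilon_spec hex
  refine ⟨hp.1, (norm_eq_iInf_iff_real_inner_le_zero hconv hp.1).1 ?_⟩
  have : Nonempty Y := hne.to_subtype
  refine le_antisymm (le_ciInf fun w => ?_) ?_
  · rw [norm_sub_rev, norm_sub_rev y]
    exact hp.2 w w.2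
  · exact ciInf_le ⟨0, by rintro _ ⟨z, rfl⟩; exact norm_nonneg _⟩ (⟨proj Y y, hp.1⟩ : Y)

/-- Add the two angle conditions, each tested at the other projection, and apply the Cauchy–Schwarz
inequality. -/
theorem norm_proj_sub_proj_le (hc : IsClosed Y) (hconv : Convex ℝ Y) (hne : Y.Nonempty)
    (y y' : EuclideanSpace ℝ (Fin dy)) : ‖proj Y y - proj Y y'‖ ≤ ‖y - y'‖ := by
  obtain ⟨h1, h1'⟩ := proj_spec hc hconv hne y
  obtain ⟨h2, h2'⟩ := proj_spec hc hconv hne y'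
  have a := h1' _ h2
  have b := h2' _ h1
  set p := proj Y y
  set p' := proj Y y'
  have e : inner ℝ (y - p) (p' - p) + inner ℝ (y' - p') (p - p')
      = ‖p - p'‖ ^ 2 - inner ℝ (y - y') (p - p') := by
    rw [← real_inner_self_eq_norm_sq, ← inner_neg_neg (y - p), neg_sub p' p, ← inner_add_left,
      ← inner_sub_left]
    congr 1
    abel
  have h := real_inner_le_norm (y - y') (p - p')
  by_contra hcon
  push Not at hcon
  have : 0 ≤ ‖y - y'‖ := norm_nonneg _
  nlinarith

theorem continuous_proj (hc : IsClosed Y) (hconv : Convex ℝ Y) (hne : Y.Nonempty) :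
    Continuous (proj Y) := by
  have : LipschitzWith 1 (proj Y) := LipschitzWith.of_dist_le_mul fun a b => by
    simpa [dist_eq_norm] using norm_proj_sub_proj_le hc hconv hne a b
  exact this.continuous

end Proj

/-! ### Consensus errors -/

section Norm

variable {V : Type*} [NormedAddCommGroup V]

theorem norm_add_sq_le_two (x y : V) : ‖x + y‖ ^ 2 ≤ 2 * ‖x‖ ^ 2 + 2 * ‖y‖ ^ 2 := by
  have h := norm_add_le x y
  have h0 := norm_nonneg (x + y)
  nlinarith [sq_nonneg (‖x‖ - ‖y‖)]

theorem norm_sub_sq_le_two (x y : V) : ‖x - y‖ ^ 2 ≤ 2 * ‖x‖ ^ 2 + 2 * ‖y‖ ^ 2 := by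
  simpa [sub_eq_add_neg] using norm_add_sq_le_two x (-y)

theorem norm_add_three_sq_le (x y z : V) :
    ‖x + y + z‖ ^ 2 ≤ 3 * ‖x‖ ^ 2 + 3 * ‖y‖ ^ 2 + 3 * ‖z‖ ^ 2 := by
  have h := norm_add₃_le (a := x) (b := y) (c := z)
  have h0 := norm_nonneg (x + y + z)
  nlinarith [sq_nonneg (‖x‖ - ‖y‖), sq_nonneg (‖x‖ - ‖z‖), sq_nonneg (‖y‖ - ‖z‖)]

end Norm

section Cons

variable {m : ℕ} {V : Type*} [NormedAddCommGroup V] [InnerProductSpace ℝ V]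

theorem cons_nonneg (a : Fin m → V) : 0 ≤ cons a := Finset.sum_nonneg fun _ _ => sq_nonneg _

/-- The cross terms vanish because the centred rows sum to zero. In particular the mean minimises
the sum of squared distances. -/
theorem sum_norm_sub_sq (hm : m ≠ 0) (a : Fin m → V) (v : V) :
    ∑ i, ‖a i - v‖ ^ 2 = cons a + m * ‖avg a - v‖ ^ 2 := by
  have h : ∀ i, ‖a i - v‖ ^ 2
      = ‖a i - avg a‖ ^ 2 + 2 * inner ℝ (a i - avg a) (avg a - v) + ‖avg a - v‖ ^ 2 := fun i => by
    rw [← norm_add_sq_real, sub_add_sub_cancel]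
  simp only [h, Finset.sum_add_distrib, ← Finset.mul_sum, ← sum_inner, sum_sub_avg hm]
  simp [cons]

theorem cons_le_sum (hm : m ≠ 0) (a : Fin m → V) (v : V) : cons a ≤ ∑ i, ‖a i - v‖ ^ 2 := by
  rw [sum_norm_sub_sq hm]
  have : 0 ≤ (m : ℝ) * ‖avg a - v‖ ^ 2 := by positivity
  linarith

theorem norm_avg_sq_le (hm : m ≠ 0) (a : Fin m → V) : m * ‖avg a‖ ^ 2 ≤ ∑ i, ‖a i‖ ^ 2 := by
  have := sum_norm_sub_sq hm a 0
  simp only [sub_zero] at this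
  linarith [cons_nonneg a]

theorem cons_le_sum_sq (hm : m ≠ 0) (a : Fin m → V) : cons a ≤ ∑ i, ‖a i‖ ^ 2 := by
  simpa using cons_le_sum hm a 0

theorem cons_add_le (a b : Fin m → V) : cons (a + b) ≤ 2 * cons a + 2 * cons b := by
  simp only [cons, avg_add, Finset.mul_sum, ← Finset.sum_add_distrib]
  refine Finset.sum_le_sum fun i _ => ?_
  have : (a + b) i - (avg a + avg b) = (a i - avg a) + (b i - avg b) := by
    simp only [Pi.add_apply]; abel
  rw [this]
  exact norm_add_sq_le_two _ _

theorem cons_smul (c : ℝ) (a : Fin m → V) : cons (c • a) = c ^ 2 * cons a := by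
  simp only [cons, avg_smul, Finset.mul_sum, Pi.smul_apply, ← smul_sub, norm_smul, mul_pow,
    Real.norm_eq_abs, sq_abs]

theorem cons_const (hm : m ≠ 0) (v : V) : cons (fun _ : Fin m => v) = 0 := by
  simp [cons, avg_const hm]

theorem norm_avg_sub_sq_le (hm : m ≠ 0) (a b : Fin m → V) :
    ‖avg a - avg b‖ ^ 2 ≤ (1 / m : ℝ) * ∑ i, ‖a i - b i‖ ^ 2 := by
  have h := norm_avg_sq_le hm (a - b)
  rw [avg_sub] at h
  have hm' : (0 : ℝ) < m := by positivity
  rw [one_div, ← div_eq_inv_mul, le_div_iff₀ hm', mul_comm]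
  exact h

end Cons

section AvgProj

variable {m dy : ℕ} {Y : Set (EuclideanSpace ℝ (Fin dy))}

theorem avg_mem (hm : m ≠ 0) (hconv : Convex ℝ Y) {a : Fin m → EuclideanSpace ℝ (Fin dy)}
    (ha : ∀ i, a i ∈ Y) : avg a ∈ Y := by
  rw [avg, Finset.smul_sum]
  refine hconv.sum_mem (fun _ _ => by positivity) ?_ fun i _ => ha i
  have : (m : ℝ) ≠ 0 := by exact_mod_cast hm
  simp [this]

/-- Replace the mean of the projections by the projection of the mean, which can only increase the
sum of squares, and use nonexpansiveness. -/
theorem cons_proj_le (hm : m ≠ 0) (hc : IsClosed Y) (hconv : Convex ℝ Y) (hne : Y.Nonempty)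
    (a : Fin m → EuclideanSpace ℝ (Fin dy)) : cons (fun i => proj Y (a i)) ≤ cons a := by
  refine (cons_le_sum hm _ (proj Y (avg a))).trans (Finset.sum_le_sum fun i _ => ?_)
  have := norm_proj_sub_proj_le hc hconv hne (a i) (avg a)
  gcongr

/-- The mean of the projections satisfies an inexact variational inequality. -/
theorem inner_avg_proj_le (hm : m ≠ 0) (hc : IsClosed Y) (hconv : Convex ℝ Y) (hne : Y.Nonempty)
    (a : Fin m → EuclideanSpace ℝ (Fin dy)) {w : EuclideanSpace ℝ (Fin dy)} (hw : w ∈ Y) :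
    inner ℝ (avg a - avg (fun i => proj Y (a i))) (w - avg (fun i => proj Y (a i)))
      ≤ cons a / (4 * m) := by
  set p : Fin m → EuclideanSpace ℝ (Fin dy) := fun i => proj Y (a i) with hp
  have hm' : (0 : ℝ) < m := by positivity
  have h1 : ∀ i, inner ℝ (a i - p i) (w - p i) ≤ 0 := fun i =>
    (proj_spec hc hconv hne (a i)).2 w hw
  -- Young's inequality is weighted so that the ‖p_i − p̄‖² it creates cancels the negative one,
  -- leaving only ‖a_i − ā‖²/4. The last inner product vanishes after summation over i.
  have h2 : ∀ i, inner ℝ (a i - p i) (w - avg p) ≤ (1 / 4) * ‖a i - avg a‖ ^ 2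
      + inner ℝ (avg a - avg p) (p i - avg p) := by
    intro i
    have e1 : inner ℝ (a i - p i) (w - avg p)
        = inner ℝ (a i - p i) (w - p i) + inner ℝ (a i - p i) (p i - avg p) := by
      rw [← inner_add_right, sub_add_sub_cancel]
    have e2 : inner ℝ (a i - p i) (p i - avg p)
        = inner ℝ (a i - avg a) (p i - avg p) + inner ℝ (avg a - avg p) (p i - avg p)
          - ‖p i - avg p‖ ^ 2 := by
      rw [← real_inner_self_eq_norm_sq, ← inner_add_left, ← inner_sub_left]
      congr 1
      abel
    have e3 := real_inner_le_norm (a i - avg a) (p i - avg p)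
    nlinarith [h1 i, sq_nonneg (‖a i - avg a‖ / 2 - ‖p i - avg p‖)]
  have h3 := Finset.sum_le_sum fun i (_ : i ∈ Finset.univ) => h2 i
  rw [← sum_inner, Finset.sum_add_distrib, ← inner_sum, ← Finset.mul_sum, sum_sub_avg hm,
    inner_zero_right, add_zero] at h3
  have h4 : ∑ i, (a i - p i) = (m : ℝ) • (avg a - avg p) := by
    rw [Finset.sum_sub_distrib, sum_eq_smul_avg hm, sum_eq_smul_avg hm, smul_sub]
  rw [h4, real_inner_smul_left] at h3
  rw [le_div_iff₀ (by positivity)]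
  simp only [cons]
  linarith

end AvgProj

/-! ### Smooth functions that are strongly concave in `y` -/

section Saddle

variable {dx dy : ℕ}

theorem pair_sub (x x' : EuclideanSpace ℝ (Fin dx)) (y y' : EuclideanSpace ℝ (Fin dy)) :
    pair x y - pair x' y' = pair (x - x') (y - y') := rfl

theorem norm_pair_sq (x : EuclideanSpace ℝ (Fin dx)) (y : EuclideanSpace ℝ (Fin dy)) :
    ‖pair x y‖ ^ 2 = ‖x‖ ^ 2 + ‖y‖ ^ 2 := WithLp.prod_norm_sq_eq_of_L2 _

theorem norm_pair_le (x : EuclideanSpace ℝ (Fin dx)) (y : EuclideanSpace ℝ (Fin dy)) :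
    ‖pair x y‖ ≤ ‖x‖ + ‖y‖ := by
  have := norm_pair_sq x y
  have h1 := norm_nonneg x
  have h2 := norm_nonneg y
  have h3 := norm_nonneg (pair x y)
  nlinarith

theorem norm_pair_zero_left (y : EuclideanSpace ℝ (Fin dy)) :
    ‖pair (0 : EuclideanSpace ℝ (Fin dx)) y‖ = ‖y‖ := by
  have := norm_pair_sq (0 : EuclideanSpace ℝ (Fin dx)) y
  rw [norm_zero] at this
  have h2 := norm_nonneg y
  have h3 := norm_nonneg (pair (0 : EuclideanSpace ℝ (Fin dx)) y)
  nlinarith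

theorem norm_pair_zero_right (x : EuclideanSpace ℝ (Fin dx)) :
    ‖pair x (0 : EuclideanSpace ℝ (Fin dy))‖ = ‖x‖ := by
  have := norm_pair_sq x (0 : EuclideanSpace ℝ (Fin dy))
  rw [norm_zero] at this
  have h2 := norm_nonneg x
  have h3 := norm_nonneg (pair x (0 : EuclideanSpace ℝ (Fin dy)))
  nlinarith

theorem norm_fst_le (z : ZSpace dx dy) : ‖z.fst‖ ≤ ‖z‖ := by
  have : ‖z‖ ^ 2 = ‖z.fst‖ ^ 2 + ‖z.snd‖ ^ 2 := WithLp.prod_norm_sq_eq_of_L2 _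
  have h1 := norm_nonneg z.fst
  have h3 := norm_nonneg z
  nlinarith [sq_nonneg ‖z.snd‖]

theorem norm_snd_le (z : ZSpace dx dy) : ‖z.snd‖ ≤ ‖z‖ := by
  have : ‖z‖ ^ 2 = ‖z.fst‖ ^ 2 + ‖z.snd‖ ^ 2 := WithLp.prod_norm_sq_eq_of_L2 _
  have h1 := norm_nonneg z.snd
  have h3 := norm_nonneg z
  nlinarith [sq_nonneg ‖z.fst‖]

theorem inner_pair_zero_left (g : ZSpace dx dy) (y : EuclideanSpace ℝ (Fin dy)) :
    inner ℝ g (pair (0 : EuclideanSpace ℝ (Fin dx)) y) = inner ℝ g.snd y := by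
  rw [WithLp.prod_inner_apply]; simp

theorem inner_pair_zero_right (g : ZSpace dx dy) (x : EuclideanSpace ℝ (Fin dx)) :
    inner ℝ g (pair x (0 : EuclideanSpace ℝ (Fin dy))) = inner ℝ g.fst x := by
  rw [WithLp.prod_inner_apply]; simp

/-- `f` has the `L`-Lipschitz gradient `gf` and is `μ`-strongly concave in `y`. -/
structure SmoothConcave (f : ZSpace dx dy → ℝ) (gf : ZSpace dx dy → ZSpace dx dy) (L μ : ℝ) :
    Prop where
  L_pos : 0 < L
  mu_pos : 0 < μ
  grad : ∀ z, HasGradientAt f (gf z) z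
  lip : ∀ z z', ‖gf z - gf z'‖ ≤ L * ‖z - z'‖
  conc : ∀ x y y', f (pair x y) ≤ f (pair x y') + inner ℝ (gf (pair x y')).snd (y - y')
      - μ / 2 * ‖y - y'‖ ^ 2

namespace SmoothConcave

variable {f : ZSpace dx dy → ℝ} {gf : ZSpace dx dy → ZSpace dx dy} {L μ : ℝ}

/-- The mean value inequality on the segment, applied to f minus its linearisation at z. It gives
the constant L instead of the sharp L/2, which suffices here. -/
theorem abs_sub_le (h : SmoothConcave f gf L μ) (z z' : ZSpace dx dy) :
    |f z' - f z - inner ℝ (gf z) (z' - z)| ≤ L * ‖z' - z‖ ^ 2 := by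
  have := Convex.norm_image_sub_le_of_norm_hasFDerivWithin_le' (𝕜 := ℝ) (f := f)
    (f' := fun w => InnerProductSpace.toDual ℝ _ (gf w)) (φ := InnerProductSpace.toDual ℝ _ (gf z))
    (C := L * ‖z' - z‖) (s := segment ℝ z z') (x := z) (y := z')
    (fun w _ => (h.grad w).hasFDerivAt.hasFDerivWithinAt) ?_ (convex_segment _ _)
    (left_mem_segment _ _ _) (right_mem_segment _ _ _)
  · rw [InnerProductSpace.toDual_apply_apply, Real.norm_eq_abs] at this
    rwa [sq, ← mul_assoc]
  · intro w hw
    rw [← map_sub, LinearIsometryEquiv.norm_map]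
    refine (h.lip w z).trans (mul_le_mul_of_nonneg_left ?_ h.L_pos.le)
    simpa [dist_eq_norm] using (norm_sub_le_of_mem_segment hw)

theorem continuous (h : SmoothConcave f gf L μ) : Continuous f :=
  continuous_of_hasGradientAt h.grad

theorem smooth_y (h : SmoothConcave f gf L μ) (x : EuclideanSpace ℝ (Fin dx))
    (y y' : EuclideanSpace ℝ (Fin dy)) :
    f (pair x y) + inner ℝ (gf (pair x y)).snd (y' - y) - L * ‖y' - y‖ ^ 2 ≤ f (pair x y') := by
  have := (abs_le.1 (h.abs_sub_le (pair x y) (pair x y'))).1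
  rw [pair_sub, sub_self, inner_pair_zero_left, norm_pair_zero_left] at this
  linarith

theorem smooth_x (h : SmoothConcave f gf L μ) (x x' : EuclideanSpace ℝ (Fin dx))
    (y : EuclideanSpace ℝ (Fin dy)) :
    |f (pair x' y) - f (pair x y) - inner ℝ (gf (pair x y)).fst (x' - x)| ≤ L * ‖x' - x‖ ^ 2 := by
  have := h.abs_sub_le (pair x y) (pair x' y)
  rwa [pair_sub, sub_self, inner_pair_zero_right, norm_pair_zero_right] at this

theorem lip_y (h : SmoothConcave f gf L μ) (x : EuclideanSpace ℝ (Fin dx))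
    (y y' : EuclideanSpace ℝ (Fin dy)) :
    ‖gf (pair x y) - gf (pair x y')‖ ≤ L * ‖y - y'‖ := by
  have := h.lip (pair x y) (pair x y')
  rwa [pair_sub x x y y', sub_self, norm_pair_zero_left] at this

theorem lip_x (h : SmoothConcave f gf L μ) (x x' : EuclideanSpace ℝ (Fin dx))
    (y : EuclideanSpace ℝ (Fin dy)) :
    ‖gf (pair x y) - gf (pair x' y)‖ ≤ L * ‖x - x'‖ := by
  have := h.lip (pair x y) (pair x' y)
  rwa [pair_sub x x' y y, sub_self, norm_pair_zero_right] at this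

theorem strong_mono (h : SmoothConcave f gf L μ) (x : EuclideanSpace ℝ (Fin dx))
    (y y' : EuclideanSpace ℝ (Fin dy)) :
    μ * ‖y - y'‖ ^ 2 ≤ inner ℝ ((gf (pair x y')).snd - (gf (pair x y)).snd) (y - y') := by
  have h1 := h.conc x y y'
  have h2 := h.conc x y' y
  have h3 : inner ℝ (gf (pair x y)).snd (y' - y) = - inner ℝ (gf (pair x y)).snd (y - y') := by
    rw [← inner_neg_right, neg_sub]
  rw [inner_sub_left]
  rw [norm_sub_rev y' y] at h2
  linarith

/-- Compare strong monotonicity with the Lipschitz bound along a unit vector of the y-space; this is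
where `dy ≥ 1` is needed. -/
theorem mu_le (h : SmoothConcave f gf L μ) (hdy : 1 ≤ dy) : μ ≤ L := by
  set y : EuclideanSpace ℝ (Fin dy) := EuclideanSpace.single ⟨0, hdy⟩ 1
  have hy : ‖y - 0‖ = 1 := by simp [y]
  have h1 := h.strong_mono 0 y 0
  have h2 := real_inner_le_norm ((gf (pair 0 0)).snd - (gf (pair 0 y)).snd) (y - 0)
  have h3 := (norm_snd_le (gf (pair 0 0) - gf (pair 0 y))).trans (h.lip_y 0 0 y)
  rw [norm_sub_rev 0 y, hy] at h3
  rw [hy] at h1 h2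
  have : (gf (pair 0 0) - gf (pair 0 y)).snd = (gf (pair 0 0)).snd - (gf (pair 0 y)).snd := rfl
  rw [this] at h3
  linarith

end SmoothConcave

/-- The maximizer of `f(x, ·)` on `Y`. -/
def yStar (Y : Set (EuclideanSpace ℝ (Fin dy))) (f : ZSpace dx dy → ℝ)
    (x : EuclideanSpace ℝ (Fin dx)) : EuclideanSpace ℝ (Fin dy) :=
  Classical.epsilon fun y => y ∈ Y ∧ ∀ w ∈ Y, f (pair x w) ≤ f (pair x y)

namespace SmoothConcave

variable {f : ZSpace dx dy → ℝ} {gf : ZSpace dx dy → ZSpace dx dy} {L μ : ℝ}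
  {Y : Set (EuclideanSpace ℝ (Fin dy))}

/-- Strong concavity at a feasible y₀ forces f(x, y) ≤ f(x, y₀) beyond distance 2‖∇_y f(x, y₀)‖/μ,
so a maximiser exists although Y may be unbounded. -/
theorem yStar_spec (h : SmoothConcave f gf L μ) (hc : IsClosed Y) (hne : Y.Nonempty)
    (x : EuclideanSpace ℝ (Fin dx)) :
    yStar Y f x ∈ Y ∧ ∀ w ∈ Y, f (pair x w) ≤ f (pair x (yStar Y f x)) := by
  refine Classical.epsilon_spec (p := fun y => y ∈ Y ∧ ∀ w ∈ Y, f (pair x w) ≤ f (pair x y)) ?_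
  obtain ⟨y0, hy0⟩ := hne
  have hcont : Continuous fun y => f (pair x y) := by
    have := h.continuous
    fun_prop
  set g := (gf (pair x y0)).snd
  have hbig : ∀ y, 2 * ‖g‖ / μ < ‖y - y0‖ → f (pair x y) ≤ f (pair x y0) := by
    intro y hy
    have h1 := h.conc x y y0
    have h2 := real_inner_le_norm g (y - y0)
    rw [div_lt_iff₀ h.mu_pos] at hy
    have h3 := norm_nonneg (y - y0)
    nlinarith
  obtain ⟨y, hy, hmax⟩ := hcont.continuousOn.exists_isMaxOn' (s := Y) hc hy0 (by
    have : ∀ᶠ y in Filter.cocompact (EuclideanSpace ℝ (Fin dy)), 2 * ‖g‖ / μ < ‖y - y0‖ := by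
      have ht : Filter.Tendsto (fun y : EuclideanSpace ℝ (Fin dy) => ‖y - y0‖)
          (Filter.cocompact _) Filter.atTop := by
        simpa [dist_eq_norm] using tendsto_dist_right_cocompact_atTop y0
      exact ht.eventually_gt_atTop _
    exact (this.mono hbig).filter_mono inf_le_left)
  exact ⟨y, hy, fun w hw => hmax hw⟩

theorem primal_eq (h : SmoothConcave f gf L μ) (hc : IsClosed Y) (hne : Y.Nonempty)
    (x : EuclideanSpace ℝ (Fin dx)) : primal Y f x = f (pair x (yStar Y f x)) := by
  obtain ⟨h1, h2⟩ := h.yStar_spec hc hne x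
  refine IsGreatest.csSup_eq ⟨⟨_, h1, rfl⟩, ?_⟩
  rintro _ ⟨w, hw, rfl⟩
  exact h2 w hw

theorem le_primal (h : SmoothConcave f gf L μ) (hc : IsClosed Y) (hne : Y.Nonempty)
    (x : EuclideanSpace ℝ (Fin dx)) {y : EuclideanSpace ℝ (Fin dy)} (hy : y ∈ Y) :
    f (pair x y) ≤ primal Y f x := by
  rw [h.primal_eq hc hne]
  exact (h.yStar_spec hc hne x).2 y hy

/-- First-order optimality: move a fraction t towards w inside Y and compare the linear gain with
the quadratic remainder. -/
theorem inner_yStar_le (h : SmoothConcave f gf L μ) (hc : IsClosed Y) (hconv : Convex ℝ Y)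
    (hne : Y.Nonempty) (x : EuclideanSpace ℝ (Fin dx)) {w : EuclideanSpace ℝ (Fin dy)}
    (hw : w ∈ Y) :
    inner ℝ (gf (pair x (yStar Y f x))).snd (w - yStar Y f x) ≤ 0 := by
  obtain ⟨h1, h2⟩ := h.yStar_spec hc hne x
  set ys := yStar Y f x
  set a := inner ℝ (gf (pair x ys)).snd (w - ys)
  have key : ∀ t : ℝ, 0 < t → t ≤ 1 → a ≤ t * (L * ‖w - ys‖ ^ 2) := by
    intro t ht ht1
    have hmem : ys + t • (w - ys) ∈ Y := hconv.add_smul_sub_mem h1 hw ⟨ht.le, ht1⟩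
    have h3 := h2 _ hmem
    have h4 := h.smooth_y x ys (ys + t • (w - ys))
    rw [add_sub_cancel_left, real_inner_smul_right, norm_smul, mul_pow, Real.norm_eq_abs,
      sq_abs] at h4
    have h5 : t * a ≤ t * (t * (L * ‖w - ys‖ ^ 2)) := by linarith
    exact le_of_mul_le_mul_left h5 ht
  by_contra hcon
  push Not at hcon
  set K := L * ‖w - ys‖ ^ 2
  have hK : 0 ≤ K := mul_nonneg h.L_pos.le (sq_nonneg _)
  -- If a were positive, this t would bound a by tK, which is at most a/2.
  have h6 := key (min 1 (a / (2 * (K + 1)))) (by positivity) (min_le_left _ _)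
  have h7 : min 1 (a / (2 * (K + 1))) * K ≤ a / (2 * (K + 1)) * (K + 1) := by
    have := min_le_right 1 (a / (2 * (K + 1)))
    have h9 : 0 ≤ a / (2 * (K + 1)) := by positivity
    nlinarith
  have h8 : a / (2 * (K + 1)) * (K + 1) = a / 2 := by field_simp
  linarith

theorem gap_ge (h : SmoothConcave f gf L μ) (hc : IsClosed Y) (hconv : Convex ℝ Y)
    (hne : Y.Nonempty) (x : EuclideanSpace ℝ (Fin dx)) {y : EuclideanSpace ℝ (Fin dy)}
    (hy : y ∈ Y) :
    μ / 2 * ‖y - yStar Y f x‖ ^ 2 ≤ primal Y f x - f (pair x y) := by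
  have h1 := h.inner_yStar_le hc hconv hne x hy
  have h2 := h.conc x y (yStar Y f x)
  rw [h.primal_eq hc hne]
  linarith

/-- Test the optimality condition at each point with the other maximiser. Strong monotonicity then
gives μ‖y − y'‖² ≤ L‖x − x'‖‖y − y'‖. -/
theorem norm_yStar_sub_le (h : SmoothConcave f gf L μ) (hc : IsClosed Y) (hconv : Convex ℝ Y)
    (hne : Y.Nonempty) (x x' : EuclideanSpace ℝ (Fin dx)) :
    ‖yStar Y f x - yStar Y f x'‖ ≤ L / μ * ‖x - x'‖ := by
  have m1 := (h.yStar_spec hc hne x).1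
  have m2 := (h.yStar_spec hc hne x').1
  have h1 := h.inner_yStar_le hc hconv hne x m2
  have h2 := h.inner_yStar_le hc hconv hne x' m1
  set y := yStar Y f x
  set y' := yStar Y f x'
  have h3 := h.strong_mono x y y'
  have h4 := real_inner_le_norm ((gf (pair x y')).snd - (gf (pair x' y')).snd) (y - y')
  have h5 := (norm_snd_le (gf (pair x y') - gf (pair x' y'))).trans (h.lip_x x x' y')
  have e0 : (gf (pair x y') - gf (pair x' y')).snd
    = (gf (pair x y')).snd - (gf (pair x' y')).snd := rfl
  rw [e0] at h5
  have e1 : inner ℝ ((gf (pair x y')).snd - (gf (pair x y)).snd) (y - y')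
      = inner ℝ ((gf (pair x y')).snd - (gf (pair x' y')).snd) (y - y')
        + inner ℝ (gf (pair x' y')).snd (y - y') + inner ℝ (gf (pair x y)).snd (y' - y) := by
    rw [inner_sub_left, inner_sub_left, ← neg_sub y y', inner_neg_right]
    ring
  have hk : 0 ≤ ‖y - y'‖ := norm_nonneg _
  rw [div_mul_eq_mul_div, le_div_iff₀ h.mu_pos]
  by_contra hcon
  push Not at hcon
  have hpos : 0 < ‖y - y'‖ := by
    rcases hk.lt_or_eq with h' | h'
    · exact h'
    · rw [← h', zero_mul] at hcon
      have : 0 ≤ L * ‖x - x'‖ := mul_nonneg h.L_pos.le (norm_nonneg _)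
      linarith
  nlinarith

/-- The gradient of the primal function. -/
def gradPrimal (Y : Set (EuclideanSpace ℝ (Fin dy))) (f : ZSpace dx dy → ℝ)
    (gf : ZSpace dx dy → ZSpace dx dy) (x : EuclideanSpace ℝ (Fin dx)) :
    EuclideanSpace ℝ (Fin dx) := (gf (pair x (yStar Y f x))).fst

theorem norm_grad_yStar_sub_le (h : SmoothConcave f gf L μ) (hc : IsClosed Y) (hconv : Convex ℝ Y)
    (hne : Y.Nonempty) (hμ : μ ≤ L) (x x' : EuclideanSpace ℝ (Fin dx)) :
    ‖gradPrimal Y f gf x - gradPrimal Y f gf x'‖ ≤ 2 * (L / μ) * L * ‖x - x'‖ := by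
  have h1 := (norm_fst_le (gf (pair x (yStar Y f x)) - gf (pair x' (yStar Y f x')))).trans
    (h.lip _ _)
  rw [pair_sub x x'] at h1
  have h2 := norm_pair_le (x - x') (yStar Y f x - yStar Y f x')
  have h3 := h.norm_yStar_sub_le hc hconv hne x x'
  have hk : 1 ≤ L / μ := (one_le_div h.mu_pos).2 hμ
  have h4 := norm_nonneg (x - x')
  refine h1.trans ?_
  have : ‖pair (x - x') (yStar Y f x - yStar Y f x')‖ ≤ 2 * (L / μ) * ‖x - x'‖ := by nlinarith
  have h5 := mul_le_mul_of_nonneg_left this h.L_pos.le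
  linarith

/-- Danskin's theorem with a quadratic remainder. P(x') − P(x) lies between the increments of f in x
at the fixed maximisers y*(x) and y*(x'). The x-gradients at these two maximisers differ by at most
κL‖x' − x‖, and L + κL ≤ 2κL. -/
theorem primal_sub_le (h : SmoothConcave f gf L μ) (hc : IsClosed Y) (hconv : Convex ℝ Y)
    (hne : Y.Nonempty) (hμ : μ ≤ L) (x x' : EuclideanSpace ℝ (Fin dx)) :
    |primal Y f x' - primal Y f x - inner ℝ (gradPrimal Y f gf x) (x' - x)|
      ≤ 2 * (L / μ) * L * ‖x' - x‖ ^ 2 := by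
  have m1 := h.yStar_spec hc hne x
  have m2 := h.yStar_spec hc hne x'
  have h3 := h.norm_yStar_sub_le hc hconv hne x' x
  have e1 := h.primal_eq hc hne x
  have e2 := h.primal_eq hc hne x'
  have l1 := h.le_primal hc hne x m2.1
  have l2 := h.le_primal hc hne x' m1.1
  have hk : 1 ≤ L / μ := (one_le_div h.mu_pos).2 hμ
  set y := yStar Y f x
  set y' := yStar Y f x'
  have s1 := (abs_le.1 (h.smooth_x x x' y)).1
  have s2 := (abs_le.1 (h.smooth_x x x' y')).2
  have hLs : 0 ≤ L * ‖x' - x‖ ^ 2 := mul_nonneg h.L_pos.le (sq_nonneg _)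
  have hgap : inner ℝ (gf (pair x y')).fst (x' - x)
      ≤ inner ℝ (gf (pair x y)).fst (x' - x) + L / μ * L * ‖x' - x‖ ^ 2 := by
    have h5 := real_inner_le_norm ((gf (pair x y')).fst - (gf (pair x y)).fst) (x' - x)
    have h6 := (norm_fst_le (gf (pair x y') - gf (pair x y))).trans (h.lip_y x y' y)
    have e0 : (gf (pair x y') - gf (pair x y)).fst
      = (gf (pair x y')).fst - (gf (pair x y)).fst := rfl
    rw [e0] at h6
    rw [inner_sub_left] at h5
    have h7 : ‖(gf (pair x y')).fst - (gf (pair x y)).fst‖ ≤ L * (L / μ * ‖x' - x‖) :=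
      h6.trans (mul_le_mul_of_nonneg_left h3 h.L_pos.le)
    have h8 := mul_le_mul_of_nonneg_right h7 (norm_nonneg (x' - x))
    nlinarith
  have hkL : L * ‖x' - x‖ ^ 2 ≤ L / μ * L * ‖x' - x‖ ^ 2 := by
    rw [mul_assoc]
    exact le_mul_of_one_le_left hLs hk
  change |_ - _ - inner ℝ (gf (pair x y)).fst (x' - x)| ≤ _
  rw [abs_le]
  constructor
  · linarith
  · linarith

theorem hasGradientAt_primal (h : SmoothConcave f gf L μ) (hc : IsClosed Y) (hconv : Convex ℝ Y)
    (hne : Y.Nonempty) (hμ : μ ≤ L) (x : EuclideanSpace ℝ (Fin dx)) :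
    HasGradientAt (primal Y f) (gradPrimal Y f gf x) x := by
  rw [hasGradientAt_iff_isLittleO]
  refine Asymptotics.IsBigO.trans_isLittleO (g := fun x' => ‖x' - x‖ ^ 2) ?_ ?_
  · refine Asymptotics.IsBigO.of_bound (2 * (L / μ) * L) (Filter.Eventually.of_forall fun x' => ?_)
    simpa using h.primal_sub_le hc hconv hne hμ x x'
  · have := Asymptotics.isLittleO_norm_pow_id (E' := EuclideanSpace ℝ (Fin dx)) (n := 2)
      one_lt_two
    have h2 : Filter.Tendsto (fun x' => x' - x) (nhds x) (nhds 0) := by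
      rw [← sub_self x]
      exact (continuous_sub_right x).tendsto x
    exact (this.comp_tendsto h2)

theorem gradient_primal (h : SmoothConcave f gf L μ) (hc : IsClosed Y) (hconv : Convex ℝ Y)
    (hne : Y.Nonempty) (hμ : μ ≤ L) : gradient (primal Y f) = gradPrimal Y f gf :=
  funext fun x => (h.hasGradientAt_primal hc hconv hne hμ x).gradient

end SmoothConcave

end Saddle

end

end Dream

namespace Dream

noncomputable section

theorem gammaOf_eq (κ : ℝ) : gammaOf κ = 1 / (1152 * κ ^ 2) := by
  rw [gammaOf, alpha, show ((1 : ℝ) + 1 / 8) * 128 * κ ^ 2 = 144 * κ ^ 2 by ring, div_div]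
  congr 1
  ring

/-! ### Descent of the merit function under inexact gradient descent ascent. -/

section Descent

variable {dx dy : ℕ}

/-- The merit function `P(x) + α (P(x) - f(x, y))`. -/
def merit (Y : Set (EuclideanSpace ℝ (Fin dy))) (f : ZSpace dx dy → ℝ)
    (x : EuclideanSpace ℝ (Fin dx)) (y : EuclideanSpace ℝ (Fin dy)) : ℝ :=
  primal Y f x + alpha * (primal Y f x - f (pair x y))

namespace SmoothConcave

variable {f : ZSpace dx dy → ℝ} {gf : ZSpace dx dy → ZSpace dx dy} {L μ : ℝ}
  {Y : Set (EuclideanSpace ℝ (Fin dy))}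

/-- The gap `P(x) - f(x, y)` after an inexact projected gradient ascent step in `y`. -/
theorem gap_after_ascent (h : SmoothConcave f gf L μ) (hc : IsClosed Y) (hconv : Convex ℝ Y)
    (hne : Y.Nonempty) (hμ : μ ≤ L) {η E : ℝ} (hη : η = 1 / (48 * L))
    {x : EuclideanSpace ℝ (Fin dx)} {y y' v : EuclideanSpace ℝ (Fin dy)} (hy : y ∈ Y)
    (hE : ∀ w ∈ Y, inner ℝ (y + η • v - y') (w - y') ≤ E) :
    primal Y f x - f (pair x y') ≤ (1 - η * μ / 2) * (primal Y f x - f (pair x y)) + E / η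
      - 23 * L * ‖y' - y‖ ^ 2 + η / 2 * ‖v - (gf (pair x y)).snd‖ ^ 2 := by
  have hL := h.L_pos
  have hmu := h.mu_pos
  have hη0 : 0 < η := by rw [hη]; positivity
  have hηL : η * L = 1 / 48 := by rw [hη]; field_simp
  have hs := (h.yStar_spec hc hne x).1
  have hP := h.primal_eq hc hne x
  set ys := yStar Y f x
  -- The ascent step is compared with the point w a fraction θ of the way to the maximiser. As ημ =
  -- 2θ, the gain from strong concavity outweighs the cost ‖w − y‖²/2, leaving no positive multiple
  -- of R.
  set θ : ℝ := η * μ / 2 with hθ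
  have hθ0 : 0 < θ := by positivity
  have hθ1 : θ ≤ 1 := by nlinarith
  set w := y + θ • (ys - y) with hw
  have hwY : w ∈ Y := hconv.add_smul_sub_mem hy hs ⟨hθ0.le, hθ1⟩
  have h1 := hE w hwY
  set g := (gf (pair x y)).snd with hg
  set R := ‖ys - y‖ ^ 2 with hR
  have hR0 : 0 ≤ R := sq_nonneg _
  have hwy : w - y = θ • (ys - y) := by simp [hw]
  have hnwy : ‖w - y‖ ^ 2 = θ ^ 2 * R := by
    rw [hwy, norm_smul, mul_pow, Real.norm_eq_abs, sq_abs]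
  -- concavity between `y` and the maximizer
  have hcw : (1 - θ) * f (pair x y) + θ * primal Y f x + θ * (1 - θ) * (μ / 2) * R
      ≤ f (pair x w) := by
    have a1 := h.conc x y w
    have a2 := h.conc x ys w
    have b1 : y - w = -(θ • (ys - y)) := by rw [← hwy, neg_sub]
    have b2 : ys - w = (1 - θ) • (ys - y) := by rw [hw, sub_smul, one_smul]; abel
    rw [b1, inner_neg_right, norm_neg, real_inner_smul_right, norm_smul, mul_pow,
      Real.norm_eq_abs, sq_abs] at a1
    rw [b2, real_inner_smul_right, norm_smul, mul_pow, Real.norm_eq_abs, sq_abs] at a2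
    rw [hP]
    have hθ1' : 0 ≤ 1 - θ := by linarith
    have c1 := mul_le_mul_of_nonneg_left a1 hθ1'
    have c2 := mul_le_mul_of_nonneg_left a2 hθ0.le
    nlinarith
  have hsy := h.smooth_y x y y'
  have hcy := h.conc x w y
  have hdiff : f (pair x w) - f (pair x y') ≤ inner ℝ g (w - y') + L * ‖y' - y‖ ^ 2
      - μ / 2 * ‖w - y‖ ^ 2 := by
    have : inner ℝ g (w - y') = inner ℝ g (w - y) - inner ℝ g (y' - y) := by
      rw [← inner_sub_right]; congr 1; abel
    linarith
  have hin : η * inner ℝ g (w - y') ≤ E - inner ℝ (y - y') (w - y')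
      - η * inner ℝ (v - g) (w - y') := by
    have : inner ℝ (y + η • v - y') (w - y') = inner ℝ (y - y') (w - y')
        + η * inner ℝ (v - g) (w - y') + η * inner ℝ g (w - y') := by
      rw [← real_inner_smul_left, ← real_inner_smul_left, ← inner_add_left, ← inner_add_left]
      congr 1
      rw [smul_sub]
      abel
    linarith
  have hpol : inner ℝ (y - y') (w - y')
      = (‖y' - y‖ ^ 2 + ‖w - y'‖ ^ 2 - ‖w - y‖ ^ 2) / 2 := by
    have : w - y = (w - y') - (y - y') := by abel
    rw [this, norm_sub_sq_real (w - y'), real_inner_comm, norm_sub_rev y y']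
    ring
  -- The term ‖w − y'‖²/2 cancels against the one from the polarisation identity `hpol`.
  have herr : -(η * inner ℝ (v - g) (w - y'))
      ≤ η ^ 2 / 2 * ‖v - g‖ ^ 2 + ‖w - y'‖ ^ 2 / 2 := by
    have a1 := abs_le.1 (abs_real_inner_le_norm (v - g) (w - y'))
    nlinarith [sq_nonneg (η * ‖v - g‖ - ‖w - y'‖)]
  have htot : η * (f (pair x w) - f (pair x y')) ≤ E - ‖y' - y‖ ^ 2 / 2 + ‖w - y‖ ^ 2 / 2
      + η ^ 2 / 2 * ‖v - g‖ ^ 2 + η * L * ‖y' - y‖ ^ 2 - η * (μ / 2 * ‖w - y‖ ^ 2) := by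
    have := mul_le_mul_of_nonneg_left hdiff hη0.le
    linarith
  rw [hnwy] at htot
  have hR1 : θ ^ 2 * R / 2 - η * (μ / 2 * (θ ^ 2 * R)) - η * (θ * (1 - θ) * (μ / 2) * R) ≤ 0 := by
    have : θ ^ 2 * R / 2 - η * (μ / 2 * (θ ^ 2 * R)) - η * (θ * (1 - θ) * (μ / 2) * R)
      = - (θ ^ 2 * R / 2) := by
      have : η * μ = 2 * θ := by rw [hθ]; ring
      linear_combination (-(θ ^ 2 * R) / 2 - θ * (1 - θ) * R / 2) * this
    rw [this]
    have : 0 ≤ θ ^ 2 * R / 2 := by positivity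
    linarith
  have hcw' := mul_le_mul_of_nonneg_left hcw hη0.le
  -- Since ηL = 1/48, the coefficient −1/2 + ηL of ‖y' − y‖² equals −23ηL.
  have hfin : η * (primal Y f x - f (pair x y')) ≤ η * ((1 - θ) * (primal Y f x - f (pair x y))
      + E / η - 23 * L * ‖y' - y‖ ^ 2 + η / 2 * ‖v - g‖ ^ 2) := by
    have e1 : η * ((1 - θ) * (primal Y f x - f (pair x y))
      + E / η - 23 * L * ‖y' - y‖ ^ 2 + η / 2 * ‖v - g‖ ^ 2)
      = η * ((1 - θ) * (primal Y f x - f (pair x y))) + E - 23 * (η * L) * ‖y' - y‖ ^ 2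
        + η ^ 2 / 2 * ‖v - g‖ ^ 2 := by
      field_simp
    rw [e1, hηL]
    rw [hηL] at htot
    linarith
  exact le_of_mul_le_mul_left hfin hη0

set_option maxHeartbeats 800000 in
/-- One step of inexact gradient descent ascent decreases the merit function. -/
theorem merit_descent (h : SmoothConcave f gf L μ) (hc : IsClosed Y) (hconv : Convex ℝ Y)
    (hne : Y.Nonempty) (hμ : μ ≤ L) {η γ E : ℝ} (hη : η = 1 / (48 * L)) (hγ : γ = gammaOf (L / μ))
    (hE0 : 0 ≤ E)
    {x u : EuclideanSpace ℝ (Fin dx)} {y y' v : EuclideanSpace ℝ (Fin dy)} (hy : y ∈ Y)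
    (hy' : y' ∈ Y) (hE : ∀ w ∈ Y, inner ℝ (y + η • v - y') (w - y') ≤ E) :
    merit Y f (x - (γ * η) • u) y' ≤ merit Y f x y
      - γ * η / 2 * ‖gradPrimal Y f gf x‖ ^ 2 - 2 / 5 * (γ * η) * ‖u‖ ^ 2 - 2 * L * ‖y' - y‖ ^ 2
      + η / 15 * (‖u - (gf (pair x y)).fst‖ ^ 2 + ‖v - (gf (pair x y)).snd‖ ^ 2)
      + E / (7 * η) := by
  have hL := h.L_pos
  have hmu := h.mu_pos
  have hη0 : 0 < η := by rw [hη]; positivity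
  have hηL : η * L = 1 / 48 := by rw [hη]; field_simp
  have hk : 1 ≤ L / μ := (one_le_div hmu).2 hμ
  have hkmu : L / μ * μ = L := by field_simp
  set k := L / μ with hkdef
  have hγ' : γ = 1 / (1152 * k ^ 2) := by rw [hγ, gammaOf_eq]
  have hγ0 : 0 < γ := by rw [hγ']; positivity
  have hγk : γ * k ^ 2 = 1 / 1152 := by rw [hγ']; field_simp
  have hγ1 : γ ≤ 1 / 1152 := hγk ▸ le_mul_of_one_le_right hγ0.le (one_le_pow₀ hk)
  set s := γ * η with hs
  have hs0 : 0 < s := by positivity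
  set τ := η * μ / 2 with hτ
  have hτk : τ * k = 1 / 96 := by rw [hτ]; linear_combination (η / 2) * hkmu + (1 / 2) * hηL
  have hτ0 : 0 < τ := by positivity
  have hτ1 : τ ≤ 1 / 96 := by nlinarith
  -- `s κ L` is much smaller than the contraction factor
  have hskL : s * k * L = τ / 576 := by
    have e1 : s * k * L * k = γ * k ^ 2 * (η * L) := by rw [hs]; ring
    have e2 : s * k * L * k = τ / 576 * k := by rw [e1, hγk, hηL]; linarith
    exact mul_right_cancel₀ (by positivity : k ≠ 0) e2
  have hgap := h.gap_after_ascent hc hconv hne hμ hη (x := x) hy hE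
  have hQ0 : 0 ≤ primal Y f x - f (pair x y) := sub_nonneg.2 (h.le_primal hc hne x hy)
  have hQt0 : 0 ≤ primal Y f x - f (pair x y') := sub_nonneg.2 (h.le_primal hc hne x hy')
  have hg1 := h.gap_ge hc hconv hne x hy
  have hg2 := h.gap_ge hc hconv hne x hy'
  -- Quadratic growth converts a gap into a squared gradient error, because κμ = L.
  have hgL : ∀ {d Q : ℝ}, μ / 2 * d ≤ Q → L ^ 2 * d ≤ 2 * k * L * Q := by
    intro d Q hdQ
    have := mul_le_mul_of_nonneg_left hdQ (by positivity : 0 ≤ 2 * k * L)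
    have e : 2 * k * L * (μ / 2 * d) = L ^ 2 * d := by linear_combination L * d * hkmu
    linarith
  set P0 := primal Y f x with hP0
  set Q := P0 - f (pair x y) with hQ
  set Qt := P0 - f (pair x y') with hQt
  set gP := gradPrimal Y f gf x with hgP
  -- the primal function
  have hdx : (x - s • u) - x = -(s • u) := by abel
  have hprim := (abs_le.1 (h.primal_sub_le hc hconv hne hμ x (x - s • u))).2
  have hfx := (abs_le.1 (h.smooth_x x (x - s • u) y')).1
  rw [hdx, inner_neg_right, real_inner_smul_right, norm_neg, norm_smul, mul_pow,
    Real.norm_eq_abs, sq_abs] at hprim hfx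
  set P1 := primal Y f (x - s • u) with hP1
  have hgPdist : ‖gP - (gf (pair x y)).fst‖ ^ 2 ≤ 2 * k * L * Q := by
    have := (norm_fst_le (gf (pair x (yStar Y f x)) - gf (pair x y))).trans (h.lip_y x _ y)
    have h2 : ‖gP - (gf (pair x y)).fst‖ ≤ L * ‖y - yStar Y f x‖ := by
      rw [norm_sub_rev y]; exact this
    refine le_trans ?_ (hgL hg1)
    rw [← mul_pow]
    gcongr
  have hgPdist' : ‖(gf (pair x y')).fst - gP‖ ^ 2 ≤ 2 * k * L * Qt := by
    have := (norm_fst_le (gf (pair x y') - gf (pair x (yStar Y f x)))).trans (h.lip_y x y' _)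
    have h2 : ‖(gf (pair x y')).fst - gP‖ ≤ L * ‖y' - yStar Y f x‖ := this
    refine le_trans ?_ (hgL hg2)
    rw [← mul_pow]
    gcongr
  have hU0 : 0 ≤ ‖u‖ ^ 2 := sq_nonneg _
  set U := ‖u‖ ^ 2 with hU
  set ex := ‖u - (gf (pair x y)).fst‖ ^ 2 with hex
  have hex0 : 0 ≤ ex := sq_nonneg _
  have hs2 : k * L * s ^ 2 * U ≤ s * U / 55296 := by
    have e1 : k * L * s ^ 2 * U = s * U * (s * k * L) := by ring
    rw [e1, hskL]
    have h1 : τ / 576 ≤ 1 / 55296 := by linarith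
    have := mul_le_mul_of_nonneg_left h1 (by positivity : 0 ≤ s * U)
    linarith
  -- Polarisation; the difference of u and ∇P(x) is split at ∇ₓf(x, y) into a part controlled by the
  -- gap and the estimation error.
  have hpoly : -(inner ℝ gP u) ≤ -(‖gP‖ ^ 2 / 2) - U / 2 + (2 * k * L * Q + ex) := by
    have e1 := norm_sub_sq_real gP u
    have e2 := norm_sub_sq_le_two (gP - (gf (pair x y)).fst) (u - (gf (pair x y)).fst)
    rw [sub_sub_sub_cancel_right] at e2
    linarith
  have hPdesc : P1 ≤ P0 - s / 2 * ‖gP‖ ^ 2 - s / 2 * U + s * (2 * k * L * Q) + s * ex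
      + 2 * (s * U / 55296) := by
    have := mul_le_mul_of_nonneg_left hpoly hs0.le
    linarith
  have hcross : s * (inner ℝ (gf (pair x y')).fst u - inner ℝ gP u)
      ≤ s * (k * L * Qt + U / 2) := by
    refine mul_le_mul_of_nonneg_left ?_ hs0.le
    rw [← inner_sub_left]
    have e1 := real_inner_le_norm ((gf (pair x y')).fst - gP) u
    have e2 := sq_nonneg (‖(gf (pair x y')).fst - gP‖ - ‖u‖)
    rw [sub_sq] at e2
    linarith
  have hLk : L * (s ^ 2 * U) ≤ k * L * s ^ 2 * U := by
    have := mul_le_mul_of_nonneg_right hk (by positivity : 0 ≤ L * (s ^ 2 * U))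
    linarith
  have hQdesc : P1 - f (pair (x - s • u) y') ≤ (1 + τ / 576) * Qt + s / 2 * U
      + 3 * (s * U / 55296) := by
    have : s * (k * L * Qt) = τ / 576 * Qt := by rw [← hskL]; ring
    linarith
  -- combination
  have hEη0 : 0 ≤ E / η := by positivity
  have hEη : E / (7 * η) = E / η / 7 := by rw [div_div, mul_comm]
  set D := ‖y' - y‖ ^ 2 with hD
  have hD0 : 0 ≤ L * D := mul_nonneg hL.le (sq_nonneg _)
  set ey := ‖v - (gf (pair x y)).snd‖ ^ 2 with hey
  have hey0 : 0 ≤ η * ey := mul_nonneg hη0.le (sq_nonneg _)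
  -- The enlargement of the gap by the move in x is absorbed by the contraction 1 − τ. The half of τ
  -- that is kept pays, after multiplication by α, for the term τQ/288 in the decrease of P.
  have hQt : (1 + τ / 576) * Qt ≤ (1 - τ / 2) * Q + (1 + 1 / 55296) * (E / η) - 23 * (L * D)
      + (1 + 1 / 55296) * (η / 2 * ey) := by
    rw [← hτ] at hgap
    have h1 := mul_le_mul_of_nonneg_left hgap (by positivity : 0 ≤ 1 + τ / 576)
    have h2 : 0 ≤ τ * Q := by positivity
    have h3 : 0 ≤ τ * τ * Q := by positivity
    have h4 : τ * (E / η) ≤ 1 / 96 * (E / η) := by gcongr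
    have h5 : τ * (η * ey) ≤ 1 / 96 * (η * ey) := by gcongr
    have h6 : 0 ≤ τ * (L * D) := by positivity
    linarith
  have hsQ : s * (2 * k * L * Q) = τ / 288 * Q := by linear_combination (2 * Q) * hskL
  have hτQ : 0 ≤ τ * Q := by positivity
  have hsex : s * ex ≤ η * ex / 1152 := by
    rw [hs]
    have := mul_le_mul_of_nonneg_right hγ1 (by positivity : 0 ≤ η * ex)
    linarith
  have hηex : 0 ≤ η * ex := by positivity
  have hsU : 0 ≤ s * U := by positivity
  -- The coefficients are those of P + (P − f)/8 with a margin: 1/2 − 1/16 > 2/5 for ‖u‖², 23/8 > 2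
  -- for ‖y' − y‖², 1/16 < 1/15 for the error of v and 1/8 < 1/7 for E.
  simp only [merit, alpha, ← hP0, ← hP1, ← hQ]
  rw [hEη]
  linarith

end SmoothConcave

end Descent

end

end Dream

namespace Dream

noncomputable section

/-! ### Bounds on expectations -/

section ExpectationLE

variable {Ω Ω' : Type*} [MeasurableSpace Ω] [MeasurableSpace Ω'] {ν : Measure Ω} {ν' : Measure Ω'}

theorem ExpectationLE.le {X : Ω → ℝ} {c d : ℝ} (h : ExpectationLE ν X c) (hcd : c ≤ d) :
    ExpectationLE ν X d := ⟨h.1, h.2.trans hcd⟩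

theorem ExpectationLE.mono {X Y : Ω → ℝ} {c : ℝ} (h : ExpectationLE ν Y c)
    (hX : AEStronglyMeasurable X ν) (h0 : ∀ o, 0 ≤ X o) (hXY : ∀ o, X o ≤ Y o) :
    ExpectationLE ν X c := by
  have hi : Integrable X ν := h.1.mono' hX (Filter.Eventually.of_forall fun o => by
    rw [Real.norm_eq_abs, abs_of_nonneg (h0 o)]; exact hXY o)
  exact ⟨hi, (integral_mono hi h.1 hXY).trans h.2⟩

theorem ExpectationLE.add {X Y : Ω → ℝ} {c d : ℝ} (hX : ExpectationLE ν X c)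
    (hY : ExpectationLE ν Y d) : ExpectationLE ν (fun o => X o + Y o) (c + d) :=
  ⟨hX.1.add hY.1, by rw [integral_add hX.1 hY.1]; exact add_le_add hX.2 hY.2⟩

theorem ExpectationLE.const_mul {X : Ω → ℝ} {c : ℝ} (hX : ExpectationLE ν X c) {a : ℝ}
    (ha : 0 ≤ a) : ExpectationLE ν (fun o => a * X o) (a * c) :=
  ⟨hX.1.const_mul a, by rw [integral_const_mul]; exact mul_le_mul_of_nonneg_left hX.2 ha⟩

theorem ExpectationLE.const [IsProbabilityMeasure ν] (c : ℝ) : ExpectationLE ν (fun _ => c) c :=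
  ⟨integrable_const c, by simp⟩

theorem ExpectationLE.sum {ι : Type*} (s : Finset ι) {X : ι → Ω → ℝ} {c : ι → ℝ}
    (h : ∀ i ∈ s, ExpectationLE ν (X i) (c i)) :
    ExpectationLE ν (fun o => ∑ i ∈ s, X i o) (∑ i ∈ s, c i) :=
  ⟨integrable_finsetSum _ fun i hi => (h i hi).1, by
    rw [integral_finsetSum _ fun i hi => (h i hi).1]
    exact Finset.sum_le_sum fun i hi => (h i hi).2⟩

/-- Fubini with the inner expectation replaced by a bound. Nonnegativity of X makes joint
integrability a consequence of the bounds. -/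
theorem ExpectationLE.prod [SFinite ν] [SFinite ν'] {X : Ω × Ω' → ℝ} {c : Ω → ℝ} {C : ℝ}
    (hX : AEStronglyMeasurable X (ν.prod ν')) (h0 : ∀ o, 0 ≤ X o)
    (hin : ∀ a, ExpectationLE ν' (fun b => X (a, b)) (c a)) (hout : ExpectationLE ν c C) :
    ExpectationLE (ν.prod ν') X C := by
  have hint : Integrable (fun a => ∫ b, X (a, b) ∂ν') ν := by
    refine hout.1.mono' hX.integral_prod_right' (Filter.Eventually.of_forall fun a => ?_)
    rw [Real.norm_eq_abs, abs_of_nonneg (integral_nonneg fun b => h0 _)]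
    exact (hin a).2
  have hi : Integrable X (ν.prod ν') := by
    rw [integrable_prod_iff hX]
    refine ⟨Filter.Eventually.of_forall fun a => (hin a).1, ?_⟩
    simpa only [Real.norm_eq_abs, abs_of_nonneg (h0 _)] using hint
  refine ⟨hi, ?_⟩
  rw [integral_prod _ hi]
  exact (integral_mono hint hout.1 fun a => (hin a).2).trans hout.2

theorem ExpectationLE.comp {f : Ω → Ω'} (hf : MeasurePreserving f ν ν') {X : Ω' → ℝ} {c : ℝ}
    (h : ExpectationLE ν' X c) : ExpectationLE ν (fun o => X (f o)) c := by
  refine ⟨hf.integrable_comp_of_integrable h.1, ?_⟩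
  have := integral_map hf.measurable.aemeasurable (μ := ν) (f := X) (by
    rw [hf.map_eq]; exact h.1.1)
  rw [hf.map_eq] at this
  rw [← this]
  exact h.2

end ExpectationLE

/-! ### Bernoulli laws -/

instance (p : ℝ) : IsProbabilityMeasure (bernoulliLaw p) := by
  unfold bernoulliLaw; infer_instance

theorem integral_bernoulliLaw {p : ℝ} (h0 : 0 ≤ p) (h1 : p ≤ 1) {E : Type*}
    [NormedAddCommGroup E] [NormedSpace ℝ E] [CompleteSpace E] (f : Bool → E) :
    ∫ z, f z ∂(bernoulliLaw p) = p • f true + (1 - p) • f false := by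
  rw [bernoulliLaw, ProbabilityTheory.integral_bernoulliMeasure]
  simp [Set.projIcc_of_mem zero_le_one (⟨h0, h1⟩ : p ∈ Set.Icc (0 : ℝ) 1)]

theorem expectationLE_bernoulliLaw {p : ℝ} (h0 : 0 ≤ p) (h1 : p ≤ 1) (f : Bool → ℝ) :
    ExpectationLE (bernoulliLaw p) f (p * f true + (1 - p) * f false) :=
  ⟨Integrable.of_finite, by rw [integral_bernoulliLaw h0 h1]; simp⟩

/-! ### Second moments of sums of independent centred vectors -/

theorem integrable_inner_of_memLp {V : Type*} [NormedAddCommGroup V] [InnerProductSpace ℝ V]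
    {Ω : Type*} [MeasurableSpace Ω] {ν : Measure Ω} {X Y : Ω → V}
    (hX : MemLp X 2 ν) (hY : MemLp Y 2 ν) : Integrable (fun o => inner ℝ (X o) (Y o)) ν := by
  have h1 := hX.integrable_norm_pow two_ne_zero
  have h2 := hY.integrable_norm_pow two_ne_zero
  refine (h1.add h2).mono' (hX.1.inner hY.1) (Filter.Eventually.of_forall fun o => ?_)
  rw [Real.norm_eq_abs]
  have := abs_real_inner_le_norm (X o) (Y o)
  have h3 := sq_nonneg (‖X o‖ - ‖Y o‖)
  simp only [Pi.add_apply]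
  nlinarith [sq_nonneg (‖X o‖), sq_nonneg ‖Y o‖]

theorem integral_norm_sub_mean_sq {V : Type*} [NormedAddCommGroup V]
    [InnerProductSpace ℝ V] [CompleteSpace V] {Ω : Type*} [MeasurableSpace Ω] {ν : Measure Ω}
    [IsProbabilityMeasure ν] {h : Ω → V} (hh : MemLp h 2 ν) :
    ∫ o, ‖h o - ∫ a, h a ∂ν‖ ^ 2 ∂ν = ∫ o, ‖h o‖ ^ 2 ∂ν - ‖∫ a, h a ∂ν‖ ^ 2 := by
  set d := ∫ a, h a ∂ν
  have hi := hh.integrable one_le_two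
  have e : ∀ o, ‖h o - d‖ ^ 2 = ‖h o‖ ^ 2 - 2 * inner ℝ d (h o) + ‖d‖ ^ 2 := fun o => by
    rw [norm_sub_sq_real, real_inner_comm]
  simp only [e]
  have i1 := hh.integrable_norm_pow two_ne_zero
  have i2 : Integrable (fun o => 2 * inner ℝ d (h o)) ν := (hi.const_inner d).const_mul 2
  have i12 : Integrable (fun o => ‖h o‖ ^ 2 - 2 * inner ℝ d (h o)) ν := i1.sub i2
  rw [integral_add i12 (integrable_const _), integral_sub i1 i2, integral_const_mul,
    integral_inner hi]
  simp only [integral_const, probReal_univ, one_smul]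
  rw [show ∫ a, h a ∂ν = d from rfl, real_inner_self_eq_norm_sq]
  ring

section SecondMoment

variable {V : Type*} [NormedAddCommGroup V] [InnerProductSpace ℝ V] [CompleteSpace V]
  [MeasurableSpace V] [BorelSpace V]

variable {ι : Type*} [Fintype ι] {Ω : ι → Type*} [∀ i, MeasurableSpace (Ω i)]
  {ν : ∀ i, Measure (Ω i)} [∀ i, IsProbabilityMeasure (ν i)]

/-- Independence and centring annihilate all cross terms. The shift c stands for what is already
determined when the samples are drawn. -/
theorem expectationLE_norm_add_sum_sq {Z : ∀ i, Ω i → V}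
    (hZ : ∀ i, MemLp (Z i) 2 (ν i)) (h0 : ∀ i, ∫ o, Z i o ∂(ν i) = 0) {M : ι → ℝ}
    (hM : ∀ i, ∫ o, ‖Z i o‖ ^ 2 ∂(ν i) ≤ M i) (c : V) :
    ExpectationLE (Measure.pi ν) (fun o => ‖c + ∑ i, Z i (o i)‖ ^ 2) (‖c‖ ^ 2 + ∑ i, M i) := by
  classical
  have hX : ∀ i, MemLp (fun o : ∀ i, Ω i => Z i (o i)) 2 (Measure.pi ν) := fun i =>
    (hZ i).comp_measurePreserving (measurePreserving_eval ν i)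
  have hmean : ∀ i, ∫ o, Z i (o i) ∂(Measure.pi ν) = 0 := fun i => by
    rw [integral_comp_eval (hZ i).1, h0 i]
  have hS : MemLp (fun o : ∀ i, Ω i => ∑ i, Z i (o i)) 2 (Measure.pi ν) :=
    memLp_finsetSum _ fun i _ => hX i
  have hint : ∀ i, Integrable (fun o : ∀ i, Ω i => Z i (o i)) (Measure.pi ν) := fun i =>
    (hX i).integrable one_le_two
  have hpair : ∀ i k, ∫ o, inner ℝ (Z i (o i)) (Z k (o k)) ∂(Measure.pi ν)
      = if i = k then ∫ o, ‖Z i o‖ ^ 2 ∂(ν i) else 0 := by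
    intro i k
    split_ifs with hik
    · subst hik
      simp only [real_inner_self_eq_norm_sq]
      exact integral_comp_eval (f := fun a => ‖Z i a‖ ^ 2) ((hZ i).1.norm.pow 2)
    · have hind := (ProbabilityTheory.iIndepFun_pi (μ := ν) (X := Z)
        (fun i => (hZ i).1.aemeasurable)).indepFun hik
      have := hind.integral_bilin (hint i) (hint k)
        (isBoundedBilinearMap_inner (𝕜 := ℝ) (E := V)).toContinuousLinearMap
      simp only [hmean] at this
      rw [map_zero] at this
      exact this
  have hsq : ∀ o : ∀ i, Ω i, ‖c + ∑ i, Z i (o i)‖ ^ 2 = ‖c‖ ^ 2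
      + 2 * inner ℝ c (∑ i, Z i (o i)) + ∑ i, ∑ k, inner ℝ (Z i (o i)) (Z k (o k)) := by
    intro o
    rw [norm_add_sq_real, ← real_inner_self_eq_norm_sq (∑ i, Z i (o i)), sum_inner]
    simp only [inner_sum]
  have i2 : Integrable (fun o : ∀ i, Ω i => 2 * inner ℝ c (∑ i, Z i (o i))) (Measure.pi ν) :=
    ((hS.integrable one_le_two).const_inner c).const_mul 2
  have i3 : ∀ i k, Integrable (fun o : ∀ i, Ω i => inner ℝ (Z i (o i)) (Z k (o k)))
      (Measure.pi ν) := fun i k => integrable_inner_of_memLp (hX i) (hX k)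
  have i3' : Integrable (fun o : ∀ i, Ω i => ∑ i, ∑ k, inner ℝ (Z i (o i)) (Z k (o k)))
      (Measure.pi ν) := integrable_finsetSum _ fun i _ => integrable_finsetSum _ fun k _ => i3 i k
  have i12 : Integrable (fun o : ∀ i, Ω i => ‖c‖ ^ 2 + 2 * inner ℝ c (∑ i, Z i (o i)))
      (Measure.pi ν) := (integrable_const _).add i2
  simp only [hsq]
  refine ⟨i12.add i3', ?_⟩
  beta_reduce
  rw [integral_add i12 i3']
  rw [integral_add (integrable_const _) i2, integral_const_mul,
    integral_inner (hS.integrable one_le_two), integral_finsetSum _ fun i _ => hint i,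
    integral_finsetSum _ fun i _ => integrable_finsetSum _ fun k _ => i3 i k]
  simp only [hmean, Finset.sum_const_zero, inner_zero_right, mul_zero, add_zero]
  rw [Finset.sum_congr rfl fun i _ => integral_finsetSum _ fun k _ => i3 i k]
  simp only [hpair, Finset.sum_ite_eq, Finset.mem_univ, if_true]
  simp only [integral_const, probReal_univ, one_smul]
  gcongr with i
  exact hM i

/-- The mean of `b` independent copies: its law is centred after subtracting the mean, and the
variance is divided by `b`. -/
theorem sampleMean_moments {Ξ : Type*} [MeasurableSpace Ξ] {D : Measure Ξ} [IsProbabilityMeasure D]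
    {h : Ξ → V} (hh : MemLp h 2 D) {b : ℕ} (hb : b ≠ 0) :
    let A : (Fin b → Ξ) → V := fun S => (1 / (b : ℝ)) • ∑ j, h (S j)
    let d := ∫ ξ, h ξ ∂D
    MemLp (fun S => A S - d) 2 (Measure.pi fun _ : Fin b => D) ∧
    ∫ S, (A S - d) ∂(Measure.pi fun _ : Fin b => D) = 0 ∧
    ∫ S, ‖A S - d‖ ^ 2 ∂(Measure.pi fun _ : Fin b => D)
      ≤ (1 / (b : ℝ)) * (∫ ξ, ‖h ξ‖ ^ 2 ∂D - ‖d‖ ^ 2) := by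
  intro A d
  have hb' : (b : ℝ) ≠ 0 := by exact_mod_cast hb
  set Z : Fin b → Ξ → V := fun _ ξ => (1 / (b : ℝ)) • (h ξ - d)
  have hAZ : ∀ S, A S - d = ∑ j, Z j (S j) := by
    intro S
    simp only [A, Z, ← Finset.smul_sum, Finset.sum_sub_distrib, smul_sub]
    congr 1
    simp only [Finset.sum_const, Finset.card_univ, Fintype.card_fin]
    rw [← Nat.cast_smul_eq_nsmul ℝ, smul_smul, one_div, inv_mul_cancel₀ hb', one_smul]
  have hZ : ∀ j, MemLp (Z j) 2 D := fun j => (hh.sub (memLp_const d)).const_smul _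
  have hi := hh.integrable one_le_two
  have hZ0 : ∀ j, ∫ ξ, Z j ξ ∂D = 0 := fun j => by
    simp only [Z]
    rw [integral_smul, integral_sub hi (integrable_const _)]
    simp [d]
  have hX : ∀ i, MemLp (fun S : Fin b → Ξ => Z i (S i)) 2 (Measure.pi fun _ : Fin b => D) :=
    fun i => (hZ i).comp_measurePreserving (measurePreserving_eval (fun _ : Fin b => D) i)
  simp only [hAZ]
  refine ⟨memLp_finsetSum _ fun i _ => hX i, ?_, ?_⟩
  · rw [integral_finsetSum _ fun i _ => (hX i).integrable one_le_two]
    refine Finset.sum_eq_zero fun i _ => ?_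
    rw [integral_comp_eval (μ := fun _ : Fin b => D) (hZ i).1, hZ0 i]
  · have hM : ∀ j, ∫ ξ, ‖Z j ξ‖ ^ 2 ∂D ≤ (1 / (b : ℝ)) ^ 2 * (∫ ξ, ‖h ξ‖ ^ 2 ∂D - ‖d‖ ^ 2) :=
      fun j => by
        simp only [Z, norm_smul, mul_pow, Real.norm_eq_abs, sq_abs]
        rw [integral_const_mul, integral_norm_sub_mean_sq hh]
    have := (expectationLE_norm_add_sum_sq hZ hZ0 hM 0).2
    simp only [zero_add, norm_zero, ne_eq, OfNat.ofNat_ne_zero, not_false_eq_true, zero_pow,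
      Finset.sum_const, Finset.card_univ, Fintype.card_fin, nsmul_eq_mul] at this
    refine this.trans (le_of_eq ?_)
    field_simp

end SecondMoment

end

end Dream

namespace Dream

noncomputable section

/-! ### The small batch estimator -/

section SmallBatch

variable {V : Type*} [NormedAddCommGroup V] [InnerProductSpace ℝ V] [CompleteSpace V]
  [MeasurableSpace V] [BorelSpace V] [SecondCountableTopology V]

theorem measurable_coin {α : Type*} [MeasurableSpace α] {f : α → Bool} (hf : Measurable f)
    (u v : ℝ) : Measurable fun a => if f a then u else v :=
  (measurable_of_finite fun z : Bool => if z then u else v).comp hf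

/-- The error of the partially participating small batch estimator. -/
theorem expectationLE_smallBatch {m b : ℕ} {Ξ : Type*} [MeasurableSpace Ξ] {D : Fin m → Measure Ξ}
    [∀ i, IsProbabilityMeasure (D i)] {h : Fin m → Ξ → V} (hmeas : ∀ i, Measurable (h i))
    (hh : ∀ i, MemLp (h i) 2 (D i)) {M : Fin m → ℝ} (hM : ∀ i, ∫ ξ, ‖h i ξ‖ ^ 2 ∂(D i) ≤ M i)
    {q : ℝ} (hq0 : 0 < q) (hq1 : q ≤ 1) (hb : b ≠ 0) (hbq : (b : ℝ) - b * q ≤ 1) (c : V)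
    (a : Fin m → ℝ) :
    ExpectationLE ((Measure.pi fun _ : Fin m => bernoulliLaw q).prod
        (Measure.pi fun i : Fin m => Measure.pi fun _ : Fin b => D i))
      (fun r => ‖c + ∑ i, a i • (((if r.1 i then (1 : ℝ) else 0) / ((b : ℝ) * q)) •
        ∑ j, h i (r.2 i j) - ∫ ξ, h i ξ ∂(D i))‖ ^ 2)
      (‖c‖ ^ 2 + ∑ i, a i ^ 2 * (M i / (b * q))) := by
  have hb' : (0 : ℝ) < b := by positivity
  set d : Fin m → V := fun i => ∫ ξ, h i ξ ∂(D i) with hd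
  -- The participation weight has mean 1 and variance 1/q − 1 under the coin.
  set w : Bool → ℝ := fun z => (if z then 1 else 0) / q with hw
  have hwt : w true = 1 / q := by simp [hw]
  have hwf : w false = 0 := by simp [hw]
  set A : ∀ i : Fin m, (Fin b → Ξ) → V := fun i S => (1 / (b : ℝ)) • ∑ j, h i (S j)
  have hAm := fun i => sampleMean_moments (hh i) hb
  -- integrate over the samples
  have hin : ∀ ω : Fin m → Bool, ExpectationLE
      (Measure.pi fun i : Fin m => Measure.pi fun _ : Fin b => D i)
      (fun S => ‖c + ∑ i, a i • (((if ω i then (1 : ℝ) else 0) / ((b : ℝ) * q)) •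
        ∑ j, h i (S i j) - d i)‖ ^ 2)
      (‖c + ∑ i, (a i * (w (ω i) - 1)) • d i‖ ^ 2
        + ∑ i, (a i ^ 2 * (1 / (b : ℝ) * (M i - ‖d i‖ ^ 2))) * w (ω i) ^ 2) := by
    intro ω
    have := expectationLE_norm_add_sum_sq
      (ν := fun i : Fin m => Measure.pi fun _ : Fin b => D i)
      (Z := fun i S => (a i * w (ω i)) • (A i S - d i))
      (M := fun i => (a i ^ 2 * (1 / (b : ℝ) * (M i - ‖d i‖ ^ 2))) * w (ω i) ^ 2)
      (fun i => (hAm i).1.const_smul _)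
      (fun i => by rw [integral_smul, (hAm i).2.1, smul_zero])
      (fun i => by
        simp only [norm_smul, mul_pow, Real.norm_eq_abs, sq_abs]
        rw [integral_const_mul]
        have h1 : ∫ S, ‖A i S - d i‖ ^ 2 ∂(Measure.pi fun _ : Fin b => D i)
            ≤ 1 / (b : ℝ) * (M i - ‖d i‖ ^ 2) :=
          (hAm i).2.2.trans (mul_le_mul_of_nonneg_left (sub_le_sub_right (hM i) _) (by positivity))
        have h2 := mul_le_mul_of_nonneg_left h1 (by positivity : 0 ≤ a i ^ 2 * w (ω i) ^ 2)
        linarith)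
      (c + ∑ i, (a i * (w (ω i) - 1)) • d i)
    convert this using 3 with S
    rw [add_assoc, ← Finset.sum_add_distrib]
    congr 2
    refine Finset.sum_congr rfl fun i _ => ?_
    have e : ((if ω i then (1 : ℝ) else 0) / ((b : ℝ) * q)) • ∑ j, h i (S i j)
        = w (ω i) • A i (S i) := by
      simp only [hw, A, smul_smul]
      congr 1
      field_simp
    rw [e]
    module
  -- integrate over the coins
  have hout1 := expectationLE_norm_add_sum_sq (ν := fun _ : Fin m => bernoulliLaw q)
    (Z := fun i z => (a i * (w z - 1)) • d i)
    (M := fun i => a i ^ 2 * ‖d i‖ ^ 2 * (1 / q - 1))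
    (fun i => MemLp.of_discrete)
    (fun i => by
      rw [integral_bernoulliLaw hq0.le hq1]
      simp only [hwt, hwf, smul_smul, ← add_smul]
      convert zero_smul ℝ (d i)
      field_simp
      ring)
    (fun i => by
      rw [integral_bernoulliLaw hq0.le hq1]
      simp only [hwt, hwf, norm_smul, mul_pow, Real.norm_eq_abs, sq_abs, smul_eq_mul]
      apply le_of_eq
      field_simp
      ring) c
  have hw2 : ∀ i : Fin m, ExpectationLE (Measure.pi fun _ : Fin m => bernoulliLaw q)
      (fun ω => w (ω i) ^ 2) (1 / q) := by
    intro i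
    have h1 := expectationLE_bernoulliLaw hq0.le hq1 (fun z => w z ^ 2)
    have h2 : q * w true ^ 2 + (1 - q) * w false ^ 2 = 1 / q := by
      rw [hwt, hwf]
      field_simp
      ring
    rw [h2] at h1
    exact h1.comp (measurePreserving_eval (fun _ : Fin m => bernoulliLaw q) i)
  have hvar : ∀ i, 0 ≤ a i ^ 2 * (1 / (b : ℝ) * (M i - ‖d i‖ ^ 2)) := fun i => by
    have h1 := integral_norm_sub_mean_sq (hh i)
    have h2 : 0 ≤ ∫ o, ‖h i o - ∫ a, h i a ∂(D i)‖ ^ 2 ∂(D i) :=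
      integral_nonneg fun _ => sq_nonneg _
    have h3 : 0 ≤ M i - ‖d i‖ ^ 2 := by
      have := hM i
      simp only [hd]
      linarith
    positivity
  have hout2 := ExpectationLE.sum Finset.univ fun i _ => (hw2 i).const_mul (hvar i)
  have hout := hout1.add hout2
  refine (ExpectationLE.prod ?_ (fun _ => sq_nonneg _) hin hout).le ?_
  · have : Measurable fun r : (Fin m → Bool) × (Fin m → Fin b → Ξ) =>
        ‖c + ∑ i, a i • (((if r.1 i then (1 : ℝ) else 0) / ((b : ℝ) * q)) •
          ∑ j, h i (r.2 i j) - d i)‖ ^ 2 := by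
      have hc := fun i : Fin m => measurable_coin
        (f := fun r : (Fin m → Bool) × (Fin m → Fin b → Ξ) => r.1 i) (by fun_prop) 1 0
      fun_prop
    exact this.aestronglyMeasurable
  · rw [add_assoc, ← Finset.sum_add_distrib]
    gcongr with i
    -- This is `hbq` rewritten. The coin contributes (1/q − 1)‖d‖², which is covered by the
    -- ‖d‖²/(bq) saved in the variance of the sample mean, so partial participation is no worse than
    -- an effective batch size bq.
    have hq2 : 1 / q - 1 ≤ 1 / (b * q) := by
      rw [div_sub_one hq0.ne', div_le_div_iff₀ hq0 (by positivity)]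
      nlinarith
    have h1 := mul_le_mul_of_nonneg_left hq2 (by positivity : 0 ≤ a i ^ 2 * ‖d i‖ ^ 2)
    have e : a i ^ 2 * (1 / (b : ℝ) * (M i - ‖d i‖ ^ 2)) * (1 / q)
        = a i ^ 2 * (M i / (b * q)) - a i ^ 2 * ‖d i‖ ^ 2 * (1 / (b * q)) := by
      field_simp
    rw [e]
    linarith

end SmallBatch

/-! ### Measurability of stochastic gradients -/

/-- F is jointly measurable, being continuous in z and measurable in ξ, and each coordinate of the
gradient is the pointwise limit of difference quotients with step 1/(n + 1). -/
theorem measurable_gradient_uncurry {E : Type*} [NormedAddCommGroup E] [InnerProductSpace ℝ E]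
    [FiniteDimensional ℝ E] [CompleteSpace E] [MeasurableSpace E] [BorelSpace E] {Ξ : Type*}
    [MeasurableSpace Ξ] {F : E → Ξ → ℝ} (hd : ∀ ξ, Differentiable ℝ fun z => F z ξ)
    (hm : ∀ z, Measurable (F z)) :
    Measurable fun p : E × Ξ => gradient (fun w => F w p.2) p.1 := by
  have hF : Measurable (Function.uncurry F) :=
    measurable_uncurry_of_continuous_of_measurable (fun ξ => (hd ξ).continuous) hm
  set B := stdOrthonormalBasis ℝ E
  have hcoord : ∀ k, Measurable fun p : E × Ξ => inner ℝ (B k) (gradient (fun w => F w p.2) p.1) := by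
    intro k
    refine measurable_of_tendsto_metrizable
      (f := fun (n : ℕ) (p : E × Ξ) => ((n : ℝ) + 1) * (F (p.1 + (1 / ((n : ℝ) + 1)) • B k) p.2
        - F p.1 p.2)) (fun n => ?_) ?_
    · have h1 : Measurable fun p : E × Ξ => F (p.1 + (1 / ((n : ℝ) + 1)) • B k) p.2 :=
        hF.comp (((measurable_fst.add_const _)).prodMk measurable_snd)
      exact (h1.sub hF).const_mul _
    · rw [tendsto_pi_nhds]
      intro p
      have hg : HasFDerivAt (fun w => F w p.2) (fderiv ℝ (fun w => F w p.2) p.1) p.1 :=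
        (hd p.2 p.1).hasFDerivAt
      have e : inner ℝ (B k) (gradient (fun w => F w p.2) p.1)
          = fderiv ℝ (fun w => F w p.2) p.1 (B k) := by
        rw [real_inner_comm, gradient, InnerProductSpace.toDual_symm_apply]
      rw [e]
      have := hg.lim (B k) (l := Filter.atTop) (c := fun n : ℕ => (n : ℝ) + 1) ?_
      · simpa using this
      · have h2 : Filter.Tendsto (fun n : ℕ => (n : ℝ) + 1) Filter.atTop Filter.atTop :=
          Filter.tendsto_atTop_add_const_right _ _ tendsto_natCast_atTop_atTop
        exact tendsto_norm_atTop_atTop.comp h2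
  have : (fun p : E × Ξ => gradient (fun w => F w p.2) p.1)
      = fun p => ∑ k, (inner ℝ (B k) (gradient (fun w => F w p.2) p.1)) • B k :=
    funext fun p => (B.sum_repr' _).symm
  rw [this]
  exact Finset.measurable_sum _ fun k _ => (hcoord k).smul_const _

end

end Dream

namespace Dream

noncomputable section

/-! ### Stochastic first order oracles -/

section Oracle

variable {m dx dy : ℕ} {Ξ : Type*} [MeasurableSpace Ξ]

/-- The gradient of the `i`-th local objective. -/
def locGrad (D : Fin m → Measure Ξ) (F : Fin m → ZSpace dx dy → Ξ → ℝ) (i : Fin m)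
    (z : ZSpace dx dy) : ZSpace dx dy := gradient (localObj (D i) (F i)) z

/-- The stochastic gradients are unbiased and `L`-average smooth. -/
structure Oracle (D : Fin m → Measure Ξ) (F : Fin m → ZSpace dx dy → Ξ → ℝ) (L : ℝ) : Prop where
  meas : ∀ i, Measurable fun p : ZSpace dx dy × Ξ => stochGrad (F i) p.1 p.2
  int : ∀ i z, Integrable (stochGrad (F i) z) (D i)
  mean : ∀ i z, ∫ ξ, stochGrad (F i) z ξ ∂(D i) = locGrad D F i z
  memLp : ∀ i z z', MemLp (fun ξ => stochGrad (F i) z ξ - stochGrad (F i) z' ξ) 2 (D i)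
  sq_le : ∀ i z z', ∫ ξ, ‖stochGrad (F i) z ξ - stochGrad (F i) z' ξ‖ ^ 2 ∂(D i)
    ≤ L ^ 2 * ‖z - z'‖ ^ 2

/-- The large batches with law `Q` estimate each local gradient with variance `s2`, and their
errors are uncorrelated. -/
def BatchVariance {bigB : ℕ} (D : Fin m → Measure Ξ) (F : Fin m → ZSpace dx dy → Ξ → ℝ)
    (Q : Measure (BigBatch m bigB Ξ)) (s2 : ℝ) : Prop :=
  ∀ (z : Fin m → ZSpace dx dy) (a : Fin m → ℝ), ExpectationLE Q
    (fun S => ‖∑ i, a i • (bigGrad F S z i - locGrad D F i (z i))‖ ^ 2) ((∑ i, a i ^ 2) * s2)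

variable {D : Fin m → Measure Ξ} {F : Fin m → ZSpace dx dy → Ξ → ℝ} {L : ℝ}

theorem Oracle.mean_diff (h : Oracle D F L) (i : Fin m) (z z' : ZSpace dx dy) :
    ∫ ξ, (stochGrad (F i) z ξ - stochGrad (F i) z' ξ) ∂(D i)
      = locGrad D F i z - locGrad D F i z' := by
  rw [integral_sub (h.int i z) (h.int i z'), h.mean, h.mean]

/-- Second moment minus squared norm of the mean is a variance, hence nonnegative. -/
theorem Oracle.locGrad_lip [∀ i, IsProbabilityMeasure (D i)] (h : Oracle D F L) (i : Fin m)
    (z z' : ZSpace dx dy) :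
    ‖locGrad D F i z - locGrad D F i z'‖ ^ 2 ≤ L ^ 2 * ‖z - z'‖ ^ 2 := by
  have h1 := integral_norm_sub_mean_sq (h.memLp i z z')
  have h2 : 0 ≤ ∫ o, ‖stochGrad (F i) z o - stochGrad (F i) z' o
    - ∫ ξ, (stochGrad (F i) z ξ - stochGrad (F i) z' ξ) ∂(D i)‖ ^ 2 ∂(D i) :=
      integral_nonneg fun _ => sq_nonneg _
  rw [h.mean_diff] at h1 h2
  linarith [h.sq_le i z z']

end Oracle

/-! ### Measurability of the iterates -/

theorem measurable_boolIte {α β : Type*} [MeasurableSpace α] [MeasurableSpace β] {f : α → Bool}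
    (hf : Measurable f) {u v : α → β} (hu : Measurable u) (hv : Measurable v) :
    Measurable fun a => if f a then u a else v a :=
  Measurable.ite (hf (measurableSet_singleton true)) hu hv

section Measurability

variable {α : Type*} [MeasurableSpace α]

section FastMix

variable {m : ℕ} {V : Type*} [NormedAddCommGroup V] [InnerProductSpace ℝ V]
  [MeasurableSpace V] [BorelSpace V] [SecondCountableTopology V]

theorem measurable_fastMix (W : Matrix (Fin m) (Fin m) ℝ) (lam2 : ℝ) {a : α → Fin m → V}
    (ha : ∀ i, Measurable fun o => a o i) (k : ℕ) (i : Fin m) :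
    Measurable fun o => fastMix W lam2 (a o) k i := by
  have : ∀ k, (∀ i, Measurable fun o => (fastMixIter W lam2 (a o) k).1 i) ∧
      ∀ i, Measurable fun o => (fastMixIter W lam2 (a o) k).2 i := by
    intro k
    induction k with
    | zero => exact ⟨ha, ha⟩
    | succ k ih =>
      refine ⟨ih.2, fun i => ?_⟩
      have h1 := ih.1
      have h2 := ih.2
      exact ((Finset.measurable_sum _ fun j _ => (h2 j).const_smul (W i j)).const_smul _).sub
        ((h1 i).const_smul _)
  exact (this k).2 i

theorem measurable_avg {a : α → Fin m → V} (ha : ∀ i, Measurable fun o => a o i) :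
    Measurable fun o => avg (a o) := by
  exact (Finset.measurable_sum _ fun i _ => ha i).const_smul _

theorem measurable_cons {a : α → Fin m → V} (ha : ∀ i, Measurable fun o => a o i) :
    Measurable fun o => cons (a o) := by
  have := measurable_avg ha
  exact Finset.measurable_sum _ fun i _ => ((ha i).sub this).norm.pow_const 2

end FastMix

variable {m dx dy : ℕ} {Ξ : Type*} [MeasurableSpace Ξ]

theorem measurable_pair {x : α → EuclideanSpace ℝ (Fin dx)} {y : α → EuclideanSpace ℝ (Fin dy)}
    (hx : Measurable x) (hy : Measurable y) : Measurable fun o => pair (x o) (y o) :=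
  (WithLp.measurable_toLp 2 _).comp (hx.prodMk hy)

theorem measurable_fst_z {z : α → ZSpace dx dy} (hz : Measurable z) :
    Measurable fun o => (z o).fst :=
  measurable_fst.comp ((WithLp.measurable_ofLp 2 _).comp hz)

theorem measurable_snd_z {z : α → ZSpace dx dy} (hz : Measurable z) :
    Measurable fun o => (z o).snd :=
  measurable_snd.comp ((WithLp.measurable_ofLp 2 _).comp hz)

/-- A random state. -/
structure MeasurableState (st : α → State m dx dy) : Prop where
  x : ∀ i, Measurable fun o => (st o).x i
  y : ∀ i, Measurable fun o => (st o).y i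
  g : ∀ i, Measurable fun o => (st o).g i
  s : ∀ i, Measurable fun o => (st o).s i
  sfo : Measurable fun o => (st o).sfo
  comm : Measurable fun o => (st o).comm

/-- The points at which a state evaluates gradients. -/
def State.z (st : State m dx dy) (i : Fin m) : ZSpace dx dy := pair (st.x i) (st.y i)

theorem MeasurableState.z {st : α → State m dx dy} (h : MeasurableState st) (i : Fin m) :
    Measurable fun o => (st o).z i := measurable_pair (h.x i) (h.y i)

variable {F : Fin m → ZSpace dx dy → Ξ → ℝ} {Y : Set (EuclideanSpace ℝ (Fin dy))}

theorem measurable_bigGrad {bigB : ℕ}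
    (hF : ∀ i, Measurable fun p : ZSpace dx dy × Ξ => stochGrad (F i) p.1 p.2)
    {S : α → BigBatch m bigB Ξ} (hS : Measurable S) {z : α → Fin m → ZSpace dx dy}
    (hz : ∀ i, Measurable fun o => z o i) (i : Fin m) :
    Measurable fun o => bigGrad F (S o) (z o) i := by
  have h1 : ∀ j, Measurable fun o => stochGrad (F i) (z o i) (S o i j) := fun j =>
    (hF i).comp ((hz i).prodMk (by fun_prop))
  exact (Finset.measurable_sum _ fun j _ => h1 j).const_smul (1 / (bigB : ℝ))

theorem measurableState_init (P : Params) (W : Matrix (Fin m) (Fin m) ℝ) (lam2 : ℝ)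
    (hF : ∀ i, Measurable fun p : ZSpace dx dy × Ξ => stochGrad (F i) p.1 p.2)
    (x₀ : EuclideanSpace ℝ (Fin dx)) (y₀ : EuclideanSpace ℝ (Fin dy))
    {S : α → BigBatch m P.bigB Ξ} (hS : Measurable S) :
    MeasurableState fun o => initState P W lam2 F x₀ y₀ (S o) where
  x _ := measurable_const
  y _ := measurable_const
  g i := measurable_bigGrad hF hS (fun _ => measurable_const) i
  s i := measurable_fastMix W lam2 (measurable_bigGrad hF hS (fun _ => measurable_const)) _ i
  sfo := measurable_const
  comm := measurable_const

theorem measurableState_step {P : Params} {W : Matrix (Fin m) (Fin m) ℝ} {lam2 : ℝ}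
    (hF : ∀ i, Measurable fun p : ZSpace dx dy × Ξ => stochGrad (F i) p.1 p.2)
    (hY : Measurable (proj Y)) {st : α → State m dx dy} (h : MeasurableState st)
    {r : α → Seed m P.b P.bigB Ξ} (hr : Measurable r) :
    MeasurableState fun o => step P W lam2 Y F (st o) (r o) := by
  have hζ : Measurable fun o => (r o).1 := by fun_prop
  have hω : ∀ i, Measurable fun o => (r o).2.1 i := by fun_prop
  have hx : ∀ i, Measurable fun o => (step P W lam2 Y F (st o) (r o)).x i := by
    refine measurable_fastMix W lam2 (fun i => ?_) _
    exact (h.x i).sub ((measurable_fst_z (h.s i)).const_smul (P.γ * P.η))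
  have hy : ∀ i, Measurable fun o => (step P W lam2 Y F (st o) (r o)).y i := by
    refine measurable_fastMix W lam2 (fun i => ?_) _
    exact hY.comp ((h.y i).add ((measurable_snd_z (h.s i)).const_smul P.η))
  have hz : ∀ i, Measurable fun o => (step P W lam2 Y F (st o) (r o)).z i := fun i =>
    measurable_pair (hx i) (hy i)
  have hg : ∀ i, Measurable fun o => (step P W lam2 Y F (st o) (r o)).g i := by
    intro i
    have h1 : Measurable fun o => bigGrad F (r o).2.2.1
        (fun i => (step P W lam2 Y F (st o) (r o)).z i) i :=
      measurable_bigGrad hF (by fun_prop) hz i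
    have hc := measurable_coin (hω i) 1 0
    have h2 : ∀ j, Measurable fun o =>
        stochGrad (F i) ((step P W lam2 Y F (st o) (r o)).z i) ((r o).2.2.2 i j)
          - stochGrad (F i) ((st o).z i) ((r o).2.2.2 i j) := by
      intro j
      exact ((hF i).comp ((hz i).prodMk (by fun_prop))).sub
        ((hF i).comp ((h.z i).prodMk (by fun_prop)))
    refine measurable_boolIte hζ h1 ((h.g i).add ?_)
    exact ((hc.div_const _)).smul (Finset.measurable_sum _ fun j _ => h2 j)
  refine ⟨hx, hy, hg, fun i => ?_, ?_, ?_⟩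
  · have h3 := measurable_fastMix W lam2
      (a := fun o i => (st o).s i + (step P W lam2 Y F (st o) (r o)).g i - (st o).g i)
      (fun i => ((h.s i).add (hg i)).sub (h.g i))
    have h4 := measurable_boolIte hζ (h3 P.bigK i) (h3 P.K i)
    convert h4 using 2 with o
    simp only [step]
    split_ifs <;> rfl
  · refine h.sfo.add (measurable_boolIte hζ measurable_const ?_)
    exact Finset.measurable_sum _ fun i _ =>
      (measurable_of_finite fun z : Bool => if z then 2 * P.b else 0).comp (hω i)
  · exact (h.comm.add_const _).add_const _ |>.add (measurable_boolIte hζ measurable_const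
      measurable_const)

end Measurability

/-! ### Expectations over the random choices of one iteration -/

section Seed

variable {m : ℕ} {Ξ : Type*} [MeasurableSpace Ξ] {P : Params} {D : Fin m → Measure Ξ}
  [∀ i, IsProbabilityMeasure (D i)] {Q : Measure (BigBatch m P.bigB Ξ)} [IsProbabilityMeasure Q]

instance : IsProbabilityMeasure (seedLaw P D Q) := by
  unfold seedLaw; infer_instance

/-- Condition on ζ. On each outcome X is dominated by a function of only some components of the
seed, whose law is a marginal of the product. -/
theorem expectationLE_seedLaw (hp0 : 0 ≤ P.p) (hp1 : P.p ≤ 1) {X : Seed m P.b P.bigB Ξ → ℝ}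
    (hX : Measurable X) (h0 : ∀ r, 0 ≤ X r) {A B : ℝ} {Xt : BigBatch m P.bigB Ξ → ℝ}
    {Xf : (Fin m → Bool) × (Fin m → Fin P.b → Ξ) → ℝ}
    (hA : ExpectationLE Q Xt A) (hXt : ∀ ω S' S, X (true, ω, S', S) ≤ Xt S')
    (hB : ExpectationLE ((Measure.pi fun _ : Fin m => bernoulliLaw P.q).prod
        (Measure.pi fun i : Fin m => Measure.pi fun _ : Fin P.b => D i)) Xf B)
    (hXf : ∀ ω S' S, X (false, ω, S', S) ≤ Xf (ω, S)) :
    ExpectationLE (seedLaw P D Q) X (P.p * A + (1 - P.p) * B) := by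
  have hb := expectationLE_bernoulliLaw hp0 hp1 (fun z => if z then A else B)
  rw [if_pos rfl, if_neg (by simp)] at hb
  refine ExpectationLE.prod hX.aestronglyMeasurable h0 (fun z => ?_) hb
  have hm : AEStronglyMeasurable (fun b => X (z, b))
      ((Measure.pi fun _ : Fin m => bernoulliLaw P.q).prod
        (Q.prod (Measure.pi fun i : Fin m => Measure.pi fun _ : Fin P.b => D i))) :=
    (hX.comp (measurable_const.prodMk measurable_id)).aestronglyMeasurable
  cases z with
  | true =>
    rw [if_pos rfl]
    have hmp := (measurePreserving_fst (μ := Q)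
      (ν := Measure.pi fun i : Fin m => Measure.pi fun _ : Fin P.b => D i)).comp
      (measurePreserving_snd (μ := Measure.pi fun _ : Fin m => bernoulliLaw P.q)
        (ν := Q.prod (Measure.pi fun i : Fin m => Measure.pi fun _ : Fin P.b => D i)))
    exact (ExpectationLE.comp hmp hA).mono hm (fun _ => h0 _) fun ⟨ω, S', S⟩ => hXt ω S' S
  | false =>
    rw [if_neg (by simp)]
    have hmp := (MeasurePreserving.id (Measure.pi fun _ : Fin m => bernoulliLaw P.q)).prod
      (measurePreserving_snd (μ := Q)
        (ν := Measure.pi fun i : Fin m => Measure.pi fun _ : Fin P.b => D i))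
    exact (ExpectationLE.comp hmp hB).mono hm (fun _ => h0 _) fun ⟨ω, S', S⟩ => hXf ω S' S

end Seed

end

end Dream

/-! ### One iteration: noise of the estimators and consensus of the trackers. -/

namespace Dream

noncomputable section

/-- The contraction factor of `k` rounds of FastMix. -/
def mixRate (lam2 : ℝ) (k : ℕ) : ℝ := 14 * (1 - c₂ * √(1 - lam2)) ^ (2 * k)

theorem mixRate_nonneg (lam2 : ℝ) (k : ℕ) : 0 ≤ mixRate lam2 k := by
  rw [mixRate, pow_mul]; positivity

/-- FastMix with `W` preserves means and contracts consensus errors. -/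
structure Mixes {m : ℕ} (W : Matrix (Fin m) (Fin m) ℝ) (lam2 : ℝ) : Prop where
  doublyStochastic : W ∈ _root_.doublyStochastic ℝ (Fin m)
  contract : ∀ (V : Type) [NormedAddCommGroup V] [InnerProductSpace ℝ V] (a : Fin m → V) (k : ℕ),
    cons (fastMix W lam2 a k) ≤ mixRate lam2 k * cons a

theorem MixingMatrix.mixes {m : ℕ} {G : SimpleGraph (Fin m)} {W : Matrix (Fin m) (Fin m) ℝ}
    (hW : MixingMatrix G W) (hm : 2 ≤ m) : Mixes W (lambda2 hW.posSemidef.isHermitian hm) :=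
  ⟨hW.doublyStochastic, fun _ _ _ a k => cons_fastMix_le hW hm a k⟩

section Step

variable {m dx dy : ℕ} {Ξ : Type*} {P : Params}
  {F : Fin m → ZSpace dx dy → Ξ → ℝ} {W : Matrix (Fin m) (Fin m) ℝ} {lam2 : ℝ}
  {Y : Set (EuclideanSpace ℝ (Fin dy))}

/-- The points `z_{t+1}`, which do not depend on the random choices of iteration `t`. -/
def nextZ (P : Params) (W : Matrix (Fin m) (Fin m) ℝ) (lam2 : ℝ)
    (Y : Set (EuclideanSpace ℝ (Fin dy))) (st : State m dx dy) (i : Fin m) : ZSpace dx dy :=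
  pair (fastMix W lam2 (fun i => st.x i - (P.γ * P.η) • (st.s i).fst) P.K i)
    (fastMix W lam2 (fun i => proj Y (st.y i + P.η • (st.s i).snd)) P.K i)

theorem step_z (st : State m dx dy) (r : Seed m P.b P.bigB Ξ) (i : Fin m) :
    (step P W lam2 Y F st r).z i = nextZ P W lam2 Y st i := rfl

theorem step_true_g (st : State m dx dy) (ω : Fin m → Bool) (S' : BigBatch m P.bigB Ξ)
    (S : Fin m → Fin P.b → Ξ) (i : Fin m) :
    (step P W lam2 Y F st (true, ω, S', S)).g i = bigGrad F S' (nextZ P W lam2 Y st) i := rfl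

theorem step_false_g (st : State m dx dy) (ω : Fin m → Bool) (S' : BigBatch m P.bigB Ξ)
    (S : Fin m → Fin P.b → Ξ) (i : Fin m) :
    (step P W lam2 Y F st (false, ω, S', S)).g i = st.g i
      + ((if ω i then (1 : ℝ) else 0) / ((P.b : ℝ) * P.q)) •
        ∑ j, (stochGrad (F i) (nextZ P W lam2 Y st i) (S i j)
          - stochGrad (F i) (st.z i) (S i j)) := rfl

theorem step_true_s (st : State m dx dy) (ω : Fin m → Bool) (S' : BigBatch m P.bigB Ξ)
    (S : Fin m → Fin P.b → Ξ) :
    (step P W lam2 Y F st (true, ω, S', S)).s = fastMix W lam2 (st.s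
      + fun i => (step P W lam2 Y F st (true, ω, S', S)).g i - st.g i) P.bigK := by
  have : (st.s + fun i => (step P W lam2 Y F st (true, ω, S', S)).g i - st.g i)
    = fun i => st.s i + (step P W lam2 Y F st (true, ω, S', S)).g i - st.g i :=
      funext fun i => (add_sub_assoc _ _ _).symm
  rw [this]
  rfl

theorem step_false_s (st : State m dx dy) (ω : Fin m → Bool) (S' : BigBatch m P.bigB Ξ)
    (S : Fin m → Fin P.b → Ξ) :
    (step P W lam2 Y F st (false, ω, S', S)).s = fastMix W lam2 (st.s
      + fun i => (step P W lam2 Y F st (false, ω, S', S)).g i - st.g i) P.K := by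
  have : (st.s + fun i => (step P W lam2 Y F st (false, ω, S', S)).g i - st.g i)
    = fun i => st.s i + (step P W lam2 Y F st (false, ω, S', S)).g i - st.g i :=
      funext fun i => (add_sub_assoc _ _ _).symm
  rw [this]
  rfl

end Step

section OneStep

variable {m dx dy : ℕ} {Ξ : Type*} [MeasurableSpace Ξ] {P : Params} {D : Fin m → Measure Ξ}
  {F : Fin m → ZSpace dx dy → Ξ → ℝ} {W : Matrix (Fin m) (Fin m) ℝ} {lam2 : ℝ}
  {Y : Set (EuclideanSpace ℝ (Fin dy))} {L s2 : ℝ}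

/-- The error of the local gradient estimators. -/
def gradErr (D : Fin m → Measure Ξ) (F : Fin m → ZSpace dx dy → Ξ → ℝ) (st : State m dx dy)
    (i : Fin m) : ZSpace dx dy := st.g i - locGrad D F i (st.z i)

/-- The error of the mean gradient estimator, plus a multiple of the local errors. -/
def noise (D : Fin m → Measure Ξ) (F : Fin m → ZSpace dx dy → Ξ → ℝ) (st : State m dx dy) : ℝ :=
  ‖avg (gradErr D F st)‖ ^ 2 + 1 / (m : ℝ) ^ 2 * ∑ i, ‖gradErr D F st i‖ ^ 2

theorem noise_nonneg (st : State m dx dy) : 0 ≤ noise D F st := by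
  unfold noise; positivity

/-- The mean squared displacement `(1/m) ∑ i, ‖z_{t+1}(i) - z_t(i)‖²`. -/
def displacement (P : Params) (W : Matrix (Fin m) (Fin m) ℝ) (lam2 : ℝ)
    (Y : Set (EuclideanSpace ℝ (Fin dy))) (st : State m dx dy) : ℝ :=
  1 / (m : ℝ) * ∑ i, ‖nextZ P W lam2 Y st i - st.z i‖ ^ 2

theorem displacement_nonneg (st : State m dx dy) : 0 ≤ displacement P W lam2 Y st := by
  unfold displacement; positivity

theorem sum_single_smul {V : Type*} [AddCommGroup V] [Module ℝ V] (i : Fin m) (v : Fin m → V) :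
    ∑ k, (Pi.single i 1 : Fin m → ℝ) k • v k = v i := by
  rw [Finset.sum_eq_single i] <;> simp +contextual

theorem sum_single_sq_mul (i : Fin m) (v : Fin m → ℝ) :
    ∑ k, (Pi.single i 1 : Fin m → ℝ) k ^ 2 * v k = v i := by
  rw [Finset.sum_eq_single i] <;> simp +contextual

theorem locGrad_meas [∀ i, IsProbabilityMeasure (D i)] (h : Oracle D F L) (hL : 0 ≤ L)
    (i : Fin m) : Measurable (locGrad D F i) := by
  have : LipschitzWith ⟨L, hL⟩ (locGrad D F i) := LipschitzWith.of_dist_le_mul fun a b => by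
    rw [dist_eq_norm, dist_eq_norm]
    change _ ≤ L * _
    rw [← sq_le_sq₀ (norm_nonneg _) (mul_nonneg hL (norm_nonneg _)), mul_pow]
    exact h.locGrad_lip i a b
  exact this.continuous.measurable

section Meas

variable {α : Type*} [MeasurableSpace α] [∀ i, IsProbabilityMeasure (D i)] {st : α → State m dx dy}

theorem measurable_gradErr (h : Oracle D F L) (hL : 0 ≤ L) (hst : MeasurableState st) (i : Fin m) :
    Measurable fun o => gradErr D F (st o) i :=
  (hst.g i).sub ((locGrad_meas h hL i).comp (hst.z i))

theorem measurable_noise (h : Oracle D F L) (hL : 0 ≤ L) (hst : MeasurableState st) :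
    Measurable fun o => noise D F (st o) := by
  have h1 := measurable_gradErr h hL hst
  exact ((measurable_avg h1).norm.pow_const 2).add
    ((Finset.measurable_sum _ fun i _ => (h1 i).norm.pow_const 2).const_mul _)

end Meas

theorem expectationLE_batch_single {bigB : ℕ} {Q : Measure (BigBatch m bigB Ξ)}
    (hQ : BatchVariance D F Q s2) (z : Fin m → ZSpace dx dy) (i : Fin m) :
    ExpectationLE Q (fun S => ‖bigGrad F S z i - locGrad D F i (z i)‖ ^ 2) s2 := by
  have := hQ z (Pi.single i 1)
  simp only [sum_single_smul i fun k => bigGrad F _ z k - locGrad D F k (z k)] at this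
  have e := sum_single_sq_mul i fun _ => s2
  rw [← Finset.sum_mul] at e
  rwa [e] at this

theorem expectationLE_batch_avg {bigB : ℕ} {Q : Measure (BigBatch m bigB Ξ)} (hm : m ≠ 0)
    (hQ : BatchVariance D F Q s2) (z : Fin m → ZSpace dx dy) :
    ExpectationLE Q (fun S => ‖avg fun i => bigGrad F S z i - locGrad D F i (z i)‖ ^ 2)
      (s2 / m) := by
  have := hQ z fun _ => 1 / (m : ℝ)
  simp only [← Finset.smul_sum] at this
  have hm' : (m : ℝ) ≠ 0 := by exact_mod_cast hm
  have e : (∑ _i : Fin m, (1 / (m : ℝ)) ^ 2) * s2 = s2 / m := by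
    simp only [Finset.sum_const, Finset.card_univ, Fintype.card_fin, nsmul_eq_mul]
    field_simp
  rwa [e] at this

/-- The large batch error, in the form in which it enters `noise`. -/
theorem expectationLE_batch_noise {bigB : ℕ} {Q : Measure (BigBatch m bigB Ξ)} (hm : m ≠ 0)
    (hQ : BatchVariance D F Q s2) (z : Fin m → ZSpace dx dy) :
    ExpectationLE Q (fun S => ‖avg fun i => bigGrad F S z i - locGrad D F i (z i)‖ ^ 2
      + 1 / (m : ℝ) ^ 2 * ∑ i, ‖bigGrad F S z i - locGrad D F i (z i)‖ ^ 2) (2 * (s2 / m)) := by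
  have hm' : (m : ℝ) ≠ 0 := by exact_mod_cast hm
  refine ((expectationLE_batch_avg hm hQ z).add ((ExpectationLE.sum Finset.univ fun i _ =>
    expectationLE_batch_single hQ z i).const_mul (by positivity))).le (le_of_eq ?_)
  simp only [Finset.sum_const, Finset.card_univ, Fintype.card_fin, nsmul_eq_mul]
  field_simp
  ring

variable [∀ i, IsProbabilityMeasure (D i)] {Q : Measure (BigBatch m P.bigB Ξ)}
  [IsProbabilityMeasure Q]

theorem expectationLE_small (h : Oracle D F L) (hq0 : 0 < P.q) (hq1 : P.q ≤ 1) (hb : P.b ≠ 0)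
    (hbq : (P.b : ℝ) - P.b * P.q ≤ 1) (z' z : Fin m → ZSpace dx dy) (c : ZSpace dx dy)
    (a : Fin m → ℝ) :
    ExpectationLE ((Measure.pi fun _ : Fin m => bernoulliLaw P.q).prod
        (Measure.pi fun i : Fin m => Measure.pi fun _ : Fin P.b => D i))
      (fun r => ‖c + ∑ i, a i • (((if r.1 i then (1 : ℝ) else 0) / ((P.b : ℝ) * P.q)) •
        ∑ j, (stochGrad (F i) (z' i) (r.2 i j) - stochGrad (F i) (z i) (r.2 i j))
          - (locGrad D F i (z' i) - locGrad D F i (z i)))‖ ^ 2)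
      (‖c‖ ^ 2 + ∑ i, a i ^ 2 * (L ^ 2 * ‖z' i - z i‖ ^ 2 / (P.b * P.q))) := by
  have := expectationLE_smallBatch
    (h := fun i ξ => stochGrad (F i) (z' i) ξ - stochGrad (F i) (z i) ξ)
    (M := fun i => L ^ 2 * ‖z' i - z i‖ ^ 2)
    (fun i => ((h.meas i).comp (measurable_const.prodMk measurable_id)).sub
      ((h.meas i).comp (measurable_const.prodMk measurable_id)))
    (fun i => h.memLp i (z' i) (z i)) (fun i => h.sq_le i (z' i) (z i)) hq0 hq1 hb hbq c a
  simpa only [h.mean_diff] using this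

theorem expectationLE_small_single (h : Oracle D F L) (hq0 : 0 < P.q) (hq1 : P.q ≤ 1)
    (hb : P.b ≠ 0) (hbq : (P.b : ℝ) - P.b * P.q ≤ 1) (z' z : Fin m → ZSpace dx dy)
    (c : ZSpace dx dy) (i : Fin m) :
    ExpectationLE ((Measure.pi fun _ : Fin m => bernoulliLaw P.q).prod
        (Measure.pi fun i : Fin m => Measure.pi fun _ : Fin P.b => D i))
      (fun r => ‖c + (((if r.1 i then (1 : ℝ) else 0) / ((P.b : ℝ) * P.q)) •
        ∑ j, (stochGrad (F i) (z' i) (r.2 i j) - stochGrad (F i) (z i) (r.2 i j))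
          - (locGrad D F i (z' i) - locGrad D F i (z i)))‖ ^ 2)
      (‖c‖ ^ 2 + L ^ 2 * ‖z' i - z i‖ ^ 2 / (P.b * P.q)) := by
  have := expectationLE_small h hq0 hq1 hb hbq z' z c (Pi.single i 1)
  rw [sum_single_sq_mul i fun i => L ^ 2 * ‖z' i - z i‖ ^ 2 / (P.b * P.q)] at this
  convert this using 4 with r
  rw [sum_single_smul i fun i => ((if r.1 i then (1 : ℝ) else 0) / ((P.b : ℝ) * P.q)) •
        ∑ j, (stochGrad (F i) (z' i) (r.2 i j) - stochGrad (F i) (z i) (r.2 i j))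
          - (locGrad D F i (z' i) - locGrad D F i (z i))]

/-- The expected noise after one iteration. -/
theorem expectationLE_noise_step (hm : m ≠ 0) (h : Oracle D F L) (hL : 0 ≤ L)
    (hY : Measurable (proj Y)) (hQ : BatchVariance D F Q s2) (hp0 : 0 ≤ P.p) (hp1 : P.p ≤ 1)
    (hq0 : 0 < P.q) (hq1 : P.q ≤ 1) (hb : P.b ≠ 0) (hbq : (P.b : ℝ) - P.b * P.q ≤ 1)
    (st : State m dx dy) :
    ExpectationLE (seedLaw P D Q) (fun r => noise D F (step P W lam2 Y F st r))
      (P.p * (2 * (s2 / m)) + (1 - P.p) * (noise D F st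
        + 2 * (L ^ 2 * displacement P W lam2 Y st / (m * (P.b * P.q))))) := by
  have hm' : (m : ℝ) ≠ 0 := by exact_mod_cast hm
  have hst : MeasurableState fun _ : Seed m P.b P.bigB Ξ => st :=
    ⟨fun _ => measurable_const, fun _ => measurable_const, fun _ => measurable_const,
      fun _ => measurable_const, measurable_const, measurable_const⟩
  have hmeas := measurable_noise h hL (measurableState_step (W := W) (lam2 := lam2) h.meas hY hst
    measurable_id)
  set z' := nextZ P W lam2 Y st with hz'
  -- The mean error uses weights 1/m, where independence of the agents gains a factor m; the local
  -- errors are bounded singly and carry the weight 1/m². Both increments are the same, whence the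
  -- factor 2 in the bound.
  have h1 := expectationLE_small h hq0 hq1 hb hbq z' st.z (avg (gradErr D F st))
    fun _ => 1 / (m : ℝ)
  have h2 := fun i => expectationLE_small_single h hq0 hq1 hb hbq z' st.z (gradErr D F st i) i
  have h3 := h1.add ((ExpectationLE.sum Finset.univ fun i _ => h2 i).const_mul
    (by positivity : 0 ≤ 1 / (m : ℝ) ^ 2))
  -- The estimator is recursive: without a refresh, the old local error persists and a centred
  -- increment is added.
  have herr : ∀ (ω : Fin m → Bool) (S' : BigBatch m P.bigB Ξ) (S : Fin m → Fin P.b → Ξ) (i : Fin m),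
      gradErr D F (step P W lam2 Y F st (false, ω, S', S)) i = gradErr D F st i
      + (((if ω i then (1 : ℝ) else 0) / ((P.b : ℝ) * P.q)) •
        ∑ j, (stochGrad (F i) (z' i) (S i j) - stochGrad (F i) (st.z i) (S i j))
          - (locGrad D F i (z' i) - locGrad D F i (st.z i))) := by
    intro ω S' S i
    simp only [gradErr, step_z, step_false_g]
    abel
  refine (expectationLE_seedLaw hp0 hp1 hmeas (fun r => noise_nonneg _)
    (expectationLE_batch_noise hm hQ z') (fun ω S' S => le_of_eq ?_) h3
    (fun ω S' S => le_of_eq ?_)).le (le_of_eq ?_)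
  · rfl
  · have e1 : avg (gradErr D F (step P W lam2 Y F st (false, ω, S', S)))
        = avg (gradErr D F st) + ∑ i, (1 / (m : ℝ)) • (((if ω i then (1 : ℝ) else 0)
          / ((P.b : ℝ) * P.q)) •
        ∑ j, (stochGrad (F i) (z' i) (S i j) - stochGrad (F i) (st.z i) (S i j))
          - (locGrad D F i (z' i) - locGrad D F i (st.z i))) := by
      rw [← Finset.smul_sum]
      simp only [avg, herr, Finset.sum_add_distrib, smul_add]
    simp only [id, noise]
    rw [e1]
    simp only [herr]
  · congr 2
    simp only [noise, displacement, Finset.sum_add_distrib, Finset.mul_sum, mul_add, ← hz']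
    rw [add_assoc, add_assoc]
    congr 1
    rw [← add_assoc, add_comm (∑ i, _) (∑ i, _), add_assoc]
    congr 1
    rw [← Finset.sum_add_distrib, Finset.sum_div, Finset.mul_sum]
    refine Finset.sum_congr rfl fun i _ => ?_
    field_simp
    ring

/-- The expected consensus error of the gradient tracker after one iteration. -/
theorem expectationLE_cons_step (hm : m ≠ 0) (h : Oracle D F L)
    (hW : Mixes W lam2) (hY : Measurable (proj Y)) (hQ : BatchVariance D F Q s2)
    (hp0 : 0 ≤ P.p) (hp1 : P.p ≤ 1)
    (hq0 : 0 < P.q) (hq1 : P.q ≤ 1) (hb : P.b ≠ 0) (hbq : (P.b : ℝ) - P.b * P.q ≤ 1)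
    (st : State m dx dy) :
    ExpectationLE (seedLaw P D Q) (fun r => cons (step P W lam2 Y F st r).s)
      (P.p * (mixRate lam2 P.bigK * (2 * cons st.s + 2 * (3 * (m * s2)
          + 3 * (L ^ 2 * (m * displacement P W lam2 Y st)) + 3 * (m ^ 2 * noise D F st))))
        + (1 - P.p) * (mixRate lam2 P.K * (2 * cons st.s
          + 2 * ((1 + 1 / (P.b * P.q)) * (L ^ 2 * (m * displacement P W lam2 Y st)))))) := by
  have hm' : (m : ℝ) ≠ 0 := by exact_mod_cast hm
  have hst : MeasurableState fun _ : Seed m P.b P.bigB Ξ => st :=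
    ⟨fun _ => measurable_const, fun _ => measurable_const, fun _ => measurable_const,
      fun _ => measurable_const, measurable_const, measurable_const⟩
  have hmeas := measurable_cons (measurableState_step (W := W) (lam2 := lam2) h.meas hY hst
    measurable_id).s
  set z' := nextZ P W lam2 Y st with hz'
  have hX : m * displacement P W lam2 Y st = ∑ i, ‖z' i - st.z i‖ ^ 2 := by
    rw [displacement, ← mul_assoc, mul_one_div_cancel hm', one_mul]
  have hR1 := mixRate_nonneg lam2 P.bigK
  have hR2 := mixRate_nonneg lam2 P.K
  have hcons : ∀ a : Fin m → ZSpace dx dy,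
      cons (st.s + a) ≤ 2 * cons st.s + 2 * ∑ i, ‖a i‖ ^ 2 := fun a =>
    (cons_add_le _ _).trans (by linarith [cons_le_sum_sq hm a])
  -- large batches
  have hA0 : ExpectationLE Q (fun S' => ∑ i, (3 * ‖bigGrad F S' z' i - locGrad D F i (z' i)‖ ^ 2
      + (3 * ‖locGrad D F i (z' i) - locGrad D F i (st.z i)‖ ^ 2 + 3 * ‖gradErr D F st i‖ ^ 2)))
      (∑ i, (3 * s2 + (3 * ‖locGrad D F i (z' i) - locGrad D F i (st.z i)‖ ^ 2
        + 3 * ‖gradErr D F st i‖ ^ 2))) :=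
    ExpectationLE.sum _ fun i _ =>
      ((expectationLE_batch_single hQ z' i).const_mul (by norm_num)).add (ExpectationLE.const _)
  have hA1 : ∑ i, (3 * s2 + (3 * ‖locGrad D F i (z' i) - locGrad D F i (st.z i)‖ ^ 2
        + 3 * ‖gradErr D F st i‖ ^ 2))
      ≤ 3 * (m * s2) + 3 * (L ^ 2 * (m * displacement P W lam2 Y st))
        + 3 * (m ^ 2 * noise D F st) := by
    have e1 : ∑ i, ‖locGrad D F i (z' i) - locGrad D F i (st.z i)‖ ^ 2
        ≤ L ^ 2 * (m * displacement P W lam2 Y st) := by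
      rw [hX, Finset.mul_sum]
      exact Finset.sum_le_sum fun i _ => h.locGrad_lip i _ _
    have e2 : ∑ i, ‖gradErr D F st i‖ ^ 2 ≤ m ^ 2 * noise D F st := by
      rw [noise, mul_add, ← mul_assoc, mul_one_div_cancel (pow_ne_zero 2 hm'), one_mul]
      have : 0 ≤ (m : ℝ) ^ 2 * ‖avg (gradErr D F st)‖ ^ 2 := by positivity
      linarith
    simp only [Finset.sum_add_distrib, ← Finset.mul_sum, Finset.sum_const, Finset.card_univ, Fintype.card_fin, nsmul_eq_mul]
    linarith
  have hA := ((ExpectationLE.const (ν := Q) (2 * cons st.s)).add ((hA0.le hA1).const_mul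
    (by norm_num : (0 : ℝ) ≤ 2))).const_mul hR1
  -- small batches
  have hB0 := fun i => expectationLE_small_single h hq0 hq1 hb hbq z' st.z
    (locGrad D F i (z' i) - locGrad D F i (st.z i)) i
  simp only [add_sub_cancel] at hB0
  have hB1 : ∑ i, (‖locGrad D F i (z' i) - locGrad D F i (st.z i)‖ ^ 2
      + L ^ 2 * ‖z' i - st.z i‖ ^ 2 / (P.b * P.q))
      ≤ (1 + 1 / (P.b * P.q)) * (L ^ 2 * (m * displacement P W lam2 Y st)) := by
    rw [hX, Finset.mul_sum, Finset.mul_sum]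
    refine Finset.sum_le_sum fun i _ => ?_
    have := h.locGrad_lip i (z' i) (st.z i)
    rw [add_mul, one_mul, one_div, div_eq_inv_mul]
    linarith
  have hB := ((ExpectationLE.const
    (ν := (Measure.pi fun _ : Fin m => bernoulliLaw P.q).prod
        (Measure.pi fun i : Fin m => Measure.pi fun _ : Fin P.b => D i))
    (2 * cons st.s)).add (((ExpectationLE.sum Finset.univ fun i _ => hB0 i).le hB1).const_mul
    (by norm_num : (0 : ℝ) ≤ 2))).const_mul hR2
  refine expectationLE_seedLaw hp0 hp1 hmeas (fun r => cons_nonneg _) hA (fun ω S' S => ?_) hB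
    (fun ω S' S => ?_)
  · simp only [id]
    rw [step_true_s]
    refine (hW.contract _ _ _).trans (mul_le_mul_of_nonneg_left ?_ hR1)
    refine (hcons _).trans ?_
    gcongr with i
    -- A refresh discards the old estimator, so its local error enters the tracker and has to be
    -- contracted by the longer FastMix.
    have e : (step P W lam2 Y F st (true, ω, S', S)).g i - st.g i
        = (bigGrad F S' z' i - locGrad D F i (z' i))
          + (locGrad D F i (z' i) - locGrad D F i (st.z i)) + -gradErr D F st i := by
      rw [step_true_g, gradErr]
      abel
    rw [e]
    refine (norm_add_three_sq_le _ _ _).trans (le_of_eq ?_)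
    rw [norm_neg]
    ring
  · simp only [id]
    rw [step_false_s]
    refine (hW.contract _ _ _).trans (mul_le_mul_of_nonneg_left ?_ hR2)
    refine (hcons _).trans (le_of_eq ?_)
    congr 2
    refine Finset.sum_congr rfl fun i _ => ?_
    rw [step_false_g, add_sub_cancel_left]

end OneStep

end

end Dream

/-! ### The potential function and its expected drift. -/

namespace Dream

noncomputable section

section LinearAvg

variable {m dx dy : ℕ}

/-- The projection `(x, y) ↦ x` as a linear map. -/
def fstLin (dx dy : ℕ) : ZSpace dx dy →ₗ[ℝ] EuclideanSpace ℝ (Fin dx) where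
  toFun z := z.fst
  map_add' _ _ := rfl
  map_smul' _ _ := rfl

/-- The projection `(x, y) ↦ y` as a linear map. -/
def sndLin (dx dy : ℕ) : ZSpace dx dy →ₗ[ℝ] EuclideanSpace ℝ (Fin dy) where
  toFun z := z.snd
  map_add' _ _ := rfl
  map_smul' _ _ := rfl

theorem map_avg {V V' : Type*} [AddCommGroup V] [Module ℝ V] [AddCommGroup V'] [Module ℝ V']
    (g : V →ₗ[ℝ] V') (a : Fin m → V) : g (avg a) = avg fun i => g (a i) := by
  simp [avg, map_sum]

theorem fst_avg (a : Fin m → ZSpace dx dy) : (avg a).fst = avg fun i => (a i).fst :=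
  map_avg (fstLin dx dy) a

theorem snd_avg (a : Fin m → ZSpace dx dy) : (avg a).snd = avg fun i => (a i).snd :=
  map_avg (sndLin dx dy) a

theorem norm_sq_eq (z : ZSpace dx dy) : ‖z‖ ^ 2 = ‖z.fst‖ ^ 2 + ‖z.snd‖ ^ 2 :=
  WithLp.prod_norm_sq_eq_of_L2 _

theorem cons_eq_add (a : Fin m → ZSpace dx dy) :
    cons a = cons (fun i => (a i).fst) + cons (fun i => (a i).snd) := by
  simp only [cons, ← fst_avg, ← snd_avg, ← Finset.sum_add_distrib]
  exact Finset.sum_congr rfl fun i _ => norm_sq_eq _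

theorem avg_pair (x : Fin m → EuclideanSpace ℝ (Fin dx)) (y : Fin m → EuclideanSpace ℝ (Fin dy)) :
    avg (fun i => pair (x i) (y i)) = pair (avg x) (avg y) := by
  have h1 := fst_avg fun i => pair (x i) (y i)
  have h2 := snd_avg fun i => pair (x i) (y i)
  exact congrArg (WithLp.toLp 2) (Prod.ext h1 h2)

end LinearAvg

section Drift

variable {m dx dy : ℕ} {Ξ : Type*} [MeasurableSpace Ξ]

/-- The gradient of the global objective. -/
def globGrad (D : Fin m → Measure Ξ) (F : Fin m → ZSpace dx dy → Ξ → ℝ) (z : ZSpace dx dy) :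
    ZSpace dx dy := avg fun i => locGrad D F i z

/-- The assumptions under which the potential function decreases. -/
structure Setup (P : Params) (D : Fin m → Measure Ξ) (F : Fin m → ZSpace dx dy → Ξ → ℝ)
    (Q : Measure (BigBatch m P.bigB Ξ)) (W : Matrix (Fin m) (Fin m) ℝ) (lam2 : ℝ)
    (Y : Set (EuclideanSpace ℝ (Fin dy))) (L μ s2 : ℝ) : Prop where
  m_ne : m ≠ 0
  prob : ∀ i, IsProbabilityMeasure (D i)
  probQ : IsProbabilityMeasure Q
  oracle : Oracle D F L
  smooth : SmoothConcave (globalObj D F) (globGrad D F) L μ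
  mu_le : μ ≤ L
  isClosed : IsClosed Y
  convex : Convex ℝ Y
  nonempty : Y.Nonempty
  bdd : BddBelow (Set.range (primal Y (globalObj D F)))
  mixes : Mixes W lam2
  batch : BatchVariance D F Q s2
  s2_nonneg : 0 ≤ s2
  p_pos : 0 < P.p
  p_le : P.p ≤ 1
  q_pos : 0 < P.q
  q_le : P.q ≤ 1
  b_ne : P.b ≠ 0
  bq : (P.b : ℝ) - P.b * P.q ≤ 1
  eta_eq : P.η = 1 / (48 * L)
  gamma_eq : P.γ = gammaOf (L / μ)
  p_eq : (1 - P.p) / (m * (P.b * P.q)) = P.p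
  rate : mixRate lam2 P.K ≤ 1 / 38416
  rate' : mixRate lam2 P.K * (1 + 1 / (P.b * P.q)) ≤ 2 / 38416
  rateBig : mixRate lam2 P.bigK * m ^ 2 ≤ 1 / 38416

/-- The gradient tracker has the mean of the gradient estimators, and the mean of the `y`-iterates
is feasible. -/
def Invariant (Y : Set (EuclideanSpace ℝ (Fin dy))) (st : State m dx dy) : Prop :=
  avg st.s = avg st.g ∧ avg st.y ∈ Y

/-- The mean consensus error of the iterates. -/
def consZ (st : State m dx dy) : ℝ := (cons st.x + cons st.y) / m

/-- The rescaled mean consensus error of the gradient tracker. -/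
def consS (P : Params) (st : State m dx dy) : ℝ := P.η ^ 2 * cons st.s / m

/-- The potential function. -/
def potential (P : Params) (D : Fin m → Measure Ξ) (F : Fin m → ZSpace dx dy → Ξ → ℝ)
    (Y : Set (EuclideanSpace ℝ (Fin dy))) (L : ℝ) (st : State m dx dy) : ℝ :=
  (merit Y (globalObj D F) (avg st.x) (avg st.y) - ⨅ x, primal Y (globalObj D F) x)
    + P.η / (5 * P.p) * noise D F st + 5 * L * (consZ st + consS P st)

/-- The mean squared norm of the gradient of the primal function. -/
def gradSq (D : Fin m → Measure Ξ) (F : Fin m → ZSpace dx dy → Ξ → ℝ)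
    (Y : Set (EuclideanSpace ℝ (Fin dy))) (st : State m dx dy) : ℝ :=
  1 / (m : ℝ) * ∑ i, ‖SmoothConcave.gradPrimal Y (globalObj D F) (globGrad D F) (st.x i)‖ ^ 2

variable {P : Params} {D : Fin m → Measure Ξ} {F : Fin m → ZSpace dx dy → Ξ → ℝ}
  {Q : Measure (BigBatch m P.bigB Ξ)} {W : Matrix (Fin m) (Fin m) ℝ} {lam2 : ℝ}
  {Y : Set (EuclideanSpace ℝ (Fin dy))} {L μ s2 : ℝ}

theorem consZ_nonneg (st : State m dx dy) : 0 ≤ consZ st :=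
  div_nonneg (add_nonneg (cons_nonneg _) (cons_nonneg _)) (Nat.cast_nonneg _)

theorem consS_nonneg (st : State m dx dy) : 0 ≤ consS P st :=
  div_nonneg (mul_nonneg (sq_nonneg _) (cons_nonneg _)) (Nat.cast_nonneg _)

theorem norm_avg_gradErr_le (st : State m dx dy) :
    ‖avg (gradErr D F st)‖ ^ 2 ≤ noise D F st := by
  have : 0 ≤ 1 / (m : ℝ) ^ 2 * ∑ i, ‖gradErr D F st i‖ ^ 2 := by positivity
  unfold noise
  linarith

theorem gradSq_nonneg (st : State m dx dy) : 0 ≤ gradSq D F Y st := by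
  unfold gradSq; positivity

namespace Setup

theorem eta_pos (h : Setup P D F Q W lam2 Y L μ s2) : 0 < P.η := by
  rw [h.eta_eq]; have := h.smooth.L_pos; positivity

theorem eta_mul (h : Setup P D F Q W lam2 Y L μ s2) : P.η * L = 1 / 48 := by
  rw [h.eta_eq]; have := h.smooth.L_pos; field_simp

theorem kappa_ge (h : Setup P D F Q W lam2 Y L μ s2) : 1 ≤ L / μ :=
  (one_le_div h.smooth.mu_pos).2 h.mu_le

theorem gamma_mul (h : Setup P D F Q W lam2 Y L μ s2) : P.γ * (L / μ) ^ 2 = 1 / 1152 := by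
  have := h.smooth.L_pos
  have := h.smooth.mu_pos
  rw [h.gamma_eq, gammaOf_eq]
  field_simp

theorem gamma_pos (h : Setup P D F Q W lam2 Y L μ s2) : 0 < P.γ := by
  have := h.kappa_ge
  rw [h.gamma_eq, gammaOf_eq]
  positivity

theorem gamma_le (h : Setup P D F Q W lam2 Y L μ s2) : P.γ ≤ 1 / 1152 :=
  h.gamma_mul ▸ le_mul_of_one_le_right h.gamma_pos.le (one_le_pow₀ h.kappa_ge)

theorem merit_ge (h : Setup P D F Q W lam2 Y L μ s2) (x : EuclideanSpace ℝ (Fin dx))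
    {y : EuclideanSpace ℝ (Fin dy)} (hy : y ∈ Y) :
    0 ≤ merit Y (globalObj D F) x y - ⨅ x, primal Y (globalObj D F) x := by
  have h1 := h.smooth.le_primal h.isClosed h.nonempty x hy
  have h2 := ciInf_le h.bdd x
  simp only [merit, alpha]
  linarith

theorem potential_nonneg (h : Setup P D F Q W lam2 Y L μ s2) {st : State m dx dy}
    (hst : Invariant Y st) : 0 ≤ potential P D F Y L st := by
  have h1 := h.merit_ge (avg st.x) hst.2
  have h2 : 0 ≤ P.η / (5 * P.p) * noise D F st :=
    mul_nonneg (div_nonneg h.eta_pos.le (by linarith [h.p_pos])) (noise_nonneg st)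
  have h3 : 0 ≤ 5 * L * (consZ st + consS P st) :=
    mul_nonneg (by linarith [h.smooth.L_pos]) (add_nonneg (consZ_nonneg _) (consS_nonneg _))
  unfold potential
  linarith

theorem avg_step_x (h : Setup P D F Q W lam2 Y L μ s2) (st : State m dx dy)
    (r : Seed m P.b P.bigB Ξ) :
    avg (step P W lam2 Y F st r).x = avg st.x - (P.γ * P.η) • (avg st.s).fst := by
  have : (fun i => st.x i - (P.γ * P.η) • (st.s i).fst)
    = st.x - (P.γ * P.η) • fun i => (st.s i).fst := rfl
  change avg (fastMix W lam2 (fun i => st.x i - (P.γ * P.η) • (st.s i).fst) P.K) = _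
  rw [avg_fastMix h.mixes.doublyStochastic, this, avg_sub, avg_smul, fst_avg]

/-- The arguments of the projections. -/
def ascent (P : Params) (st : State m dx dy) (i : Fin m) : EuclideanSpace ℝ (Fin dy) :=
  st.y i + P.η • (st.s i).snd

theorem avg_step_y (h : Setup P D F Q W lam2 Y L μ s2) (st : State m dx dy)
    (r : Seed m P.b P.bigB Ξ) :
    avg (step P W lam2 Y F st r).y = avg fun i => proj Y (ascent P st i) :=
  avg_fastMix h.mixes.doublyStochastic _ _ _

theorem avg_ascent (st : State m dx dy) :
    avg (ascent P st) = avg st.y + P.η • (avg st.s).snd := by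
  have : ascent P st = st.y + P.η • fun i => (st.s i).snd := rfl
  rw [this, avg_add, avg_smul, snd_avg]

theorem cons_ascent_le (st : State m dx dy) :
    cons (ascent P st) ≤ 2 * cons st.y + 2 * (P.η ^ 2 * cons fun i => (st.s i).snd) := by
  have : ascent P st = st.y + P.η • fun i => (st.s i).snd := rfl
  rw [this, ← cons_smul]
  exact cons_add_le _ _

theorem invariant_step (h : Setup P D F Q W lam2 Y L μ s2) {st : State m dx dy}
    (hst : Invariant Y st) (r : Seed m P.b P.bigB Ξ) :
    Invariant Y (step P W lam2 Y F st r) := by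
  constructor
  · have e : avg (step P W lam2 Y F st r).s = avg (fun i => st.s i
        + (step P W lam2 Y F st r).g i - st.g i) :=
      avg_fastMix h.mixes.doublyStochastic _ _ _
    have e2 : (fun i => st.s i + (step P W lam2 Y F st r).g i - st.g i)
      = st.s + (step P W lam2 Y F st r).g - st.g := rfl
    rw [e, e2, avg_sub, avg_add, hst.1]
    abel
  · rw [h.avg_step_y]
    exact avg_mem h.m_ne h.convex fun i => (proj_spec h.isClosed h.convex h.nonempty _).1

/-- The local steps add at most the disagreement of the trackers scaled by η (in x, even by γη), the
projection does not increase disagreement, and FastMix contracts the result. -/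
theorem consZ_step_le (h : Setup P D F Q W lam2 Y L μ s2) (st : State m dx dy)
    (r : Seed m P.b P.bigB Ξ) :
    consZ (step P W lam2 Y F st r) ≤ 2 / 38416 * (consZ st + consS P st) := by
  have hm : (0 : ℝ) < m := by have := h.m_ne; positivity
  have hR0 := mixRate_nonneg lam2 P.K
  have h1 : cons (step P W lam2 Y F st r).x
      ≤ mixRate lam2 P.K * (2 * cons st.x + 2 * (P.η ^ 2 * cons fun i => (st.s i).fst)) := by
    refine (h.mixes.contract _ _ _).trans (mul_le_mul_of_nonneg_left ?_ hR0)
    have e : (fun i => st.x i - (P.γ * P.η) • (st.s i).fst)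
      = st.x + (-(P.γ * P.η)) • fun i => (st.s i).fst := by
        funext i; simp [sub_eq_add_neg]
    rw [e]
    refine (cons_add_le _ _).trans ?_
    rw [cons_smul, neg_sq, mul_pow]
    have hg : P.γ ^ 2 ≤ 1 := by nlinarith [h.gamma_pos, h.gamma_le]
    have := mul_le_mul_of_nonneg_right hg
      (mul_nonneg (sq_nonneg P.η) (cons_nonneg fun i => (st.s i).fst))
    linarith
  have h2 : cons (step P W lam2 Y F st r).y
      ≤ mixRate lam2 P.K * (2 * cons st.y + 2 * (P.η ^ 2 * cons fun i => (st.s i).snd)) := by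
    refine (h.mixes.contract _ _ _).trans (mul_le_mul_of_nonneg_left ?_ hR0)
    exact (cons_proj_le h.m_ne h.isClosed h.convex h.nonempty _).trans (cons_ascent_le st)
  have h3 := cons_eq_add st.s
  have h4 : 0 ≤ 2 * (cons st.x + cons st.y) + 2 * (P.η ^ 2 * cons st.s) := by
    have := cons_nonneg st.x
    have := cons_nonneg st.y
    have := cons_nonneg st.s
    positivity
  have h5 := mul_le_mul_of_nonneg_right h.rate h4
  have e : 2 / 38416 * (consZ st + consS P st)
      = 1 / 38416 * (2 * (cons st.x + cons st.y) + 2 * (P.η ^ 2 * cons st.s)) / m := by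
    simp only [consZ, consS]
    field_simp
  rw [e]
  simp only [consZ]
  gcongr
  rw [h3] at h5 ⊢
  linarith

/-- Pass through the means at both times: an agent's displacement consists of two consensus errors
and the move of the mean iterate. -/
theorem displacement_le (h : Setup P D F Q W lam2 Y L μ s2) (st : State m dx dy)
    (r : Seed m P.b P.bigB Ξ) :
    displacement P W lam2 Y st ≤ 3 * consZ (step P W lam2 Y F st r) + 3 * consZ st
      + 3 * ((P.γ * P.η) ^ 2 * ‖(avg st.s).fst‖ ^ 2)
      + 3 * ‖avg (step P W lam2 Y F st r).y - avg st.y‖ ^ 2 := by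
  have hm : (0 : ℝ) < m := by have := h.m_ne; positivity
  have hx := h.avg_step_x st r
  set st' := step P W lam2 Y F st r with hst'
  have hcz : ∀ s : State m dx dy, cons s.z = cons s.x + cons s.y := fun s => cons_eq_add s.z
  have hav : ∀ s : State m dx dy, avg s.z = pair (avg s.x) (avg s.y) := fun s => avg_pair _ _
  have hd : ‖avg st'.z - avg st.z‖ ^ 2 = (P.γ * P.η) ^ 2 * ‖(avg st.s).fst‖ ^ 2
      + ‖avg st'.y - avg st.y‖ ^ 2 := by
    rw [hav, hav, pair_sub, norm_pair_sq, hx, sub_sub_cancel_left, norm_neg, norm_smul, mul_pow,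
      Real.norm_eq_abs, sq_abs]
  have h1 : ∀ i, ‖nextZ P W lam2 Y st i - st.z i‖ ^ 2 ≤ 3 * ‖st'.z i - avg st'.z‖ ^ 2
      + 3 * ‖st.z i - avg st.z‖ ^ 2 + 3 * ‖avg st'.z - avg st.z‖ ^ 2 := by
    intro i
    have e : nextZ P W lam2 Y st i - st.z i = (st'.z i - avg st'.z) + -(st.z i - avg st.z)
        + (avg st'.z - avg st.z) := by
      rw [← step_z (F := F) st r i]; abel
    rw [e]
    refine (norm_add_three_sq_le _ _ _).trans (le_of_eq ?_)
    rw [norm_neg]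
  have h2 : ∑ i, ‖nextZ P W lam2 Y st i - st.z i‖ ^ 2 ≤ 3 * cons st'.z + 3 * cons st.z
      + m * (3 * ‖avg st'.z - avg st.z‖ ^ 2) := by
    refine (Finset.sum_le_sum fun i _ => h1 i).trans (le_of_eq ?_)
    simp only [Finset.sum_add_distrib, ← Finset.mul_sum, Finset.sum_const, Finset.card_univ,
      Fintype.card_fin, nsmul_eq_mul, cons]
    ring
  rw [hcz, hcz, hd] at h2
  have h3 := mul_le_mul_of_nonneg_left h2 (by positivity : 0 ≤ 1 / (m : ℝ))
  refine h3.trans (le_of_eq ?_)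
  simp only [consZ]
  field_simp
  ring

/-- ∇P is 2κL-Lipschitz and γκ² is an absolute constant, so passing from the mean iterate to the
individual ones costs only a small multiple of L times the consensus error. -/
theorem gradSq_le (h : Setup P D F Q W lam2 Y L μ s2) (st : State m dx dy) :
    P.γ * P.η / 4 * gradSq D F Y st
      ≤ P.γ * P.η / 2
        * ‖SmoothConcave.gradPrimal Y (globalObj D F) (globGrad D F) (avg st.x)‖ ^ 2
        + L / 100 * consZ st := by
  have hm : (0 : ℝ) < m := by have := h.m_ne; positivity
  have hL := h.smooth.L_pos
  set gP := SmoothConcave.gradPrimal Y (globalObj D F) (globGrad D F)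
  have h1 : ∀ i, ‖gP (st.x i)‖ ^ 2 ≤ 2 * ‖gP (avg st.x)‖ ^ 2
      + 2 * ((2 * (L / μ) * L) ^ 2 * ‖st.x i - avg st.x‖ ^ 2) := by
    intro i
    have e : gP (st.x i) = gP (avg st.x) + (gP (st.x i) - gP (avg st.x)) := by abel
    have h2 := h.smooth.norm_grad_yStar_sub_le h.isClosed h.convex h.nonempty h.mu_le (st.x i)
      (avg st.x)
    have h3 := norm_add_sq_le_two (gP (avg st.x)) (gP (st.x i) - gP (avg st.x))
    rw [← e] at h3
    refine h3.trans ?_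
    rw [← mul_pow]
    gcongr
  have h2 : gradSq D F Y st ≤ 2 * ‖gP (avg st.x)‖ ^ 2
      + 2 * ((2 * (L / μ) * L) ^ 2 * (cons st.x / m)) := by
    have := mul_le_mul_of_nonneg_left (Finset.sum_le_sum fun i (_ : i ∈ Finset.univ) => h1 i)
      (by positivity : 0 ≤ 1 / (m : ℝ))
    refine this.trans (le_of_eq ?_)
    simp only [Finset.sum_add_distrib, ← Finset.mul_sum, Finset.sum_const, Finset.card_univ,
      Fintype.card_fin, nsmul_eq_mul, cons]
    field_simp
  have h3 := mul_le_mul_of_nonneg_left h2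
    (by have := h.gamma_pos; have := h.eta_pos; positivity : 0 ≤ P.γ * P.η / 4)
  have hx : cons st.x / m ≤ consZ st := by
    unfold consZ
    gcongr
    linarith [cons_nonneg st.y]
  have e : P.γ * P.η / 4 * (2 * ((2 * (L / μ) * L) ^ 2 * (cons st.x / m)))
      = 2 * (P.γ * (L / μ) ^ 2) * (P.η * L) * (L * (cons st.x / m)) := by ring
  rw [h.gamma_mul, h.eta_mul] at e
  have h4 : L * (cons st.x / m) ≤ L * consZ st := by gcongr
  have h5 : 0 ≤ L * consZ st := mul_nonneg hL.le (consZ_nonneg st)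
  rw [mul_add, e] at h3
  linarith

/-- By gradient tracking the mean of `s` is the mean of `g`. Its error is the mean estimation error
plus the effect of evaluating the local gradients at the agents' own points instead of the mean
point. -/
theorem mean_error_le (h : Setup P D F Q W lam2 Y L μ s2) {st : State m dx dy}
    (hst : Invariant Y st) :
    ‖(avg st.s).fst - (globGrad D F (pair (avg st.x) (avg st.y))).fst‖ ^ 2
      + ‖(avg st.s).snd - (globGrad D F (pair (avg st.x) (avg st.y))).snd‖ ^ 2
      ≤ 2 * noise D F st + 2 * (L ^ 2 * consZ st) := by
  have hm : (0 : ℝ) < m := by have := h.m_ne; positivity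
  have := h.prob
  have e0 := norm_sq_eq (avg st.s - globGrad D F (pair (avg st.x) (avg st.y)))
  refine e0.symm.le.trans ?_
  have hav : pair (avg st.x) (avg st.y) = avg st.z := (avg_pair _ _).symm
  rw [hst.1, hav]
  have e1 : avg st.g - globGrad D F (avg st.z) = avg (gradErr D F st)
      + (avg (fun i => locGrad D F i (st.z i)) - avg fun i => locGrad D F i (avg st.z)) := by
    have h1 : avg (gradErr D F st) = avg st.g - avg fun i => locGrad D F i (st.z i) :=
      avg_sub st.g fun i => locGrad D F i (st.z i)
    rw [h1, globGrad, sub_add_sub_cancel]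
  have h0 := norm_add_sq_le_two (avg (gradErr D F st))
    (avg (fun i => locGrad D F i (st.z i)) - avg fun i => locGrad D F i (avg st.z))
  rw [← e1] at h0
  have h1 : ∑ i, ‖locGrad D F i (st.z i) - locGrad D F i (avg st.z)‖ ^ 2
      ≤ L ^ 2 * cons st.z := by
    rw [cons, Finset.mul_sum]
    exact Finset.sum_le_sum fun i _ => h.oracle.locGrad_lip i _ _
  have h2 : cons st.z = cons st.x + cons st.y := cons_eq_add st.z
  have h3 := norm_avg_sub_sq_le h.m_ne (fun i => locGrad D F i (st.z i))
    (fun i => locGrad D F i (avg st.z))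
  have h4 := mul_le_mul_of_nonneg_left h1 (by positivity : 0 ≤ 1 / (m : ℝ))
  have h5 : 1 / (m : ℝ) * (L ^ 2 * cons st.z) = L ^ 2 * consZ st := by
    rw [h2, consZ]
    field_simp
  have h6 := norm_avg_gradErr_le (D := D) (F := F) st
  rw [h5] at h4
  have h7 := h3.trans h4
  linarith

/-- The mean iterate makes an inexact step in the sense of `merit_descent`, with E supplied by
`inner_avg_proj_le`. -/
theorem merit_step_le (h : Setup P D F Q W lam2 Y L μ s2) {st : State m dx dy}
    (hst : Invariant Y st) (r : Seed m P.b P.bigB Ξ) :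
    merit Y (globalObj D F) (avg (step P W lam2 Y F st r).x) (avg (step P W lam2 Y F st r).y)
      ≤ merit Y (globalObj D F) (avg st.x) (avg st.y)
      - P.γ * P.η / 2
        * ‖SmoothConcave.gradPrimal Y (globalObj D F) (globGrad D F) (avg st.x)‖ ^ 2
      - 2 / 5 * (P.γ * P.η) * ‖(avg st.s).fst‖ ^ 2
      - 2 * L * ‖avg (step P W lam2 Y F st r).y - avg st.y‖ ^ 2
      + P.η / 15 * (2 * noise D F st + 2 * (L ^ 2 * consZ st))
      + 24 / 7 * L * (consZ st + consS P st) := by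
  have hm : (0 : ℝ) < m := by have := h.m_ne; positivity
  have hη := h.eta_pos
  have hL := h.smooth.L_pos
  set E := cons (ascent P st) / (4 * m) with hE
  have hE0 : 0 ≤ E := div_nonneg (cons_nonneg _) (by positivity)
  have hEle : E ≤ (consZ st + consS P st) / 2 := by
    have h1 := cons_ascent_le (P := P) st
    have h2 := cons_eq_add st.s
    have h3 : cons (ascent P st) ≤ 2 * (cons st.x + cons st.y) + 2 * (P.η ^ 2 * cons st.s) := by
      have a := cons_nonneg st.x
      have b := mul_nonneg (sq_nonneg P.η) (cons_nonneg fun i => (st.s i).fst)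
      rw [h2]
      linarith
    have e : (consZ st + consS P st) / 2
        = (2 * (cons st.x + cons st.y) + 2 * (P.η ^ 2 * cons st.s)) / (4 * m) := by
      simp only [consZ, consS]
      field_simp
      ring
    rw [hE, e]
    gcongr
  have hy' : avg (step P W lam2 Y F st r).y ∈ Y := (h.invariant_step hst r).2
  have hvi : ∀ w ∈ Y, inner ℝ (avg st.y + P.η • (avg st.s).snd - avg (step P W lam2 Y F st r).y)
      (w - avg (step P W lam2 Y F st r).y) ≤ E := by
    intro w hw
    rw [h.avg_step_y, ← avg_ascent]
    exact inner_avg_proj_le h.m_ne h.isClosed h.convex h.nonempty _ hw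
  have hmd := h.smooth.merit_descent h.isClosed h.convex h.nonempty h.mu_le h.eta_eq h.gamma_eq hE0
    (x := avg st.x) (u := (avg st.s).fst) hst.2 hy' hvi
  rw [h.avg_step_x]
  have herr := mul_le_mul_of_nonneg_left (h.mean_error_le hst) (by positivity : 0 ≤ P.η / 15)
  have hE2 : E / (7 * P.η) ≤ 24 / 7 * L * (consZ st + consS P st) := by
    rw [div_le_iff₀ (by positivity)]
    have : 24 / 7 * L * (consZ st + consS P st) * (7 * P.η)
        = 24 * (P.η * L) * (consZ st + consS P st) := by ring
    rw [this, h.eta_mul]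
    linarith
  linarith

/-- The expected potential decreases along DREAM. -/
theorem potential_drift (h : Setup P D F Q W lam2 Y L μ s2) {st : State m dx dy}
    (hst : Invariant Y st) :
    ExpectationLE (seedLaw P D Q) (fun r => potential P D F Y L (step P W lam2 Y F st r))
      (potential P D F Y L st - P.γ * P.η / 4 * gradSq D F Y st + P.η / 2 * (s2 / m)) := by
  have hm : (0 : ℝ) < m := by have := h.m_ne; positivity
  have := h.prob
  have := h.probQ
  have hη := h.eta_pos
  have hηL := h.eta_mul
  have hL := h.smooth.L_pos
  have hp := h.p_pos
  have hγ := h.gamma_pos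
  have hγ1 := h.gamma_le
  have hβ : 0 < (P.b : ℝ) * P.q := by have := h.b_ne; have := h.q_pos; positivity
  have hYm : Measurable (proj Y) := (continuous_proj h.isClosed h.convex h.nonempty).measurable
  have hN := expectationLE_noise_step (W := W) (lam2 := lam2) h.m_ne h.oracle hL.le hYm h.batch
    hp.le h.p_le h.q_pos h.q_le h.b_ne h.bq st
  have hS := expectationLE_cons_step h.m_ne h.oracle h.mixes hYm h.batch
    hp.le h.p_le h.q_pos h.q_le h.b_ne h.bq st
  -- The next x and y are the same for all seeds, so any seed represents them; only the noise and
  -- the trackers have to be integrated.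
  obtain ⟨S0⟩ : Nonempty (Seed m P.b P.bigB Ξ) :=
    nonempty_of_isProbabilityMeasure (seedLaw P D Q)
  -- the parts of the potential that do not depend on the seed
  set N := noise D F st with hNdef
  set X := displacement P W lam2 Y st with hXdef
  have hN0 : 0 ≤ N := noise_nonneg st
  have hX0 : 0 ≤ X := displacement_nonneg st
  set Mr := merit Y (globalObj D F) (avg (step P W lam2 Y F st S0).x)
    (avg (step P W lam2 Y F st S0).y)
  set cz := consZ (step P W lam2 Y F st S0) with hcz
  have hdecomp : ∀ r, potential P D F Y L (step P W lam2 Y F st r)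
      = ((Mr - ⨅ x, primal Y (globalObj D F) x) + 5 * L * cz)
        + (P.η / (5 * P.p) * noise D F (step P W lam2 Y F st r)
        + 5 * L * P.η ^ 2 / m * cons (step P W lam2 Y F st r).s) := by
    intro r
    have e1 : (step P W lam2 Y F st r).x = (step P W lam2 Y F st S0).x := rfl
    have e2 : (step P W lam2 Y F st r).y = (step P W lam2 Y F st S0).y := rfl
    simp only [potential, consS, Mr, cz, consZ, e1, e2]
    ring
  simp only [hdecomp]
  refine ((ExpectationLE.const _).add ((hN.const_mul (by positivity)).add
    (hS.const_mul (by positivity)))).le ?_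
  have hmerit := h.merit_step_le hst S0
  have hczle := h.consZ_step_le st S0
  have hXle := h.displacement_le st S0
  have hG := h.gradSq_le st
  change Mr ≤ _ at hmerit
  set U := ‖(avg st.s).fst‖ ^ 2
  set Dy := ‖avg (step P W lam2 Y F st S0).y - avg st.y‖ ^ 2
  set z := consZ st with hz
  set s := consS P st with hs
  have hz0 : 0 ≤ z := consZ_nonneg st
  have hs0 : 0 ≤ s := consS_nonneg st
  have hU0 : 0 ≤ U := sq_nonneg _
  have hDy0 : 0 ≤ Dy := sq_nonneg _
  have hs2 : 0 ≤ s2 / m := div_nonneg h.s2_nonneg hm.le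
  -- the noise
  have hA : P.η / (5 * P.p) * (P.p * (2 * (s2 / m)) + (1 - P.p) * (N
      + 2 * (L ^ 2 * X / (m * (P.b * P.q)))))
      = P.η / (5 * P.p) * N - P.η / 5 * N + 2 / 5 * P.η * (s2 / m) + L / 120 * X := by
    have e1 : (1 - P.p) * (N + 2 * (L ^ 2 * X / (m * (P.b * P.q))))
        = (1 - P.p) * N + 2 * (L ^ 2 * X) * ((1 - P.p) / (m * (P.b * P.q))) := by ring
    -- The balance (1 − p)/(mbq) = p cancels the p in the weight η/(5p): the noise loses ηN/5 and
    -- the displacement enters with coefficient (2/5)(ηL)L = L/120.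
    rw [e1, h.p_eq]
    have e2 : P.η / (5 * P.p) * (P.p * (2 * (s2 / m)) + ((1 - P.p) * N + 2 * (L ^ 2 * X) * P.p))
        = P.η / (5 * P.p) * N - P.η / 5 * N + 2 / 5 * P.η * (s2 / m)
          + 2 / 5 * (P.η * L) * L * X := by
      field_simp
      ring
    rw [e2, hηL]
    ring
  -- the consensus error of the tracker
  have hRB : mixRate lam2 P.bigK ≤ 1 / 38416 := by
    refine le_trans ?_ h.rateBig
    have : (1 : ℝ) ≤ (m : ℝ) ^ 2 := by
      have : (1 : ℝ) ≤ m := by exact_mod_cast Nat.one_le_iff_ne_zero.2 h.m_ne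
      exact one_le_pow₀ this
    exact le_mul_of_one_le_right (mixRate_nonneg _ _) this
  have hRB0 := mixRate_nonneg lam2 P.bigK
  have hRK0 := mixRate_nonneg lam2 P.K
  have hm1 : (1 : ℝ) ≤ m := by exact_mod_cast Nat.one_le_iff_ne_zero.2 h.m_ne
  have hrate := h.rate
  have hrate' := h.rate'
  have hrateBig := h.rateBig
  obtain ⟨t, ht⟩ : ∃ t : ℝ, t = 1 / 38416 := ⟨_, rfl⟩
  have ht0 : 0 ≤ t := by rw [ht]; norm_num
  have ht2 : (2 / 38416 : ℝ) = 2 * t := by rw [ht]; norm_num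
  rw [← ht] at hRB hrate hrateBig
  rw [ht2] at hrate'
  have hB1 : P.η ^ 2 / m * (mixRate lam2 P.bigK * (2 * cons st.s + 2 * (3 * (m * s2)
      + 3 * (L ^ 2 * (m * X)) + 3 * (m ^ 2 * N))))
      ≤ t * (2 * s + 6 * (P.η ^ 2 * (s2 / m)) + 1 / 384 * X + 6 * (P.η ^ 2 * N)) := by
    have e1 : P.η ^ 2 / m * (mixRate lam2 P.bigK * (2 * cons st.s + 2 * (3 * (m * s2)
      + 3 * (L ^ 2 * (m * X)) + 3 * (m ^ 2 * N))))
      = mixRate lam2 P.bigK * (2 * s + 6 * (P.η * L) ^ 2 * X)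
        + (6 * (mixRate lam2 P.bigK * m * (P.η ^ 2 * (s2 / m)))
        + 6 * (mixRate lam2 P.bigK * m * (P.η ^ 2 * N))) := by
      simp only [hs, consS]
      field_simp
      ring
    rw [e1, hηL]
    have a1 := mul_le_mul_of_nonneg_right hRB
      (by positivity : 0 ≤ 2 * s + 6 * (1 / 48 : ℝ) ^ 2 * X)
    have a0 : mixRate lam2 P.bigK * m ≤ t :=
      le_trans (mul_le_mul_of_nonneg_left (le_self_pow₀ hm1 two_ne_zero) hRB0) hrateBig
    have a2 := mul_le_mul_of_nonneg_right a0 (by positivity : 0 ≤ P.η ^ 2 * (s2 / m))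
    have a3 := mul_le_mul_of_nonneg_right a0 (by positivity : 0 ≤ P.η ^ 2 * N)
    have e2 : t * (2 * s + 6 * (P.η ^ 2 * (s2 / m)) + 1 / 384 * X + 6 * (P.η ^ 2 * N))
      = t * (2 * s + 6 * (1 / 48) ^ 2 * X) + (6 * (t * (P.η ^ 2 * (s2 / m)))
        + 6 * (t * (P.η ^ 2 * N))) := by ring
    rw [e2]
    exact add_le_add a1 (add_le_add (mul_le_mul_of_nonneg_left a2 (by norm_num))
      (mul_le_mul_of_nonneg_left a3 (by norm_num)))
  have hB2 : P.η ^ 2 / m * (mixRate lam2 P.K * (2 * cons st.s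
      + 2 * ((1 + 1 / (P.b * P.q)) * (L ^ 2 * (m * X)))))
      ≤ t * (2 * s + 1 / 576 * X) := by
    have e1 : P.η ^ 2 / m * (mixRate lam2 P.K * (2 * cons st.s
      + 2 * ((1 + 1 / (P.b * P.q)) * (L ^ 2 * (m * X)))))
      = mixRate lam2 P.K * (2 * s)
        + (mixRate lam2 P.K * (1 + 1 / (P.b * P.q))) * (2 * (P.η * L) ^ 2 * X) := by
      simp only [hs, consS]
      field_simp
    rw [e1, hηL]
    have a1 := mul_le_mul_of_nonneg_right hrate (by positivity : 0 ≤ 2 * s)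
    have a2 := mul_le_mul_of_nonneg_right hrate'
      (by positivity : 0 ≤ 2 * (1 / 48 : ℝ) ^ 2 * X)
    linarith
  have hp1 : 0 ≤ 1 - P.p := by linarith [h.p_le]
  have hB : 5 * L * P.η ^ 2 / m * (P.p * (mixRate lam2 P.bigK * (2 * cons st.s + 2 * (3 * (m * s2)
      + 3 * (L ^ 2 * (m * X)) + 3 * (m ^ 2 * N))))
      + (1 - P.p) * (mixRate lam2 P.K * (2 * cons st.s
      + 2 * ((1 + 1 / (P.b * P.q)) * (L ^ 2 * (m * X))))))
      ≤ 5 * L * t * (2 * s + X / 200) + 5 / 8 * t * (P.η * (s2 / m)) + 5 / 8 * t * (P.η * N) := by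
    have b1 := mul_le_mul_of_nonneg_left hB1 hp.le
    have b2 := mul_le_mul_of_nonneg_left hB2 hp1
    have b3 := mul_le_mul_of_nonneg_left (add_le_add b1 b2) (by positivity : 0 ≤ 5 * L)
    have c1 : P.p * (t * (2 * s + 6 * (P.η ^ 2 * (s2 / m)) + 1 / 384 * X + 6 * (P.η ^ 2 * N)))
        + (1 - P.p) * (t * (2 * s + 1 / 576 * X))
        ≤ t * (2 * s + X / 200 + 6 * (P.η ^ 2 * (s2 / m)) + 6 * (P.η ^ 2 * N)) := by
      have d1 : 0 ≤ t * (P.η ^ 2 * (s2 / m)) := by positivity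
      have d2 : 0 ≤ t * (P.η ^ 2 * N) := by positivity
      have d3 : 0 ≤ t * X := by positivity
      have f1 := mul_le_mul_of_nonneg_right h.p_le d1
      have f2 := mul_le_mul_of_nonneg_right h.p_le d2
      have f3 := mul_le_mul_of_nonneg_right h.p_le d3
      have e4 : P.p * (t * (2 * s + 6 * (P.η ^ 2 * (s2 / m)) + 1 / 384 * X + 6 * (P.η ^ 2 * N)))
        + (1 - P.p) * (t * (2 * s + 1 / 576 * X))
        = t * (2 * s) + 6 * (P.p * (t * (P.η ^ 2 * (s2 / m)))) + 6 * (P.p * (t * (P.η ^ 2 * N)))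
          + 1 / 576 * (t * X) + 1 / 1152 * (P.p * (t * X)) := by ring
      have e5 : t * (2 * s + X / 200 + 6 * (P.η ^ 2 * (s2 / m)) + 6 * (P.η ^ 2 * N))
        = t * (2 * s) + 6 * (t * (P.η ^ 2 * (s2 / m))) + 6 * (t * (P.η ^ 2 * N))
          + 1 / 200 * (t * X) := by ring
      rw [e4, e5]
      rw [one_mul] at f1 f2 f3
      linarith
    have c2 := mul_le_mul_of_nonneg_left c1 (by positivity : 0 ≤ 5 * L)
    have e3 : 5 * L * (t * (2 * s + X / 200 + 6 * (P.η ^ 2 * (s2 / m)) + 6 * (P.η ^ 2 * N)))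
      = 5 * L * t * (2 * s + X / 200) + 30 * (P.η * L) * t * (P.η * (s2 / m))
        + 30 * (P.η * L) * t * (P.η * N) := by ring
    rw [e3, hηL] at c2
    refine le_trans (le_of_eq ?_) (b3.trans (c2.trans (le_of_eq ?_)))
    · ring
    · ring
  have hηN : 0 ≤ P.η * N := by positivity
  have hηs : 0 ≤ P.η * (s2 / m) := by positivity
  have hLz : 0 ≤ L * z := by positivity
  have hLs : 0 ≤ L * s := by positivity
  have hLD : 0 ≤ L * Dy := by positivity
  have hLU : L * ((P.γ * P.η) ^ 2 * U) ≤ 1 / 48 * (P.γ * P.η * U) := by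
    have e : L * ((P.γ * P.η) ^ 2 * U) = (P.η * L) * P.γ * (P.γ * P.η * U) := by ring
    rw [e, hηL]
    have : 0 ≤ P.γ * P.η * U := by positivity
    refine mul_le_mul_of_nonneg_right ?_ this
    linarith
  have hgU : 0 ≤ P.γ * P.η * U := by positivity
  have hLX : L * X ≤ L * (3 * cz + 3 * z + 3 * ((P.γ * P.η) ^ 2 * U) + 3 * Dy) :=
    mul_le_mul_of_nonneg_left hXle hL.le
  have hLcz : L * cz ≤ L * (2 / 38416 * (z + s)) := mul_le_mul_of_nonneg_left hczle hL.le
  have hηz : P.η / 15 * (2 * N + 2 * (L ^ 2 * z)) = 2 / 15 * (P.η * N) + 1 / 360 * (L * z) := by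
    have : P.η / 15 * (2 * N + 2 * (L ^ 2 * z))
      = 2 / 15 * (P.η * N) + 2 / 15 * (P.η * L) * (L * z) := by ring
    rw [this, hηL]
    ring
  rw [hηz] at hmerit
  rw [hA]
  simp only [potential, ← hNdef, ← hz, ← hs]
  -- The final budget: −η/5 against 2η/15 for the noise; weight 5L against 24L/7 plus small terms
  -- for the consensus errors; the displacement is paid for by 2L‖Δȳ‖² and (2/5)γη‖ū‖²; and 2/5 plus
  -- a small term is below 1/2 for the batch variance.
  rw [ht] at hB
  linarith

end Setup

end Drift

end

end Dream

namespace Dream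

noncomputable section

/-! ### Expectations along independent iterations -/

section Resampling

variable {S : Type*} [MeasurableSpace S]

theorem measurable_update_prod (t : ℕ) :
    Measurable fun o : (ℕ → S) × S => Function.update o.1 t o.2 := by
  refine measurable_pi_lambda _ fun k => ?_
  by_cases hk : k = t
  · subst hk
    simpa using measurable_snd
  · simp only [Function.update_of_ne hk]
    fun_prop

/-- Resampling one coordinate preserves the law of an i.i.d. sequence. -/
theorem measurePreserving_update (ν : Measure S) [IsProbabilityMeasure ν] (t : ℕ) :
    MeasurePreserving (fun o : (ℕ → S) × S => Function.update o.1 t o.2)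
      ((Measure.infinitePi fun _ : ℕ => ν).prod ν) (Measure.infinitePi fun _ : ℕ => ν) := by
  refine ⟨measurable_update_prod t, Measure.eq_infinitePi _ fun s B hB => ?_⟩
  rw [Measure.map_apply (measurable_update_prod t)
    (MeasurableSet.pi s.countable_toSet fun i _ => hB i)]
  -- Finite boxes determine the law. If the box constrains coordinate t, its preimage splits that
  -- coordinate off onto the fresh sample; otherwise the fresh sample is unconstrained.
  by_cases ht : t ∈ s
  · have e : (fun o : (ℕ → S) × S => Function.update o.1 t o.2) ⁻¹' Set.pi s B
        = Set.pi (s.erase t) B ×ˢ B t := by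
      ext ⟨r, x⟩
      simp only [Set.mem_preimage, Set.mem_pi, Finset.mem_coe, Set.mem_prod, Finset.mem_erase]
      constructor
      · refine fun h => ⟨fun i hi => ?_, ?_⟩
        · simpa [hi.1] using h i hi.2
        · simpa using h t ht
      · rintro ⟨h1, h2⟩ i hi
        by_cases hit : i = t
        · subst hit; simpa using h2
        · simpa [hit] using h1 i ⟨hit, hi⟩
    rw [e, Measure.prod_prod, Measure.infinitePi_pi _ fun i _ => hB i, Finset.prod_erase_mul _ _ ht]
  · have e : (fun o : (ℕ → S) × S => Function.update o.1 t o.2) ⁻¹' Set.pi s B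
        = Set.pi s B ×ˢ Set.univ := by
      ext ⟨r, x⟩
      simp only [Set.mem_preimage, Set.mem_pi, Finset.mem_coe, Set.mem_prod, Set.mem_univ, and_true]
      refine forall₂_congr fun i hi => ?_
      have : i ≠ t := fun h => ht (h ▸ hi)
      simp [this]
    rw [e, Measure.prod_prod, Measure.infinitePi_pi _ fun i _ => hB i, measure_univ, mul_one]

/-- Bounding an expectation by resampling one coordinate. -/
theorem ExpectationLE.resample {A : Type*} [MeasurableSpace A] {Q : Measure A}
    [IsProbabilityMeasure Q] {ν : Measure S} [IsProbabilityMeasure ν] (t : ℕ)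
    {f g : A × (ℕ → S) → ℝ} {c : ℝ} (hf : Measurable f) (h0 : ∀ o, 0 ≤ f o)
    (hin : ∀ a r, ExpectationLE ν (fun s => f (a, Function.update r t s)) (g (a, r)))
    (hg : ExpectationLE (Q.prod (Measure.infinitePi fun _ : ℕ => ν)) g c) :
    ExpectationLE (Q.prod (Measure.infinitePi fun _ : ℕ => ν)) f c := by
  have hmp : MeasurePreserving (fun o : (A × (ℕ → S)) × S => (o.1.1, Function.update o.1.2 t o.2))
      ((Q.prod (Measure.infinitePi fun _ : ℕ => ν)).prod ν)
      (Q.prod (Measure.infinitePi fun _ : ℕ => ν)) :=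
    ((MeasurePreserving.id Q).prod (measurePreserving_update ν t)).comp
      (measurePreserving_prodAssoc Q (Measure.infinitePi fun _ : ℕ => ν) ν)
  have h1 : ExpectationLE ((Q.prod (Measure.infinitePi fun _ : ℕ => ν)).prod ν)
      (fun o => f (o.1.1, Function.update o.1.2 t o.2)) c :=
    ExpectationLE.prod (hf.comp hmp.measurable).aestronglyMeasurable (fun _ => h0 _)
      (fun a => hin a.1 a.2) hg
  have h2 := integral_map hmp.measurable.aemeasurable hf.aestronglyMeasurable (μ :=
    (Q.prod (Measure.infinitePi fun _ : ℕ => ν)).prod ν)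
  rw [hmp.map_eq] at h2
  refine ⟨(hmp.integrable_comp hf.aestronglyMeasurable).1 h1.1, ?_⟩
  rw [h2]
  exact h1.2

end Resampling

section RunCongr

variable {m dx dy : ℕ} {Ξ : Type*} {P : Params} {F : Fin m → ZSpace dx dy → Ξ → ℝ}
  {W : Matrix (Fin m) (Fin m) ℝ} {lam2 : ℝ} {Y : Set (EuclideanSpace ℝ (Fin dy))}
  {x₀ : EuclideanSpace ℝ (Fin dx)} {y₀ : EuclideanSpace ℝ (Fin dy)}

theorem run_congr (S₀ : BigBatch m P.bigB Ξ) {r r' : ℕ → Seed m P.b P.bigB Ξ} (t : ℕ)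
    (h : ∀ k < t, r k = r' k) :
    run P W lam2 Y F x₀ y₀ S₀ r t = run P W lam2 Y F x₀ y₀ S₀ r' t := by
  induction t with
  | zero => rfl
  | succ t ih =>
    rw [run, run, ih fun k hk => h k (hk.trans t.lt_succ_self), h t t.lt_succ_self]

theorem run_update (S₀ : BigBatch m P.bigB Ξ) (r : ℕ → Seed m P.b P.bigB Ξ) {k t : ℕ} (hk : k ≤ t)
    (s : Seed m P.b P.bigB Ξ) :
    run P W lam2 Y F x₀ y₀ S₀ (Function.update r t s) k = run P W lam2 Y F x₀ y₀ S₀ r k :=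
  run_congr S₀ k fun _ hj => Function.update_of_ne (hj.trans_le hk).ne _ _

theorem run_succ_update (S₀ : BigBatch m P.bigB Ξ) (r : ℕ → Seed m P.b P.bigB Ξ) (t : ℕ)
    (s : Seed m P.b P.bigB Ξ) :
    run P W lam2 Y F x₀ y₀ S₀ (Function.update r t s) (t + 1)
      = step P W lam2 Y F (run P W lam2 Y F x₀ y₀ S₀ r t) s := by
  rw [run, run_update S₀ r le_rfl, Function.update_self]

end RunCongr

section Run

variable {m dx dy : ℕ} {Ξ : Type*} [MeasurableSpace Ξ] {P : Params} {D : Fin m → Measure Ξ}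
  [∀ i, IsProbabilityMeasure (D i)]
  {F : Fin m → ZSpace dx dy → Ξ → ℝ} {W : Matrix (Fin m) (Fin m) ℝ} {lam2 : ℝ}
  {Y : Set (EuclideanSpace ℝ (Fin dy))} {Q : Measure (BigBatch m P.bigB Ξ)}
  [IsProbabilityMeasure Q]
  {x₀ : EuclideanSpace ℝ (Fin dx)} {y₀ : EuclideanSpace ℝ (Fin dy)}

theorem measurableState_run
    (hF : ∀ i, Measurable fun p : ZSpace dx dy × Ξ => stochGrad (F i) p.1 p.2)
    (hY : Measurable (proj Y)) (t : ℕ) :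
    MeasurableState fun o : BigBatch m P.bigB Ξ × (ℕ → Seed m P.b P.bigB Ξ) =>
      run P W lam2 Y F x₀ y₀ o.1 o.2 t := by
  induction t with
  | zero => exact measurableState_init P W lam2 hF x₀ y₀ measurable_fst
  | succ t ih =>
    exact measurableState_step hF hY ih ((measurable_pi_apply t).comp measurable_snd)

/-- A function of the state that drifts by at most `e - G` in each iteration. -/
theorem expectationLE_run {Φ G : State m dx dy → ℝ} {I : State m dx dy → Prop} {c e : ℝ}
    (hI0 : ∀ S₀, I (initState P W lam2 F x₀ y₀ S₀))
    (hI : ∀ st r, I st → I (step P W lam2 Y F st r))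
    (hΦm : ∀ t, Measurable fun o : BigBatch m P.bigB Ξ × (ℕ → Seed m P.b P.bigB Ξ) =>
      Φ (run P W lam2 Y F x₀ y₀ o.1 o.2 t))
    (hGm : ∀ t, Measurable fun o : BigBatch m P.bigB Ξ × (ℕ → Seed m P.b P.bigB Ξ) =>
      G (run P W lam2 Y F x₀ y₀ o.1 o.2 t))
    (hΦ0 : ∀ st, I st → 0 ≤ Φ st) (hG0 : ∀ st, 0 ≤ G st)
    (hinit : ExpectationLE Q (fun S₀ => Φ (initState P W lam2 F x₀ y₀ S₀)) c)
    (hdrift : ∀ st, I st → ExpectationLE (seedLaw P D Q) (fun r => Φ (step P W lam2 Y F st r))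
      (Φ st - G st + e)) (t : ℕ) :
    ExpectationLE (Q.prod (Measure.infinitePi fun _ : ℕ => seedLaw P D Q))
      (fun o => Φ (run P W lam2 Y F x₀ y₀ o.1 o.2 t)
        + ∑ k ∈ Finset.range t, G (run P W lam2 Y F x₀ y₀ o.1 o.2 k)) (c + t * e) := by
  have hIt : ∀ t S₀ r, I (run P W lam2 Y F x₀ y₀ S₀ r t) := by
    intro t S₀ r
    induction t with
    | zero => exact hI0 S₀
    | succ t ih => exact hI _ _ ih
  induction t with
  | zero =>
    simpa [run] using ExpectationLE.comp (measurePreserving_fst (μ := Q)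
      (ν := Measure.infinitePi fun _ : ℕ => seedLaw P D Q)) hinit
  | succ t ih =>
    -- With all seeds but the t-th fixed, the states up to time t are constant and the state at t +
    -- 1 is one step with a fresh seed.
    refine ExpectationLE.resample t (g := fun o => (Φ (run P W lam2 Y F x₀ y₀ o.1 o.2 t)
        + ∑ k ∈ Finset.range t, G (run P W lam2 Y F x₀ y₀ o.1 o.2 k)) + e)
      ((hΦm _).add (Finset.measurable_sum _ fun k _ => hGm k))
      (fun o => add_nonneg (hΦ0 _ (hIt _ _ _)) (Finset.sum_nonneg fun k _ => hG0 _))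
      (fun S₀ r => ?_) ((ih.add (ExpectationLE.const e)).le (by push_cast; linarith))
    have h1 : ∀ s, Φ (run P W lam2 Y F x₀ y₀ S₀ (Function.update r t s) (t + 1))
        + ∑ k ∈ Finset.range (t + 1), G (run P W lam2 Y F x₀ y₀ S₀ (Function.update r t s) k)
        = Φ (step P W lam2 Y F (run P W lam2 Y F x₀ y₀ S₀ r t) s)
          + ∑ k ∈ Finset.range (t + 1), G (run P W lam2 Y F x₀ y₀ S₀ r k) := by
      intro s
      rw [run_succ_update]
      congr 1
      refine Finset.sum_congr rfl fun k hk => ?_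
      rw [run_update S₀ r (Nat.lt_succ_iff.1 (Finset.mem_range.1 hk))]
    simp only [h1]
    refine ((hdrift _ (hIt t S₀ r)).add (ExpectationLE.const _)).le ?_
    rw [Finset.sum_range_succ]
    linarith

theorem expectationLE_law {f : BigBatch m P.bigB Ξ × (ℕ → Seed m P.b P.bigB Ξ) → ℝ} {c : ℝ}
    [Nonempty (Fin P.T × Fin m)]
    (h : ExpectationLE (Q.prod (Measure.infinitePi fun _ : ℕ => seedLaw P D Q)) f c) :
    ExpectationLE (law P D Q) (fun o => f (o.1, o.2.1)) c := by
  have := ProbabilityTheory.isProbabilityMeasure_uniformOn (s := (Set.univ : Set (Fin P.T × Fin m)))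
    Set.finite_univ Set.univ_nonempty
  exact ExpectationLE.comp ((MeasurePreserving.id Q).prod (measurePreserving_fst
    (μ := Measure.infinitePi fun _ : ℕ => seedLaw P D Q)
    (ν := ProbabilityTheory.uniformOn (Set.univ : Set (Fin P.T × Fin m))))) h

theorem expectationLE_uniformOn {ι : Type*} [Fintype ι] [Nonempty ι] [MeasurableSpace ι]
    [MeasurableSingletonClass ι] (f : ι → ℝ) :
    ExpectationLE (ProbabilityTheory.uniformOn (Set.univ : Set ι)) f
      (1 / (Fintype.card ι : ℝ) * ∑ i, f i) := by
  have := ProbabilityTheory.isProbabilityMeasure_uniformOn (s := (Set.univ : Set ι))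
    Set.finite_univ Set.univ_nonempty
  refine ⟨Integrable.of_finite, le_of_eq ?_⟩
  rw [integral_fintype Integrable.of_finite, Finset.mul_sum]
  refine Finset.sum_congr rfl fun i _ => ?_
  have : (ProbabilityTheory.uniformOn (Set.univ : Set ι)).real {i} = 1 / (Fintype.card ι : ℝ) := by
    rw [Measure.real, ProbabilityTheory.uniformOn_univ]
    simp
  rw [this, smul_eq_mul]

/-- Averages over the uniform output index. -/
theorem expectationLE_output [Nonempty (Fin P.T × Fin m)]
    {f : EuclideanSpace ℝ (Fin dx) → ℝ} (hf : Measurable f) (hf0 : ∀ x, 0 ≤ f x)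
    (hF : ∀ i, Measurable fun p : ZSpace dx dy × Ξ => stochGrad (F i) p.1 p.2)
    (hY : Measurable (proj Y)) {c : ℝ}
    (h : ExpectationLE (Q.prod (Measure.infinitePi fun _ : ℕ => seedLaw P D Q))
      (fun o => ∑ k ∈ Finset.range P.T,
        (1 / (m : ℝ) * ∑ i, f ((run P W lam2 Y F x₀ y₀ o.1 o.2 k).x i))) (P.T * c)) :
    ExpectationLE (law P D Q) (fun o => f (output P W lam2 Y F x₀ y₀ o)) c := by
  have := ProbabilityTheory.isProbabilityMeasure_uniformOn (s := (Set.univ : Set (Fin P.T × Fin m)))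
    Set.finite_univ Set.univ_nonempty
  have hT : (P.T : ℝ) ≠ 0 := by
    obtain ⟨k, -⟩ := Classical.arbitrary (Fin P.T × Fin m)
    have := k.pos
    positivity
  have hm : Measurable fun o : (BigBatch m P.bigB Ξ × (ℕ → Seed m P.b P.bigB Ξ)) ×
      (Fin P.T × Fin m) => f ((run P W lam2 Y F x₀ y₀ o.1.1 o.1.2 o.2.1).x o.2.2) := by
    refine measurable_from_prod_countable_left fun w => ?_
    exact hf.comp ((measurableState_run hF hY w.1).x w.2)
  have h1 : ExpectationLE ((Q.prod (Measure.infinitePi fun _ : ℕ => seedLaw P D Q)).prod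
      (ProbabilityTheory.uniformOn (Set.univ : Set (Fin P.T × Fin m))))
      (fun o => f ((run P W lam2 Y F x₀ y₀ o.1.1 o.1.2 o.2.1).x o.2.2)) c := by
    refine ExpectationLE.prod hm.aestronglyMeasurable (fun _ => hf0 _)
      (fun o => expectationLE_uniformOn _) ?_
    have h2 := (h.const_mul (a := 1 / (P.T : ℝ)) (by positivity)).le
      (show 1 / (P.T : ℝ) * (P.T * c) ≤ c by field_simp; exact le_rfl)
    convert h2 using 2 with o
    rw [Fintype.card_prod, Fintype.card_fin, Fintype.card_fin, Fintype.sum_prod_type,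
      ← Finset.mul_sum, Finset.sum_range]
    push_cast
    ring
  exact ExpectationLE.comp (MeasurePreserving.symm (MeasurableEquiv.prodAssoc)
    (measurePreserving_prodAssoc Q (Measure.infinitePi fun _ : ℕ => seedLaw P D Q)
      (ProbabilityTheory.uniformOn (Set.univ : Set (Fin P.T × Fin m))))) h1

end Run

end

end Dream

/-! ### Expected costs and expected accuracy of a run. -/

namespace Dream

noncomputable section

section Cost

variable {m dx dy : ℕ} {Ξ : Type*} [MeasurableSpace Ξ] {P : Params} {D : Fin m → Measure Ξ}
  [∀ i, IsProbabilityMeasure (D i)]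
  {F : Fin m → ZSpace dx dy → Ξ → ℝ} {W : Matrix (Fin m) (Fin m) ℝ} {lam2 : ℝ}
  {Y : Set (EuclideanSpace ℝ (Fin dy))} {Q : Measure (BigBatch m P.bigB Ξ)}
  [IsProbabilityMeasure Q] [Nonempty (Fin P.T × Fin m)]

instance : IsProbabilityMeasure (law P D Q) := by
  have := ProbabilityTheory.isProbabilityMeasure_uniformOn (s := (Set.univ : Set (Fin P.T × Fin m)))
    Set.finite_univ Set.univ_nonempty
  unfold law
  infer_instance

theorem expectationLE_coinSum {q : ℝ} (hq0 : 0 ≤ q) (hq1 : q ≤ 1) (c : ℝ) :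
    ExpectationLE (Measure.pi fun _ : Fin m => bernoulliLaw q)
      (fun ω => ∑ i, if ω i then c else 0) (m * (q * c)) := by
  have h1 : ExpectationLE (bernoulliLaw q) (fun z => if z then c else 0) (q * c) := by
    simpa using expectationLE_bernoulliLaw hq0 hq1 fun z => if z then c else 0
  refine (ExpectationLE.sum Finset.univ fun i _ => ExpectationLE.comp
    (measurePreserving_eval (fun _ : Fin m => bernoulliLaw q) i) h1).le (le_of_eq ?_)
  simp

/-- The counter is a function of the state with constant expected drift, so `expectationLE_run`
applies with G = 0. -/
theorem expectationLE_sfoCost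
    (hF : ∀ i, Measurable fun p : ZSpace dx dy × Ξ => stochGrad (F i) p.1 p.2)
    (hY : Measurable (proj Y)) (hp0 : 0 ≤ P.p) (hp1 : P.p ≤ 1) (hq0 : 0 ≤ P.q) (hq1 : P.q ≤ 1)
    (x₀ : EuclideanSpace ℝ (Fin dx)) (y₀ : EuclideanSpace ℝ (Fin dy)) :
    ExpectationLE (law P D Q) (sfoCost P W lam2 Y F x₀ y₀)
      (m * P.bigB + P.T * (P.p * (m * P.bigB) + (1 - P.p) * (m * (P.q * (2 * P.b))))) := by
  have hm := measurableState_run (P := P) (W := W) (lam2 := lam2) (x₀ := x₀) (y₀ := y₀) hF hY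
  have h := expectationLE_run (D := D) (F := F) (Y := Y) (Q := Q) (W := W) (lam2 := lam2)
    (x₀ := x₀) (y₀ := y₀) (Φ := fun st => (st.sfo : ℝ)) (G := fun _ => 0) (I := fun _ => True)
    (c := m * P.bigB) (e := P.p * (m * P.bigB) + (1 - P.p) * (m * (P.q * (2 * P.b))))
    (fun _ => trivial) (fun _ _ _ => trivial)
    (fun t => (measurable_from_top (f := fun n : ℕ => (n : ℝ))).comp (hm t).sfo)
    (fun _ => measurable_const) (fun _ _ => Nat.cast_nonneg _) (fun _ => le_rfl)
    (by simpa [initState] using ExpectationLE.const (ν := Q) ((m : ℝ) * P.bigB)) ?_ P.T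
  · exact expectationLE_law (by simpa using h)
  intro st _
  have hst : MeasurableState fun _ : Seed m P.b P.bigB Ξ => st :=
    ⟨fun _ => measurable_const, fun _ => measurable_const, fun _ => measurable_const,
      fun _ => measurable_const, measurable_const, measurable_const⟩
  have h1 := expectationLE_seedLaw (D := D) (Q := Q) hp0 hp1
    (X := fun r => ((step P W lam2 Y F st r).sfo : ℝ))
    ((measurable_from_top (f := fun n : ℕ => (n : ℝ))).comp
      (measurableState_step hF hY hst measurable_id).sfo) (fun _ => Nat.cast_nonneg _)
    (Xt := fun _ => st.sfo + m * P.bigB)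
    (Xf := fun o => st.sfo + ∑ i, if o.1 i then (2 * P.b : ℝ) else 0)
    (ExpectationLE.const _) (fun ω S' S => by simp [step])
    ((ExpectationLE.const _).add (ExpectationLE.comp measurePreserving_fst
      (expectationLE_coinSum (m := m) hq0 hq1 (2 * P.b : ℝ)))) (fun ω S' S => by simp [step])
  exact h1.le (by linarith)

theorem expectationLE_commCost
    (hF : ∀ i, Measurable fun p : ZSpace dx dy × Ξ => stochGrad (F i) p.1 p.2)
    (hY : Measurable (proj Y)) (hp0 : 0 ≤ P.p) (hp1 : P.p ≤ 1)
    (x₀ : EuclideanSpace ℝ (Fin dx)) (y₀ : EuclideanSpace ℝ (Fin dy)) :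
    ExpectationLE (law P D Q) (commCost P W lam2 Y F x₀ y₀)
      (P.K₀ + P.T * (2 * P.K + (P.p * P.bigK + (1 - P.p) * P.K))) := by
  have hm := measurableState_run (P := P) (W := W) (lam2 := lam2) (x₀ := x₀) (y₀ := y₀) hF hY
  have h := expectationLE_run (D := D) (F := F) (Y := Y) (Q := Q) (W := W) (lam2 := lam2)
    (x₀ := x₀) (y₀ := y₀) (Φ := fun st => (st.comm : ℝ)) (G := fun _ => 0) (I := fun _ => True)
    (c := P.K₀) (e := 2 * P.K + (P.p * P.bigK + (1 - P.p) * P.K))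
    (fun _ => trivial) (fun _ _ _ => trivial)
    (fun t => (measurable_from_top (f := fun n : ℕ => (n : ℝ))).comp (hm t).comm)
    (fun _ => measurable_const) (fun _ _ => Nat.cast_nonneg _) (fun _ => le_rfl)
    (by simpa [initState] using ExpectationLE.const (ν := Q) (P.K₀ : ℝ)) ?_ P.T
  · exact expectationLE_law (by simpa using h)
  intro st _
  have hst : MeasurableState fun _ : Seed m P.b P.bigB Ξ => st :=
    ⟨fun _ => measurable_const, fun _ => measurable_const, fun _ => measurable_const,
      fun _ => measurable_const, measurable_const, measurable_const⟩
  have h1 := expectationLE_seedLaw (D := D) (Q := Q) hp0 hp1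
    (X := fun r => ((step P W lam2 Y F st r).comm : ℝ))
    ((measurable_from_top (f := fun n : ℕ => (n : ℝ))).comp
      (measurableState_step hF hY hst measurable_id).comm) (fun _ => Nat.cast_nonneg _)
    (Xt := fun _ => st.comm + P.K + P.K + P.bigK) (Xf := fun _ => st.comm + P.K + P.K + P.K)
    (ExpectationLE.const _) (fun ω S' S => by simp [step])
    (ExpectationLE.const _) (fun ω S' S => by simp [step])
  exact h1.le (by linarith)

end Cost

section Accuracy

variable {m dx dy : ℕ} {Ξ : Type*} [MeasurableSpace Ξ] {P : Params} {D : Fin m → Measure Ξ}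
  {F : Fin m → ZSpace dx dy → Ξ → ℝ} {W : Matrix (Fin m) (Fin m) ℝ} {lam2 : ℝ}
  {Y : Set (EuclideanSpace ℝ (Fin dy))} {Q : Measure (BigBatch m P.bigB Ξ)} {L μ s2 : ℝ}
  {x₀ : EuclideanSpace ℝ (Fin dx)} {y₀ : EuclideanSpace ℝ (Fin dy)}

namespace Setup

theorem measurable_proj (h : Setup P D F Q W lam2 Y L μ s2) : Measurable (proj Y) :=
  (continuous_proj h.isClosed h.convex h.nonempty).measurable

theorem continuous_primal (h : Setup P D F Q W lam2 Y L μ s2) :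
    Continuous (primal Y (globalObj D F)) :=
  continuous_of_hasGradientAt fun x =>
    h.smooth.hasGradientAt_primal h.isClosed h.convex h.nonempty h.mu_le x

theorem measurable_gradPrimal (h : Setup P D F Q W lam2 Y L μ s2) :
    Measurable (SmoothConcave.gradPrimal Y (globalObj D F) (globGrad D F)) := by
  refine Continuous.measurable ?_
  have hL := h.smooth.L_pos
  have hκ := h.kappa_ge
  refine (LipschitzWith.of_dist_le_mul (K := ⟨2 * (L / μ) * L, by positivity⟩)
    fun x x' => ?_).continuous
  rw [dist_eq_norm, dist_eq_norm]
  exact h.smooth.norm_grad_yStar_sub_le h.isClosed h.convex h.nonempty h.mu_le x x'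

theorem measurable_merit (h : Setup P D F Q W lam2 Y L μ s2) {α : Type*} [MeasurableSpace α]
    {x : α → EuclideanSpace ℝ (Fin dx)} {y : α → EuclideanSpace ℝ (Fin dy)}
    (hx : Measurable x) (hy : Measurable y) :
    Measurable fun o => merit Y (globalObj D F) (x o) (y o) := by
  have h1 := h.continuous_primal.measurable.comp hx
  have h2 := h.smooth.continuous.measurable.comp (measurable_pair hx hy)
  exact h1.add ((h1.sub h2).const_mul alpha)

theorem measurable_potential (h : Setup P D F Q W lam2 Y L μ s2) {α : Type*} [MeasurableSpace α]
    {st : α → State m dx dy} (hst : MeasurableState st) :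
    Measurable fun o => potential P D F Y L (st o) := by
  have := h.prob
  have h1 := h.measurable_merit (measurable_avg hst.x) (measurable_avg hst.y)
  have h2 := measurable_noise h.oracle h.smooth.L_pos.le hst
  have h3 := ((measurable_cons hst.x).add (measurable_cons hst.y)).div_const (m : ℝ)
  have h4 := ((measurable_cons hst.s).const_mul (P.η ^ 2)).div_const (m : ℝ)
  exact ((h1.sub_const _).add (h2.const_mul _)).add ((h3.add h4).const_mul _)

theorem measurable_gradSq (h : Setup P D F Q W lam2 Y L μ s2) {α : Type*} [MeasurableSpace α]
    {st : α → State m dx dy} (hst : MeasurableState st) :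
    Measurable fun o => gradSq D F Y (st o) :=
  (Finset.measurable_sum _ fun i _ =>
    ((h.measurable_gradPrimal.comp (hst.x i)).norm.pow_const 2)).const_mul _

theorem psi0_nonneg (h : Setup P D F Q W lam2 Y L μ s2) (hy : y₀ ∈ Y) :
    0 ≤ psi0 Y (globalObj D F) x₀ y₀ :=
  (h.merit_ge x₀ hy).trans_eq (by simp only [merit, psi0]; ring)

/-- The consensus error of the initial gradient tracker. -/
theorem cons_init_le (h : Setup P D F Q W lam2 Y L μ s2) :
    ExpectationLE Q (fun S₀ => cons (initState P W lam2 F x₀ y₀ S₀).s)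
      (mixRate lam2 P.K₀ * (2 * heterogeneity D F (pair x₀ y₀) + 2 * (m * s2))) := by
  have := h.probQ
  have hH : heterogeneity D F (pair x₀ y₀) = cons fun i => locGrad D F i (pair x₀ y₀) := by
    rw [heterogeneity, (h.smooth.grad (pair x₀ y₀)).gradient]
    rfl
  have hmeas : Measurable fun S₀ : BigBatch m P.bigB Ξ =>
      cons (initState P W lam2 F x₀ y₀ S₀).s :=
    measurable_cons (measurableState_init P W lam2 h.oracle.meas x₀ y₀ measurable_id).s
  have h1 := ExpectationLE.sum Finset.univ fun i (_ : i ∈ Finset.univ) =>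
    expectationLE_batch_single h.batch (fun _ => pair x₀ y₀) i
  have h2 := ((ExpectationLE.const (ν := Q) (2 * heterogeneity D F (pair x₀ y₀))).add
    (h1.const_mul (a := 2) (by norm_num))).const_mul (mixRate_nonneg lam2 P.K₀)
  refine (h2.mono hmeas.aestronglyMeasurable (fun _ => cons_nonneg _) fun S₀ => ?_).le
    (le_of_eq (by simp))
  refine (h.mixes.contract _ _ _).trans (mul_le_mul_of_nonneg_left ?_ (mixRate_nonneg _ _))
  have e : bigGrad F S₀ (fun _ => pair x₀ y₀) = (fun i => locGrad D F i (pair x₀ y₀))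
      + fun i => bigGrad F S₀ (fun _ => pair x₀ y₀) i - locGrad D F i (pair x₀ y₀) :=
    funext fun i => (add_sub_cancel _ _).symm
  have h3 := cons_add_le (fun i => locGrad D F i (pair x₀ y₀))
    fun i => bigGrad F S₀ (fun _ => pair x₀ y₀) i - locGrad D F i (pair x₀ y₀)
  have h4 := cons_le_sum_sq h.m_ne fun i =>
    bigGrad F S₀ (fun _ => pair x₀ y₀) i - locGrad D F i (pair x₀ y₀)
  rw [← e] at h3
  rw [hH]
  linarith

/-- All agents start at the same point, so only the noise of the first batch and the disagreement of
the trackers add to Ψ₀. -/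
theorem potential_init (h : Setup P D F Q W lam2 Y L μ s2) :
    ExpectationLE Q (fun S₀ => potential P D F Y L (initState P W lam2 F x₀ y₀ S₀))
      (psi0 Y (globalObj D F) x₀ y₀ + P.η / (5 * P.p) * (2 * (s2 / m))
        + 5 * L * P.η ^ 2 / m
          * (mixRate lam2 P.K₀ * (2 * heterogeneity D F (pair x₀ y₀) + 2 * (m * s2)))) := by
  have := h.probQ
  have hη := h.eta_pos
  have hp := h.p_pos
  have hL := h.smooth.L_pos
  have hm : (0 : ℝ) < m := by have := h.m_ne; positivity
  have hN := expectationLE_batch_noise h.m_ne h.batch fun _ => pair x₀ y₀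
  have h1 := ((ExpectationLE.const (ν := Q) (psi0 Y (globalObj D F) x₀ y₀)).add
    (hN.const_mul (by positivity : 0 ≤ P.η / (5 * P.p)))).add
    ((h.cons_init_le (x₀ := x₀) (y₀ := y₀)).const_mul (by positivity : 0 ≤ 5 * L * P.η ^ 2 / m))
  convert h1 using 2 with S₀
  have e1 : avg (initState P W lam2 F x₀ y₀ S₀).x = x₀ := avg_const h.m_ne x₀
  have e2 : avg (initState P W lam2 F x₀ y₀ S₀).y = y₀ := avg_const h.m_ne y₀
  have e3 : cons (initState P W lam2 F x₀ y₀ S₀).x = 0 := cons_const h.m_ne x₀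
  have e4 : cons (initState P W lam2 F x₀ y₀ S₀).y = 0 := cons_const h.m_ne y₀
  have e5 : noise D F (initState P W lam2 F x₀ y₀ S₀)
    = ‖avg fun i => bigGrad F S₀ (fun _ => pair x₀ y₀) i - locGrad D F i (pair x₀ y₀)‖ ^ 2
      + 1 / (m : ℝ) ^ 2 * ∑ i, ‖bigGrad F S₀ (fun _ => pair x₀ y₀) i
        - locGrad D F i (pair x₀ y₀)‖ ^ 2 := rfl
  simp only [potential, consZ, consS, e1, e2, e3, e4, e5, merit, psi0]
  ring

theorem invariant_init (h : Setup P D F Q W lam2 Y L μ s2) (hy : y₀ ∈ Y)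
    (S₀ : BigBatch m P.bigB Ξ) : Invariant Y (initState P W lam2 F x₀ y₀ S₀) := by
  refine ⟨avg_fastMix h.mixes.doublyStochastic _ _ _, ?_⟩
  have : avg (initState P W lam2 F x₀ y₀ S₀).y = y₀ := avg_const h.m_ne y₀
  rwa [this]

/-- Telescope the drift of the nonnegative potential over T iterations and divide by γηT/4. The
output index turns the double average over time and agents into an expectation. -/
theorem expectation_gradSq_le [Nonempty (Fin P.T × Fin m)]
    (h : Setup P D F Q W lam2 Y L μ s2) (hy : y₀ ∈ Y) {ε : ℝ}
    (hε : 0 < ε)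
    (hT : 16 * psi0 Y (globalObj D F) x₀ y₀ / (P.γ * P.η * ε ^ 2) + 2 / P.p ≤ P.T)
    (hs : s2 / m ≤ P.γ * ε ^ 2 / 32) (hR : mixRate lam2 P.K₀ ≤ (P.γ * m * ε ^ 2 / 16) ^ 2)
    (hH : m * ε ^ 2 * (heterogeneity D F (pair x₀ y₀) + m * s2) ≤ (L / μ) ^ 2) :
    ExpectationLE (law P D Q) (fun o => ‖gradient (primal Y (globalObj D F))
      (output P W lam2 Y F x₀ y₀ o)‖ ^ 2) (ε ^ 2) := by
  have := h.prob
  have := h.probQ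
  have hη := h.eta_pos
  have hγ := h.gamma_pos
  have hp := h.p_pos
  have hL := h.smooth.L_pos
  have hm : (0 : ℝ) < m := by have := h.m_ne; positivity
  set Ψ := psi0 Y (globalObj D F) x₀ y₀ with hΨ
  set H := heterogeneity D F (pair x₀ y₀) with hHdef
  have hΨ0 : 0 ≤ Ψ := h.psi0_nonneg hy
  have hH0 : 0 ≤ H := Finset.sum_nonneg fun _ _ => sq_nonneg _
  have hs20 := h.s2_nonneg
  set τ := P.γ * P.η * ε ^ 2 with hτ
  have hτ0 : 0 < τ := by positivity
  -- The summand 2/p in T is there to amortise the initial noise, whose weight is η/(5p).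
  have hTp : 2 ≤ P.p * P.T := by
    have h1 : 2 / P.p ≤ P.T := le_trans (le_add_of_nonneg_left (by positivity)) hT
    rw [div_le_iff₀ hp] at h1
    linarith
  have hT0 : (0 : ℝ) < P.T := by
    by_contra hc
    have : (P.T : ℝ) = 0 := le_antisymm (not_lt.1 hc) (Nat.cast_nonneg _)
    rw [this] at hTp
    norm_num at hTp
  have hT1 : (1 : ℝ) ≤ P.T := by
    have : P.T ≠ 0 := by rintro h0; rw [h0] at hT0; simp at hT0
    exact_mod_cast Nat.one_le_iff_ne_zero.2 this
  have hrun := expectationLE_run (D := D) (F := F) (W := W) (lam2 := lam2) (Y := Y) (Q := Q)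
    (x₀ := x₀) (y₀ := y₀) (Φ := potential P D F Y L)
    (G := fun st => P.γ * P.η / 4 * gradSq D F Y st) (I := Invariant Y)
    (h.invariant_init hy) (fun st r hst => h.invariant_step hst r)
    (fun t => h.measurable_potential (measurableState_run h.oracle.meas h.measurable_proj t))
    (fun t => (h.measurable_gradSq
      (measurableState_run h.oracle.meas h.measurable_proj t)).const_mul _)
    (fun st hst => h.potential_nonneg hst)
    (fun st => mul_nonneg (by positivity) (gradSq_nonneg st))
    h.potential_init (fun st hst => h.potential_drift hst) P.T
  have hI : ∀ t S₀ r, Invariant Y (run P W lam2 Y F x₀ y₀ S₀ r t) := by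
    intro t S₀ r
    induction t with
    | zero => exact h.invariant_init hy S₀
    | succ t ih => exact h.invariant_step ih _
  have hsum : ExpectationLE (Q.prod (Measure.infinitePi fun _ : ℕ => seedLaw P D Q))
      (fun o => ∑ k ∈ Finset.range P.T, gradSq D F Y (run P W lam2 Y F x₀ y₀ o.1 o.2 k))
      (P.T * ε ^ 2) := by
    have h1 := hrun.const_mul (a := 4 / (P.γ * P.η)) (by positivity)
    refine (h1.mono (Finset.measurable_sum _ fun k _ => h.measurable_gradSq
      (measurableState_run h.oracle.meas h.measurable_proj k)).aestronglyMeasurable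
      (fun o => Finset.sum_nonneg fun _ _ => gradSq_nonneg _) fun o => ?_).le ?_
    · rw [← Finset.mul_sum]
      have h2 := h.potential_nonneg (hI P.T o.1 o.2)
      rw [mul_add, ← mul_assoc]
      have e : 4 / (P.γ * P.η) * (P.γ * P.η / 4) = 1 := by field_simp
      rw [e, one_mul]
      exact le_add_of_nonneg_left (mul_nonneg (by positivity) h2)
    · rw [div_mul_eq_mul_div, div_le_iff₀ (by positivity)]
      have a1 : 16 * Ψ ≤ P.T * τ := by
        have h1 : 16 * Ψ / τ ≤ P.T := le_trans (le_add_of_nonneg_right (by positivity)) hT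
        rwa [div_le_iff₀ hτ0] at h1
      have a2 : P.η / (5 * P.p) * (2 * (s2 / m)) ≤ P.T * τ / 160 := by
        have h2 : P.η / (5 * P.p) * (2 * (s2 / m)) ≤ P.η / (5 * P.p) * (2 * (P.γ * ε ^ 2 / 32)) := by
          gcongr
        refine h2.trans ?_
        rw [div_mul_eq_mul_div, div_le_iff₀ (by positivity)]
        have := mul_le_mul_of_nonneg_right hTp hτ0.le
        have e : P.η * (2 * (P.γ * ε ^ 2 / 32)) = τ / 16 := by rw [hτ]; ring
        rw [e]
        linarith
      have a3 : P.η / 2 * (s2 / m) ≤ τ / 64 := by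
        have := mul_le_mul_of_nonneg_left hs (by positivity : 0 ≤ P.η / 2)
        refine this.trans (le_of_eq ?_)
        rw [hτ]; ring
      have a4 : 5 * L * P.η ^ 2 / m * (mixRate lam2 P.K₀ * (2 * H + 2 * (m * s2))) ≤ τ / 64 := by
        have h4 : 5 * L * P.η ^ 2 / m * (mixRate lam2 P.K₀ * (2 * H + 2 * (m * s2)))
            ≤ 5 * L * P.η ^ 2 / m * ((P.γ * m * ε ^ 2 / 16) ^ 2 * (2 * H + 2 * (m * s2))) := by
          gcongr
        refine h4.trans ?_
        have e : 5 * L * P.η ^ 2 / m * ((P.γ * m * ε ^ 2 / 16) ^ 2 * (2 * H + 2 * (m * s2)))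
            = 10 / 256 * (P.η * L) * (P.η * ε ^ 2 * P.γ) * (P.γ
              * (m * ε ^ 2 * (H + m * s2))) := by
          field_simp
          ring
        rw [e, h.eta_mul]
        have h5 := mul_le_mul_of_nonneg_left hH hγ.le
        rw [h.gamma_mul] at h5
        have h6 : 10 / 256 * (1 / 48) * (P.η * ε ^ 2 * P.γ) * (P.γ * (m * ε ^ 2 * (H + m * s2)))
            ≤ 10 / 256 * (1 / 48) * (P.η * ε ^ 2 * P.γ) * (1 / 1152) := by gcongr
        refine h6.trans ?_
        have e2 : P.η * ε ^ 2 * P.γ = τ := by rw [hτ]; ring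
        rw [e2]
        linarith
      have a5 := mul_le_mul_of_nonneg_left a3 hT0.le
      have a6 := mul_le_mul_of_nonneg_right hT1 hτ0.le
      -- The four contributions are at most 1/16 + 1/160 + 1/64 + 1/64 = 1/10 of Tτ, below the
      -- available quarter.
      have e : (P.T : ℝ) * ε ^ 2 * (P.γ * P.η) = P.T * τ := by rw [hτ]; ring
      rw [e]
      linarith
  rw [h.smooth.gradient_primal h.isClosed h.convex h.nonempty h.mu_le]
  exact expectationLE_output (h.measurable_gradPrimal.norm.pow_const 2) (fun _ => sq_nonneg _)
    h.oracle.meas h.measurable_proj hsum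

/-- From second to first moment by ‖∇P‖ ≤ (ε² + ‖∇P‖²)/(2ε). -/
theorem expectation_norm_gradient_le [Nonempty (Fin P.T × Fin m)]
    (h : Setup P D F Q W lam2 Y L μ s2) (hy : y₀ ∈ Y) {ε : ℝ}
    (hε : 0 < ε)
    (hT : 16 * psi0 Y (globalObj D F) x₀ y₀ / (P.γ * P.η * ε ^ 2) + 2 / P.p ≤ P.T)
    (hs : s2 / m ≤ P.γ * ε ^ 2 / 32) (hR : mixRate lam2 P.K₀ ≤ (P.γ * m * ε ^ 2 / 16) ^ 2)
    (hH : m * ε ^ 2 * (heterogeneity D F (pair x₀ y₀) + m * s2) ≤ (L / μ) ^ 2) :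
    ExpectationLE (law P D Q) (fun o => ‖gradient (primal Y (globalObj D F))
      (output P W lam2 Y F x₀ y₀ o)‖) ε := by
  have := h.prob
  have := h.probQ
  have h1 := h.expectation_gradSq_le hy hε hT hs hR hH
  have hmeas : AEStronglyMeasurable (fun o => ‖gradient (primal Y (globalObj D F))
      (output P W lam2 Y F x₀ y₀ o)‖) (law P D Q) := by
    have := h1.1.aestronglyMeasurable.aemeasurable.sqrt.aestronglyMeasurable
    simpa only [Real.sqrt_sq (norm_nonneg _)] using this
  have h2 := ((ExpectationLE.const (ν := law P D Q) (ε ^ 2)).add h1).const_mul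
    (by positivity : 0 ≤ 1 / (2 * ε))
  refine (h2.mono hmeas (fun _ => norm_nonneg _) fun o => ?_).le (le_of_eq ?_)
  · rw [one_div, ← div_eq_inv_mul, le_div_iff₀ (by positivity)]
    linarith [two_mul_le_add_sq ε ‖gradient (primal Y (globalObj D F))
      (output P W lam2 Y F x₀ y₀ o)‖]
  · field_simp
    ring

end Setup

end Accuracy

end

end Dream

namespace Dream

noncomputable section

/-! ### The oracles of the problem -/

section SecondMoment

variable {Ξ : Type*} [MeasurableSpace Ξ] {V : Type*} [NormedAddCommGroup V] {D : Measure Ξ}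

theorem memLp_of_lintegral_sq_le {h : Ξ → V} (hh : AEStronglyMeasurable h D) {c : ℝ} (hc : 0 ≤ c)
    (hle : ∫⁻ ξ, ‖h ξ‖ₑ ^ 2 ∂D ≤ ENNReal.ofReal c) :
    MemLp h 2 D ∧ ∫ ξ, ‖h ξ‖ ^ 2 ∂D ≤ c := by
  have e : ∀ ξ, ‖h ξ‖ₑ ^ 2 = ENNReal.ofReal (‖h ξ‖ ^ 2) := fun ξ => by
    rw [ENNReal.ofReal_pow (norm_nonneg _), ofReal_norm]
  refine ⟨⟨hh, ?_⟩, ?_⟩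
  · rw [eLpNorm_lt_top_iff_lintegral_rpow_enorm_lt_top (by norm_num) (by norm_num)]
    simpa using hle.trans_lt ENNReal.ofReal_lt_top
  · rw [integral_eq_lintegral_of_nonneg_ae (Filter.Eventually.of_forall fun _ => sq_nonneg _)
      (hh.norm.pow 2)]
    simp only [← e]
    exact ENNReal.toReal_le_of_le_ofReal hc hle

theorem hasGradientAt_avg {m : ℕ} {E : Type*} [NormedAddCommGroup E] [InnerProductSpace ℝ E]
    [CompleteSpace E] {f : Fin m → E → ℝ} {g : Fin m → E} {z : E}
    (h : ∀ i, HasGradientAt (f i) (g i) z) :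
    HasGradientAt (fun w => (1 / (m : ℝ)) * ∑ i, f i w) (avg g) z := by
  rw [hasGradientAt_iff_hasFDerivAt]
  have := (HasFDerivAt.fun_sum fun i (_ : i ∈ Finset.univ) => (h i).hasFDerivAt).const_mul
    (1 / (m : ℝ))
  have e : InnerProductSpace.toDual ℝ E (avg g)
      = (1 / (m : ℝ)) • ∑ i, InnerProductSpace.toDual ℝ E (g i) := by
    simp only [avg, map_smul, map_sum]
  rw [e]
  exact this

theorem inner_avg_left {m : ℕ} {E : Type*} [NormedAddCommGroup E] [InnerProductSpace ℝ E]
    (g : Fin m → E) (v : E) :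
    inner ℝ (avg g) v = 1 / (m : ℝ) * ∑ i, inner ℝ (g i) v := by
  rw [avg, real_inner_smul_left, sum_inner]

end SecondMoment

section Problem

variable {m dx dy : ℕ} {Ξ : Type*} [MeasurableSpace Ξ] {D : Fin m → Measure Ξ}
  {F : Fin m → ZSpace dx dy → Ξ → ℝ} {Y : Set (EuclideanSpace ℝ (Fin dy))} {L μ : ℝ}

namespace ProblemAssumptions

theorem measurable_stochGrad (h : ProblemAssumptions D F Y L μ) (i : Fin m) :
    Measurable fun p : ZSpace dx dy × Ξ => stochGrad (F i) p.1 p.2 :=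
  measurable_gradient_uncurry (h.differentiable i) (h.measurable i)

theorem measurable_stochGrad_right (h : ProblemAssumptions D F Y L μ) (i : Fin m)
    (z : ZSpace dx dy) : Measurable (stochGrad (F i) z) :=
  (h.measurable_stochGrad i).comp measurable_prodMk_left

theorem hasGradientAt_localObj (h : ProblemAssumptions D F Y L μ) (i : Fin m)
    (z : ZSpace dx dy) : HasGradientAt (localObj (D i) (F i)) (locGrad D F i z) z := by
  have := h.unbiased i z
  rwa [← this.gradient] at this

/-- Average smoothness controls only differences of stochastic gradients, so integrability of a
single one is asked for separately: bounded variance provides it online, finiteness offline. -/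
theorem oracle (h : ProblemAssumptions D F Y L μ)
    (hint : ∀ i z, Integrable (stochGrad (F i) z) (D i)) : Oracle D F L := by
  have h2 : ∀ i z z', MemLp (fun ξ => stochGrad (F i) z ξ - stochGrad (F i) z' ξ) 2 (D i) ∧
      ∫ ξ, ‖stochGrad (F i) z ξ - stochGrad (F i) z' ξ‖ ^ 2 ∂(D i) ≤ L ^ 2 * ‖z - z'‖ ^ 2 :=
    fun i z z' => memLp_of_lintegral_sq_le ((h.measurable_stochGrad_right i z).sub
      (h.measurable_stochGrad_right i z')).aestronglyMeasurable (by positivity)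
      (h.averageSmooth i z z')
  exact ⟨h.measurable_stochGrad, hint, fun i z => (h.unbiased i z).gradient.symm,
    fun i z z' => (h2 i z z').1, fun i z z' => (h2 i z z').2⟩

theorem smoothConcave [∀ i, IsProbabilityMeasure (D i)] (h : ProblemAssumptions D F Y L μ)
    (hm : m ≠ 0) (ho : Oracle D F L) : SmoothConcave (globalObj D F) (globGrad D F) L μ where
  L_pos := h.L_pos
  mu_pos := h.mu_pos
  grad z := hasGradientAt_avg fun i => h.hasGradientAt_localObj i z
  lip z z' := by
    have hm' : (0 : ℝ) < m := by positivity
    have h1 := norm_avg_sub_sq_le hm (fun i => locGrad D F i z) (fun i => locGrad D F i z')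
    have h2 := mul_le_mul_of_nonneg_left (Finset.sum_le_sum fun i (_ : i ∈ Finset.univ) =>
      ho.locGrad_lip i z z') (by positivity : 0 ≤ 1 / (m : ℝ))
    have h3 := h1.trans h2
    simp only [Finset.sum_const, Finset.card_univ, Fintype.card_fin, nsmul_eq_mul] at h3
    rw [← mul_assoc, one_div_mul_cancel hm'.ne', one_mul, ← mul_pow] at h3
    exact le_of_sq_le_sq h3 (mul_nonneg h.L_pos.le (norm_nonneg _))
  conc x y y' := by
    have hm' : (0 : ℝ) < m := by positivity
    have h1 := mul_le_mul_of_nonneg_left (Finset.sum_le_sum fun i (_ : i ∈ Finset.univ) =>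
      h.stronglyConcave i x y y') (by positivity : 0 ≤ 1 / (m : ℝ))
    simp only [globalObj]
    refine h1.trans (le_of_eq ?_)
    rw [globGrad, snd_avg, inner_avg_left]
    simp only [Finset.sum_add_distrib, Finset.sum_sub_distrib, Finset.sum_const, Finset.card_univ,
      Fintype.card_fin, nsmul_eq_mul, locGrad]
    field_simp

theorem memLp_stochGrad [∀ i, IsProbabilityMeasure (D i)] (h : ProblemAssumptions D F Y L μ)
    {σ : ℝ} (hσ : BoundedVariance D F σ) (i : Fin m) (z : ZSpace dx dy) :
    MemLp (stochGrad (F i) z) 2 (D i) ∧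
      ∫ ξ, ‖locGrad D F i z - stochGrad (F i) z ξ‖ ^ 2 ∂(D i) ≤ σ ^ 2 := by
  have h1 := memLp_of_lintegral_sq_le (h := fun ξ => locGrad D F i z - stochGrad (F i) z ξ)
    (measurable_const.sub (h.measurable_stochGrad_right i z)).aestronglyMeasurable
    (sq_nonneg σ) (hσ i z)
  refine ⟨?_, h1.2⟩
  have h2 := (memLp_const (locGrad D F i z)).sub h1.1
  refine h2.congr_norm ?_ ?_
  · exact (h.measurable_stochGrad_right i z).aestronglyMeasurable
  · exact Filter.Eventually.of_forall fun ξ => by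
      simp only [Pi.sub_apply, sub_sub_cancel]

/-- Each batch mean is centred with variance at most σ²/b', and the batches of different agents are
independent, so the weighted variances add up. -/
theorem batchVariance_online [∀ i, IsProbabilityMeasure (D i)] (h : ProblemAssumptions D F Y L μ)
    {σ : ℝ} (hσ : BoundedVariance D F σ) {bigB : ℕ} (hB : bigB ≠ 0) :
    BatchVariance D F (onlineBatch D bigB) (σ ^ 2 / bigB) := by
  intro z a
  have hB' : (0 : ℝ) < bigB := by positivity
  have hv : ∀ i, ∫ ξ, ‖stochGrad (F i) (z i) ξ‖ ^ 2 ∂(D i) - ‖locGrad D F i (z i)‖ ^ 2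
      ≤ σ ^ 2 := by
    intro i
    have h1 := integral_norm_sub_mean_sq (h.memLp_stochGrad hσ i (z i)).1
    have e : ∫ ξ, stochGrad (F i) (z i) ξ ∂(D i) = locGrad D F i (z i) :=
      (h.unbiased i (z i)).gradient.symm
    rw [e] at h1
    rw [← h1]
    refine le_trans (le_of_eq ?_) (h.memLp_stochGrad hσ i (z i)).2
    simp only [norm_sub_rev]
  have hs : ∀ i, MemLp (fun S : Fin bigB → Ξ => (1 / (bigB : ℝ)) • ∑ j, stochGrad (F i) (z i) (S j)
        - locGrad D F i (z i)) 2 (Measure.pi fun _ : Fin bigB => D i) ∧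
      ∫ S : Fin bigB → Ξ, ((1 / (bigB : ℝ)) • ∑ j, stochGrad (F i) (z i) (S j)
        - locGrad D F i (z i)) ∂(Measure.pi fun _ : Fin bigB => D i) = 0 ∧
      ∫ S : Fin bigB → Ξ, ‖(1 / (bigB : ℝ)) • ∑ j, stochGrad (F i) (z i) (S j)
        - locGrad D F i (z i)‖ ^ 2 ∂(Measure.pi fun _ : Fin bigB => D i) ≤ σ ^ 2 / bigB := by
    intro i
    have h1 := sampleMean_moments (h.memLp_stochGrad hσ i (z i)).1 hB
    have e : ∫ ξ, stochGrad (F i) (z i) ξ ∂(D i) = locGrad D F i (z i) :=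
      (h.unbiased i (z i)).gradient.symm
    rw [e] at h1
    refine ⟨h1.1, h1.2.1, h1.2.2.trans ?_⟩
    have := mul_le_mul_of_nonneg_left (hv i) (by positivity : 0 ≤ 1 / (bigB : ℝ))
    refine this.trans (le_of_eq ?_)
    ring
  have h3 := expectationLE_norm_add_sum_sq
    (Z := fun i (S : Fin bigB → Ξ) => a i • ((1 / (bigB : ℝ)) • ∑ j, stochGrad (F i) (z i) (S j)
        - locGrad D F i (z i))) (M := fun i => a i ^ 2 * (σ ^ 2 / bigB))
    (fun i => (hs i).1.const_smul (a i))
    (fun i => by rw [integral_smul, (hs i).2.1, smul_zero])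
    (fun i => by
      simp only [norm_smul, mul_pow, Real.norm_eq_abs, sq_abs]
      rw [integral_const_mul]
      exact mul_le_mul_of_nonneg_left (hs i).2.2 (sq_nonneg _)) 0
  simp only [zero_add, norm_zero, ne_eq, OfNat.ofNat_ne_zero, not_false_eq_true, zero_pow,
    ← Finset.sum_mul] at h3
  exact h3

end ProblemAssumptions

end Problem

section Offline

variable {m dx dy n : ℕ} {F : Fin m → ZSpace dx dy → Fin n → ℝ}
  {Y : Set (EuclideanSpace ℝ (Fin dy))} {L μ : ℝ}

theorem isProbabilityMeasure_offlineLaw (hn : n ≠ 0) (i : Fin m) :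
    IsProbabilityMeasure (offlineLaw m n i) := by
  have : NeZero n := ⟨hn⟩
  exact ProbabilityTheory.isProbabilityMeasure_uniformOn Set.finite_univ Set.univ_nonempty

theorem integral_offlineLaw {V : Type*} [NormedAddCommGroup V] [NormedSpace ℝ V] [CompleteSpace V]
    (hn : n ≠ 0) (i : Fin m) (f : Fin n → V) :
    ∫ ξ, f ξ ∂(offlineLaw m n i) = (1 / (n : ℝ)) • ∑ j, f j := by
  have : NeZero n := ⟨hn⟩
  have := isProbabilityMeasure_offlineLaw (m := m) hn i
  rw [integral_fintype Integrable.of_finite, Finset.smul_sum]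
  refine Finset.sum_congr rfl fun j _ => ?_
  congr 1
  rw [Measure.real, offlineLaw, ProbabilityTheory.uniformOn_univ]
  simp

/-- The full data set reproduces the local gradient exactly. -/
theorem batchVariance_offline (h : ProblemAssumptions (offlineLaw m n) F Y L μ) (hn : n ≠ 0) :
    BatchVariance (offlineLaw m n) F (offlineBatch m n) 0 := by
  intro z a
  have hb : ∀ i, bigGrad F (fun _ j => j) z i = locGrad (offlineLaw m n) F i (z i) := by
    intro i
    rw [locGrad, (h.unbiased i (z i)).gradient, integral_offlineLaw hn]
    rfl
  have hmeas : StronglyMeasurable fun S : BigBatch m n (Fin n) =>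
      ‖∑ i, a i • (bigGrad F S z i - locGrad (offlineLaw m n) F i (z i))‖ ^ 2 :=
    (measurable_of_finite _).stronglyMeasurable
  refine ⟨?_, ?_⟩
  · rw [offlineBatch]
    exact Integrable.of_finite
  · rw [offlineBatch, integral_dirac' _ _ hmeas]
    simp [hb]

end Offline

end

end Dream

namespace Dream

noncomputable section

/-! ### The parameters -/

section Numbers

/-- Use 1 − u ≤ exp(−u) with u = c₂√δ; the hypothesis says ku ≥ a log x. -/
theorem mixRate_le {lam2 : ℝ} (h0 : 0 ≤ lam2) (h1 : lam2 < 1) {x : ℝ} (hx : 0 < x) {a k : ℕ}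
    (hk : a * Real.log x / (c₂ * √(1 - lam2)) ≤ k) : mixRate lam2 k ≤ 14 / x ^ (2 * a) := by
  have hδ : 0 < 1 - lam2 := by linarith
  have hd : 0 < c₂ * √(1 - lam2) := mul_pos (by linarith [c₂_pos.1]) (Real.sqrt_pos.2 hδ)
  have hd1 : 0 ≤ 1 - c₂ * √(1 - lam2) := (rate_nonneg (by linarith)).le
  rw [div_le_iff₀ hd] at hk
  have h2 : (1 - c₂ * √(1 - lam2)) ^ (2 * k) ≤ Real.exp (-(2 * (a * Real.log x))) := by
    calc (1 - c₂ * √(1 - lam2)) ^ (2 * k) ≤ Real.exp (-(c₂ * √(1 - lam2))) ^ (2 * k) := by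
          gcongr
          linarith [Real.add_one_le_exp (-(c₂ * √(1 - lam2)))]
      _ = Real.exp (-(2 * (k * (c₂ * √(1 - lam2))))) := by
          rw [← Real.exp_nat_mul]
          congr 1
          push_cast
          ring
      _ ≤ _ := Real.exp_le_exp.2 (by linarith)
  have h3 : Real.exp (-(2 * (a * Real.log x))) = 1 / x ^ (2 * a) := by
    rw [Real.exp_neg, one_div, show 2 * (a * Real.log x) = ((2 * a : ℕ) : ℝ) * Real.log x by
      push_cast; ring, Real.exp_nat_mul, Real.exp_log hx]
  rw [mixRate]
  rw [h3] at h2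
  calc 14 * (1 - c₂ * √(1 - lam2)) ^ (2 * k) ≤ 14 * (1 / x ^ (2 * a)) := by gcongr
    _ = _ := by ring

theorem c₁_sq : c₁ ^ 2 = 14 := Real.sq_sqrt (by norm_num)

theorem c₁_pos : 0 < c₁ := Real.sqrt_pos.2 (by norm_num)

theorem c₁_lt : c₁ < 4 := by
  rw [c₁, Real.sqrt_lt' (by norm_num)]
  norm_num

theorem c₁_gt : 1 < c₁ := by
  rw [c₁, Real.lt_sqrt (by norm_num)]
  norm_num

theorem half_le_log {m : ℕ} (hm : 2 ≤ m) : 1 / 2 ≤ Real.log m := by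
  have h1 : Real.log 2 ≤ Real.log m := Real.log_le_log (by norm_num) (by exact_mod_cast hm)
  linarith [Real.log_two_gt_d9]

/-- A ceiling of a multiple of `log x / (c₂ √δ)`, where `x ≤ m ^ 4`. -/
theorem ceil_log_le {m : ℕ} (hm : 2 ≤ m) {δ : ℝ} (hδ0 : 0 < δ) (hδ1 : δ ≤ 1) {x : ℝ} (hx : 1 ≤ x)
    (hxm : x ≤ (m : ℝ) ^ 4) :
    (⌈5 * Real.log x / (c₂ * √δ)⌉₊ : ℝ) ≤ 82 * (Real.log m / √δ) := by
  have hs : 0 < √δ := Real.sqrt_pos.2 hδ0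
  have hs1 : √δ ≤ 1 := Real.sqrt_le_one.2 hδ1
  have hc := c₂_pos.1
  have hl := half_le_log hm
  have h1 : Real.log x ≤ 4 * Real.log m := by
    refine (Real.log_le_log (by linarith) hxm).trans (le_of_eq ?_)
    rw [Real.log_pow]
    norm_num
  have h0 : 0 ≤ Real.log x := Real.log_nonneg hx
  have h2 : 5 * Real.log x / (c₂ * √δ) ≤ 80 * (Real.log m / √δ) := by
    rw [div_le_iff₀ (by positivity)]
    have e : 80 * (Real.log m / √δ) * (c₂ * √δ) = 80 * Real.log m * c₂ := by
      field_simp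
    rw [e]
    nlinarith
  -- This absorbs the 1 lost in the ceiling; it needs m ≥ 2.
  have h3 : 1 ≤ 2 * (Real.log m / √δ) := by
    rw [← mul_div_assoc, one_le_div hs]
    linarith
  have h4 := (Nat.ceil_lt_add_one (a := 5 * Real.log x / (c₂ * √δ)) (by positivity)).le
  linarith

theorem initialRounds_le {m : ℕ} (hm : 2 ≤ m) {δ κ ε : ℝ} (hδ0 : 0 < δ) (hδ1 : δ ≤ 1)
    (hκ : 0 < κ) (hε : 0 < ε) :
    (⌈Real.log (16 * c₁ / (gammaOf κ * m * ε ^ 2)) / (c₂ * √δ)⌉₊ : ℝ)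
      ≤ (98 + 8 * Real.log (1 + κ ^ 2 / ε ^ 2)) * (Real.log m / √δ) := by
  have hs : 0 < √δ := Real.sqrt_pos.2 hδ0
  have hs1 : √δ ≤ 1 := Real.sqrt_le_one.2 hδ1
  have hc := c₂_pos.1
  have hl := half_le_log hm
  have hm2 : (2 : ℝ) ≤ m := by exact_mod_cast hm
  set Λ := Real.log (1 + κ ^ 2 / ε ^ 2) with hΛ
  have hΛ0 : 0 ≤ Λ := Real.log_nonneg (by have : 0 ≤ κ ^ 2 / ε ^ 2 := by positivity
                                          linarith)
  -- Here 16 · 1152 = 18432 and c₁/m ≤ 2. The power of two is convenient because 16 log 2 < 12.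
  have h1 : 16 * c₁ / (gammaOf κ * m * ε ^ 2) ≤ 2 ^ 16 * (1 + κ ^ 2 / ε ^ 2) := by
    rw [gammaOf_eq]
    have e : 16 * c₁ / (1 / (1152 * κ ^ 2) * m * ε ^ 2) = 18432 * (c₁ / m) * (κ ^ 2 / ε ^ 2) := by
      field_simp
      ring
    rw [e]
    have h2 : c₁ / m ≤ 2 := by
      rw [div_le_iff₀ (by linarith)]
      linarith [c₁_lt]
    have h3 : 0 ≤ κ ^ 2 / ε ^ 2 := by positivity
    nlinarith
  have hpos : 0 < 16 * c₁ / (gammaOf κ * m * ε ^ 2) := by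
    have := c₁_pos
    rw [gammaOf_eq]
    positivity
  have h2 : Real.log (16 * c₁ / (gammaOf κ * m * ε ^ 2)) ≤ 12 + Λ := by
    refine (Real.log_le_log hpos h1).trans ?_
    rw [Real.log_mul (by norm_num) (by positivity), Real.log_pow]
    have := Real.log_two_lt_d9
    push_cast
    linarith
  have h3 : Real.log (16 * c₁ / (gammaOf κ * m * ε ^ 2)) / (c₂ * √δ) ≤ 4 * (12 + Λ) / √δ := by
    rw [div_le_div_iff₀ (by positivity) hs]
    have : Real.log (16 * c₁ / (gammaOf κ * m * ε ^ 2)) * √δ ≤ (12 + Λ) * √δ := by gcongr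
    have h5 : (12 + Λ) * √δ ≤ 4 * c₂ * ((12 + Λ) * √δ) :=
      le_mul_of_one_le_left (by positivity) (by linarith)
    linarith
  have h4 := (Nat.ceil_le_ceil h3 : ⌈Real.log (16 * c₁ / (gammaOf κ * m * ε ^ 2)) / (c₂ * √δ)⌉₊
    ≤ _)
  have h5 := (Nat.ceil_lt_add_one (a := 4 * (12 + Λ) / √δ) (by positivity)).le
  have h6 : (⌈Real.log (16 * c₁ / (gammaOf κ * m * ε ^ 2)) / (c₂ * √δ)⌉₊ : ℝ)
    ≤ ⌈4 * (12 + Λ) / √δ⌉₊ := by exact_mod_cast h4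
  refine h6.trans (h5.trans ?_)
  have h7 : 1 ≤ 1 / √δ := (one_le_div hs).2 hs1
  have h8 : (98 + 8 * Λ) * (Real.log m / √δ) = (98 + 8 * Λ) * Real.log m * (1 / √δ) := by ring
  have h9 : 4 * (12 + Λ) / √δ = 4 * (12 + Λ) * (1 / √δ) := by ring
  rw [h8, h9]
  have h10 : (98 + 8 * Λ) * (1 / 2) ≤ (98 + 8 * Λ) * Real.log m := by gcongr
  have h11 := mul_le_mul_of_nonneg_right h10 (by positivity : 0 ≤ 1 / √δ)
  linarith

end Numbers

section ParamsFacts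

variable {m B : ℕ} {L κ δ Ψ ε : ℝ}

/-- The probability q undoes the rounding of b, so bq is exactly √(b'/m), while b exceeds it by at
most 1, as the small batch estimate requires. -/
theorem params_bq (hm : 2 ≤ m) (hB : B ≠ 0) :
    ((params m L κ δ Ψ ε B).b : ℝ) * (params m L κ δ Ψ ε B).q = √((B : ℝ) / m) ∧
    0 < √((B : ℝ) / m) ∧ (params m L κ δ Ψ ε B).b ≠ 0 ∧ 0 < (params m L κ δ Ψ ε B).q ∧
    (params m L κ δ Ψ ε B).q ≤ 1 ∧ ((params m L κ δ Ψ ε B).b : ℝ) - √((B : ℝ) / m) ≤ 1 := by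
  have hr : 0 < √((B : ℝ) / m) := Real.sqrt_pos.2 (by positivity)
  have hb : 0 < ⌈√((B : ℝ) / m)⌉₊ := Nat.ceil_pos.2 hr
  have hb' : (0 : ℝ) < ⌈√((B : ℝ) / m)⌉₊ := by exact_mod_cast hb
  have hle := Nat.le_ceil √((B : ℝ) / m)
  have hlt := (Nat.ceil_lt_add_one hr.le).le
  simp only [params]
  refine ⟨by field_simp, hr, hb.ne', by positivity, ?_, by linarith⟩
  rw [one_div, inv_mul_le_iff₀ hb']
  linarith

theorem sqrt_facts (hm : 2 ≤ m) (hB : B ≠ 0) :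
    (m : ℝ) * √((B : ℝ) / m) = √(m * B) ∧ √((m : ℝ) * B) * √((B : ℝ) / m) = B ∧
    √((m : ℝ) * B) ^ 2 = m * B ∧ 1 ≤ √((m : ℝ) * B) := by
  have hm' : (0 : ℝ) < m := by positivity
  have h3 : √((m : ℝ) * B) ^ 2 = m * B := Real.sq_sqrt (by positivity)
  have h1 : (m : ℝ) * √((B : ℝ) / m) = √(m * B) := by
    rw [eq_comm, Real.sqrt_eq_iff_mul_self_eq (by positivity) (by positivity)]
    have := Real.mul_self_sqrt (by positivity : 0 ≤ (B : ℝ) / m)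
    rw [mul_mul_mul_comm, this]
    field_simp
  refine ⟨h1, ?_, h3, ?_⟩
  · rw [← h1, mul_assoc, Real.mul_self_sqrt (by positivity)]
    field_simp
  · rw [Real.one_le_sqrt]
    have : 1 ≤ m * B := Nat.one_le_iff_ne_zero.2 (by positivity)
    exact_mod_cast this

theorem params_p (hm : 2 ≤ m) (hB : B ≠ 0) :
    (params m L κ δ Ψ ε B).p * (1 + √((m : ℝ) * B)) = 1 ∧ 0 < (params m L κ δ Ψ ε B).p ∧
    (params m L κ δ Ψ ε B).p ≤ 1 := by
  obtain ⟨h1, hr, -⟩ := params_bq (L := L) (κ := κ) (δ := δ) (Ψ := Ψ) (ε := ε) hm hB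
  obtain ⟨-, h4, -, h5⟩ := sqrt_facts hm hB
  have hB' : (0 : ℝ) < B := by positivity
  have e : (params m L κ δ Ψ ε B).p = √((B : ℝ) / m) / (√((B : ℝ) / m) + B) := by
    rw [← h1]; rfl
  have hp : (params m L κ δ Ψ ε B).p * (1 + √((m : ℝ) * B)) = 1 := by
    rw [e, div_mul_eq_mul_div, div_eq_one_iff_eq (by positivity)]
    linarith
  have hp0 : 0 < (params m L κ δ Ψ ε B).p := by rw [e]; positivity
  refine ⟨hp, hp0, ?_⟩
  nlinarith

/-- With S = √(mb'), one has m√(b'/m) = S and p(1 + S) = 1, that is, 1 − p = pS. -/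
theorem params_p_eq (hm : 2 ≤ m) (hB : B ≠ 0) :
    (1 - (params m L κ δ Ψ ε B).p) / (m * √((B : ℝ) / m)) = (params m L κ δ Ψ ε B).p := by
  obtain ⟨h1, h2, -⟩ := params_p (L := L) (κ := κ) (δ := δ) (Ψ := Ψ) (ε := ε) hm hB
  obtain ⟨h3, -, -, h5⟩ := sqrt_facts hm hB
  rw [h3, div_eq_iff (by linarith)]
  linarith

/-- The constant is 16 · 1152 · 48. The rest is 2/p = 2 + 2√(mb') and 1 for the ceiling. -/
theorem params_T_le (hm : 2 ≤ m) (hB : B ≠ 0) (hL : 0 < L) (hκ : 0 < κ) (hε : 0 < ε) (hΨ : 0 ≤ Ψ) :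
    ((params m L κ δ Ψ ε B).T : ℝ) ≤ 884736 * (Ψ * κ ^ 2 * L / ε ^ 2) + 3 + 2 * √((m : ℝ) * B) := by
  obtain ⟨h1, h2, -⟩ := params_p (L := L) (κ := κ) (δ := δ) (Ψ := Ψ) (ε := ε) hm hB
  have e1 : 2 / (params m L κ δ Ψ ε B).p = 2 * (1 + √((m : ℝ) * B)) := by
    rw [div_eq_iff h2.ne']
    linarith
  have e2 : 16 * Ψ / (gammaOf κ * (1 / (48 * L)) * ε ^ 2)
      = 884736 * (Ψ * κ ^ 2 * L / ε ^ 2) := by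
    rw [gammaOf_eq]
    field_simp
    ring
  have e : ((params m L κ δ Ψ ε B).T : ℝ) = (⌈16 * Ψ / (gammaOf κ * (1 / (48 * L)) * ε ^ 2)
      + 2 / (params m L κ δ Ψ ε B).p⌉₊ : ℝ) := rfl
  rw [e, e1, e2]
  have := (Nat.ceil_lt_add_one (a := 884736 * (Ψ * κ ^ 2 * L / ε ^ 2)
    + 2 * (1 + √((m : ℝ) * B))) (by positivity)).le
  linarith

theorem le_params_T : 16 * Ψ / ((params m L κ δ Ψ ε B).γ * (params m L κ δ Ψ ε B).η * ε ^ 2)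
    + 2 / (params m L κ δ Ψ ε B).p ≤ (params m L κ δ Ψ ε B).T :=
  Nat.le_ceil _

theorem params_T_ne (hm : 2 ≤ m) (hB : B ≠ 0) (hL : 0 < L) (hκ : 0 < κ) (hΨ : 0 ≤ Ψ) :
    (params m L κ δ Ψ ε B).T ≠ 0 := by
  obtain ⟨-, h2, -⟩ := params_p (L := L) (κ := κ) (δ := δ) (Ψ := Ψ) (ε := ε) hm hB
  have h := le_params_T (m := m) (L := L) (κ := κ) (δ := δ) (Ψ := Ψ) (ε := ε) (B := B)
  have h3 : 0 ≤ 16 * Ψ / ((params m L κ δ Ψ ε B).γ * (params m L κ δ Ψ ε B).η * ε ^ 2) := by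
    have : 0 < (params m L κ δ Ψ ε B).γ := by
      change 0 < gammaOf κ
      rw [gammaOf_eq]
      positivity
    have : 0 < (params m L κ δ Ψ ε B).η := by
      change 0 < 1 / (48 * L)
      positivity
    positivity
  have h4 : 0 < 2 / (params m L κ δ Ψ ε B).p := by positivity
  rintro h0
  rw [h0, Nat.cast_zero] at h
  linarith

end ParamsFacts

section SetupParams

variable {m B dx dy : ℕ} {Ξ : Type*} [MeasurableSpace Ξ] {D : Fin m → Measure Ξ}
  {F : Fin m → ZSpace dx dy → Ξ → ℝ} {Y : Set (EuclideanSpace ℝ (Fin dy))} {L μ s2 Ψ ε : ℝ}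
  {W : Matrix (Fin m) (Fin m) ℝ} {lam2 : ℝ}

theorem ProblemAssumptions.setup (h : ProblemAssumptions D F Y L μ) (hm : 2 ≤ m) (hdy : 1 ≤ dy)
    [∀ i, IsProbabilityMeasure (D i)] (hY : Y.Nonempty) (ho : Oracle D F L)
    (hl0 : 0 ≤ lam2) (hl1 : lam2 < 1) (hW : Mixes W lam2) (hB : B ≠ 0)
    {Q : Measure (BigBatch m B Ξ)} [hQp : IsProbabilityMeasure Q] (hQ : BatchVariance D F Q s2)
    (hs2 : 0 ≤ s2) :
    Setup (params m L (L / μ) (1 - lam2) Ψ ε B) D F Q W lam2 Y L μ s2 := by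
  have hm0 : m ≠ 0 := by omega
  have hm' : (0 : ℝ) < m := by positivity
  have hB' : (0 : ℝ) < B := by positivity
  have hsm := h.smoothConcave hm0 ho
  obtain ⟨h1, h2, h3, h4, h5, h6⟩ := params_bq (L := L) (κ := L / μ) (δ := 1 - lam2) (Ψ := Ψ)
    (ε := ε) hm hB
  obtain ⟨h7, h8, h9⟩ := params_p (L := L) (κ := L / μ) (δ := 1 - lam2) (Ψ := Ψ) (ε := ε) hm hB
  have h10 := params_p_eq (L := L) (κ := L / μ) (δ := 1 - lam2) (Ψ := Ψ) (ε := ε) hm hB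
  have hM : 0 < (m : ℝ) / B + 1 := by positivity
  have hM1 : 1 ≤ (m : ℝ) / B + 1 := le_add_of_nonneg_left (by positivity)
  have hc1 := c₁_pos
  -- This is 14⁵, so 14/c₁¹⁰ = 14⁻⁴ = 1/38416, the contraction demanded by `Setup`. The exponent is
  -- twice the 5 in K and K'.
  have hc10 : c₁ ^ 10 = 537824 := by
    rw [show c₁ ^ 10 = (c₁ ^ 2) ^ 5 by ring, c₁_sq]; norm_num
  have hrate : mixRate lam2 (params m L (L / μ) (1 - lam2) Ψ ε B).K
      ≤ 1 / 38416 * (1 / ((m : ℝ) / B + 1) ^ 10) := by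
    refine (mixRate_le hl0 hl1 (mul_pos hc1 hM) (a := 5) (Nat.le_ceil _)).trans (le_of_eq ?_)
    rw [mul_pow, hc10, ← div_div, div_eq_mul_one_div (14 / 537824 : ℝ)]
    norm_num
  have hrateBig : mixRate lam2 (params m L (L / μ) (1 - lam2) Ψ ε B).bigK
      ≤ 1 / 38416 * (1 / (m : ℝ) ^ 10) := by
    refine (mixRate_le hl0 hl1 (mul_pos hc1 hm') (a := 5) (Nat.le_ceil _)).trans (le_of_eq ?_)
    rw [mul_pow, hc10, ← div_div, div_eq_mul_one_div (14 / 537824 : ℝ)]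
    norm_num
  have hR0 := mixRate_nonneg lam2 (params m L (L / μ) (1 - lam2) Ψ ε B).K
  refine ⟨hm0, inferInstance, hQp, ho, hsm, hsm.mu_le hdy, h.isClosed, h.convex, hY,
    h.lowerBounded, hW, hQ, hs2, h8, h9, h4, h5, h3, ?_, rfl, rfl, ?_, ?_, ?_, ?_⟩
  · rw [h1]; exact h6
  · rw [h1]; exact h10
  · refine hrate.trans (mul_le_of_le_one_right (by norm_num) ?_)
    rw [div_le_one (by positivity)]
    exact one_le_pow₀ hM1
  · rw [h1]
    have e : 1 / √((B : ℝ) / m) = √((m : ℝ) / B) := by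
      rw [one_div, ← Real.sqrt_inv, inv_div]
    -- The summand m/b' in the definition of K is there to compensate 1/(bq) = √(m/b').
    have h11 : 1 + 1 / √((B : ℝ) / m) ≤ 2 * ((m : ℝ) / B + 1) := by
      rw [e]
      have := Real.sq_sqrt (by positivity : 0 ≤ (m : ℝ) / B)
      nlinarith [sq_nonneg (√((m : ℝ) / B) - 1)]
    have h12 : ((m : ℝ) / B + 1) ≤ ((m : ℝ) / B + 1) ^ 10 := le_self_pow₀ hM1 (by norm_num)
    calc _ ≤ 1 / 38416 * (1 / ((m : ℝ) / B + 1) ^ 10) * (2 * ((m : ℝ) / B + 1) ^ 10) := by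
          refine mul_le_mul hrate (h11.trans (by linarith)) (by positivity) (by positivity)
      _ = 2 / 38416 := by field_simp
  · have hm1 : (1 : ℝ) ≤ m := by exact_mod_cast (by omega : 1 ≤ m)
    calc _ ≤ 1 / 38416 * (1 / (m : ℝ) ^ 10) * (m : ℝ) ^ 2 := by gcongr
      _ = 1 / 38416 * (1 / (m : ℝ) ^ 8) := by field_simp
      _ ≤ 1 / 38416 := by
        refine mul_le_of_le_one_right (by norm_num) ?_
        rw [div_le_one (by positivity)]
        exact one_le_pow₀ hm1

end SetupParams

end

end Dream

/-! ### Complexity bounds for the chosen parameters. -/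

namespace Dream

noncomputable section

section Complexity

variable {m B dx dy : ℕ} {Ξ : Type*} [MeasurableSpace Ξ] {D : Fin m → Measure Ξ}
  [∀ i, IsProbabilityMeasure (D i)]
  {F : Fin m → ZSpace dx dy → Ξ → ℝ} {Y : Set (EuclideanSpace ℝ (Fin dy))} {L κ δ Ψ ε : ℝ}
  {W : Matrix (Fin m) (Fin m) ℝ} {lam2 : ℝ} 
  {Q : Measure (BigBatch m (params m L κ δ Ψ ε B).bigB Ξ)}
  [hQp : IsProbabilityMeasure Q]

/-- Write S = √(mb'). Since pS ≤ 1, an iteration costs pS² + (1 − p)2S ≤ 3S gradients in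
expectation. Multiplying by the bound on T gives the product term and multiples of S and S², where S
≤ S². -/
theorem sfo_complexity
    (hF : ∀ i, Measurable fun p : ZSpace dx dy × Ξ => stochGrad (F i) p.1 p.2)
    (hY : Measurable (proj Y)) (hm : 2 ≤ m) (hB : B ≠ 0) (hL : 0 < L) (hκ : 0 < κ) (hε : 0 < ε)
    (hΨ : 0 ≤ Ψ) (x₀ : EuclideanSpace ℝ (Fin dx)) (y₀ : EuclideanSpace ℝ (Fin dy)) :
    ExpectationLE (law (params m L κ δ Ψ ε B) D Q)
      (sfoCost (params m L κ δ Ψ ε B) W lam2 Y F x₀ y₀)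
      (16 * √((m : ℝ) * B) ^ 2 + 2654208 * √((m : ℝ) * B) * (Ψ * κ ^ 2 * L / ε ^ 2)) := by
  have : NeZero (params m L κ δ Ψ ε B).T := ⟨params_T_ne hm hB hL hκ hΨ⟩
  have : NeZero m := ⟨by omega⟩
  obtain ⟨h1, h2, h3, h4, h5, h6⟩ := params_bq (L := L) (κ := κ) (δ := δ) (Ψ := Ψ)
    (ε := ε) hm hB
  obtain ⟨h7, h8, h9⟩ := params_p (L := L) (κ := κ) (δ := δ) (Ψ := Ψ) (ε := ε) hm hB
  obtain ⟨h10, h11, h12, h13⟩ := sqrt_facts hm hB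
  have hT := params_T_le (δ := δ) hm hB hL hκ hε hΨ
  refine (expectationLE_sfoCost hF hY h8.le h9 h4.le h5 x₀ y₀).le ?_
  have e1 : (m : ℝ) * ((params m L κ δ Ψ ε B).q * (2 * (params m L κ δ Ψ ε B).b))
      = 2 * √((m : ℝ) * B) := by
    rw [← h10, ← h1]; ring
  have e2 : (m : ℝ) * (params m L κ δ Ψ ε B).bigB = √((m : ℝ) * B) ^ 2 := h12.symm
  rw [e1, e2]
  generalize √((m : ℝ) * B) = S at *
  generalize (params m L κ δ Ψ ε B).p = p at *
  have hA : 0 ≤ Ψ * κ ^ 2 * L / ε ^ 2 := by positivity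
  generalize Ψ * κ ^ 2 * L / ε ^ 2 = A at *
  have hT0 : (0 : ℝ) ≤ (params m L κ δ Ψ ε B).T := Nat.cast_nonneg _
  generalize ((params m L κ δ Ψ ε B).T : ℝ) = T at *
  have hpS : p * S ≤ 1 := by linarith
  have h14 : p * S ^ 2 + (1 - p) * (2 * S) ≤ 3 * S := by
    have a1 := mul_le_mul_of_nonneg_right hpS (by linarith : 0 ≤ S)
    have a2 : 0 ≤ p * S := by positivity
    nlinarith
  have h15 := mul_le_mul hT h14 (by
    have : 0 ≤ 1 - p := by linarith
    positivity) (by positivity)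
  have h16 : (884736 * A + 3 + 2 * S) * (3 * S) = 2654208 * S * A + 9 * S + 6 * S ^ 2 := by ring
  have h17 : S ≤ S ^ 2 := by nlinarith
  linarith

/-- Each iteration runs FastMix three times with at most 82 log(m)/√δ rounds. The smallness
hypotheses make the summand √(mb') in T and the logarithm in K₀ subordinate to κ²L/ε². -/
theorem comm_complexity
    (hF : ∀ i, Measurable fun p : ZSpace dx dy × Ξ => stochGrad (F i) p.1 p.2)
    (hY : Measurable (proj Y)) (hm : 2 ≤ m) (hB : B ≠ 0) (hL : 0 < L) (hκ : 0 < κ) (hε : 0 < ε)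
    (hΨ : 0 ≤ Ψ) (hδ0 : 0 < δ) (hδ1 : δ ≤ 1)
    (hR : 1 ≤ κ ^ 2 * L / ε ^ 2) (hS : √((m : ℝ) * B) ≤ 192 * (κ ^ 2 * L / ε ^ 2))
    (hΛ : Real.log (1 + κ ^ 2 / ε ^ 2) ≤ κ ^ 2 * L / ε ^ 2)
    (x₀ : EuclideanSpace ℝ (Fin dx)) (y₀ : EuclideanSpace ℝ (Fin dy)) :
    ExpectationLE (law (params m L κ δ Ψ ε B) D Q)
      (commCost (params m L κ δ Ψ ε B) W lam2 Y F x₀ y₀)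
      (10 ^ 9 * ((1 + Ψ) * κ ^ 2 * L / ε ^ 2 * Real.log m / √δ)) := by
  have : NeZero (params m L κ δ Ψ ε B).T := ⟨params_T_ne hm hB hL hκ hΨ⟩
  have : NeZero m := ⟨by omega⟩
  obtain ⟨-, h8, h9⟩ := params_p (L := L) (κ := κ) (δ := δ) (Ψ := Ψ) (ε := ε) hm hB
  have hT := params_T_le (δ := δ) hm hB hL hκ hε hΨ
  refine (expectationLE_commCost hF hY h8.le h9 x₀ y₀).le ?_
  have hm2 : (2 : ℝ) ≤ m := by exact_mod_cast hm
  have hB' : (1 : ℝ) ≤ B := by exact_mod_cast Nat.one_le_iff_ne_zero.2 hB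
  have hc1 := c₁_gt
  have hc4 := c₁_lt
  have hm4 : 4 * ((m : ℝ) + 1) ≤ m ^ 4 := by
    have h1 : (2 : ℝ) ^ 3 ≤ (m : ℝ) ^ 3 := by gcongr
    have h2 : (m : ℝ) ^ 4 = m ^ 3 * m := by ring
    nlinarith
  have hK : ((params m L κ δ Ψ ε B).K : ℝ) ≤ 82 * (Real.log m / √δ) := by
    have h1 : 0 ≤ (m : ℝ) / B := by positivity
    have h2 : (m : ℝ) / B ≤ m := div_le_self (by linarith) hB'
    refine ceil_log_le hm hδ0 hδ1 ?_ ?_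
    · nlinarith
    · nlinarith
  have hbigK : ((params m L κ δ Ψ ε B).bigK : ℝ) ≤ 82 * (Real.log m / √δ) := by
    refine ceil_log_le hm hδ0 hδ1 ?_ ?_
    · nlinarith
    · nlinarith
  have hK0 : ((params m L κ δ Ψ ε B).K₀ : ℝ) ≤ _ := initialRounds_le hm hδ0 hδ1 hκ hε
  have hE : 0 ≤ Real.log m / √δ := by
    have := half_le_log hm
    positivity
  have e1 : (1 + Ψ) * κ ^ 2 * L / ε ^ 2 * Real.log m / √δ
      = (1 + Ψ) * (κ ^ 2 * L / ε ^ 2) * (Real.log m / √δ) := by ring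
  have e2 : Ψ * κ ^ 2 * L / ε ^ 2 = Ψ * (κ ^ 2 * L / ε ^ 2) := by ring
  rw [e1]
  rw [e2] at hT
  have hT0 : (0 : ℝ) ≤ (params m L κ δ Ψ ε B).T := Nat.cast_nonneg _
  generalize ((params m L κ δ Ψ ε B).T : ℝ) = T at *
  generalize ((params m L κ δ Ψ ε B).K : ℝ) = K at *
  generalize ((params m L κ δ Ψ ε B).bigK : ℝ) = bigK at *
  generalize ((params m L κ δ Ψ ε B).K₀ : ℝ) = K₀ at *
  generalize (params m L κ δ Ψ ε B).p = p at *
  generalize κ ^ 2 * L / ε ^ 2 = R at *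
  generalize Real.log m / √δ = E at *
  generalize Real.log (1 + κ ^ 2 / ε ^ 2) = Λ at *
  generalize √((m : ℝ) * B) = S at *
  have h1 : 2 * K + (p * bigK + (1 - p) * K) ≤ 246 * E := by
    have a1 := mul_le_mul_of_nonneg_left hbigK h8.le
    have a2 := mul_le_mul_of_nonneg_left hK (by linarith : 0 ≤ 1 - p)
    linarith
  have h2 := mul_le_mul_of_nonneg_left h1 hT0
  have h3 : T ≤ 884736 * (Ψ * R) + 387 * R := by linarith
  have h4 := mul_le_mul_of_nonneg_right h3 (by positivity : 0 ≤ 246 * E)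
  have h5 : (98 + 8 * Λ) * E ≤ (106 * R) * E := by
    refine mul_le_mul_of_nonneg_right ?_ hE
    linarith
  have h6 : 0 ≤ Ψ * R * E := by positivity
  have h7 : 0 ≤ R * E := by positivity
  have e3 : (884736 * (Ψ * R) + 387 * R) * (246 * E)
    = 217645056 * (Ψ * R * E) + 95202 * (R * E) := by ring
  have e4 : 10 ^ 9 * ((1 + Ψ) * R * E) = 10 ^ 9 * (R * E) + 10 ^ 9 * (Ψ * R * E) := by ring
  have e5 : 106 * R * E = 106 * (R * E) := by ring
  rw [e3] at h4
  rw [e4]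
  rw [e5] at h5
  linarith

end Complexity

end

end Dream

/-! ### The online and the offline case. -/

namespace Dream

noncomputable section

section Main

variable {m B dx dy : ℕ} {Ξ : Type*} [MeasurableSpace Ξ] {D : Fin m → Measure Ξ}
  {F : Fin m → ZSpace dx dy → Ξ → ℝ} {Y : Set (EuclideanSpace ℝ (Fin dy))} {L μ s2 : ℝ}
  {W : Matrix (Fin m) (Fin m) ℝ} {lam2 : ℝ}

theorem Setup.differentiable_primal {P : Params} {Q : Measure (BigBatch m P.bigB Ξ)}
    (h : Setup P D F Q W lam2 Y L μ s2) : Differentiable ℝ (primal Y (globalObj D F)) := fun x =>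
  (h.smooth.hasGradientAt_primal h.isClosed h.convex h.nonempty h.mu_le x).differentiableAt

/-- Apply `mixRate_le` with a = 1; the factor c₁² = 14 in the denominator cancels the constant of
FastMix. -/
theorem mixRate_initialRounds_le {κ ε : ℝ} (h0 : 0 ≤ lam2) (h1 : lam2 < 1) (hm : m ≠ 0)
    (hκ : 0 < κ) (hε : 0 < ε) (L Ψ : ℝ) :
    mixRate lam2 (params m L κ (1 - lam2) Ψ ε B).K₀ ≤ (gammaOf κ * m * ε ^ 2 / 16) ^ 2 := by
  have hγ : 0 < gammaOf κ := by rw [gammaOf_eq]; positivity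
  have hc := c₁_pos
  have hm' : (0 : ℝ) < m := by positivity
  refine (mixRate_le h0 h1 (x := 16 * c₁ / (gammaOf κ * m * ε ^ 2)) (by positivity) (a := 1)
    ?_).trans (le_of_eq ?_)
  · rw [Nat.cast_one, one_mul]
    exact Nat.le_ceil _
  · rw [mul_one, div_pow, mul_pow 16 c₁, c₁_sq]
    field_simp

theorem isProbabilityMeasure_onlineBatch [∀ i, IsProbabilityMeasure (D i)] (bigB : ℕ) :
    IsProbabilityMeasure (onlineBatch D bigB) := by
  unfold onlineBatch
  infer_instance

/-- Here 36864 = 32 · 1152 = 192², and the summand m comes from the ceiling. -/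
theorem mul_onlineBigB_le {κ σ ε : ℝ} (hm : m ≠ 0) (hκ : 0 < κ) (hε : 0 < ε) :
    (m : ℝ) * onlineBigB m κ σ ε ≤ 36864 * (κ * σ / ε) ^ 2 + m := by
  have hm' : (0 : ℝ) < m := by positivity
  have hγ : 0 < gammaOf κ := by rw [gammaOf_eq]; positivity
  have h1 := (Nat.ceil_lt_add_one (a := 32 * σ ^ 2 / (gammaOf κ * m * ε ^ 2)) (by positivity)).le
  have h2 := mul_le_mul_of_nonneg_left h1 hm'.le
  refine h2.trans (le_of_eq ?_)
  rw [gammaOf_eq]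
  field_simp
  ring

theorem onlineBigB_ne {κ σ ε : ℝ} (hm : m ≠ 0) (hκ : 0 < κ) (hε : 0 < ε) (hσ : 0 < σ) :
    onlineBigB m κ σ ε ≠ 0 := by
  have hm' : (0 : ℝ) < m := by positivity
  have hγ : 0 < gammaOf κ := by rw [gammaOf_eq]; positivity
  exact (Nat.ceil_pos.2 (by positivity)).ne'

theorem variance_onlineBigB_le {κ σ ε : ℝ} (hm : m ≠ 0) (hκ : 0 < κ) (hε : 0 < ε) (hσ : 0 < σ) :
    σ ^ 2 / onlineBigB m κ σ ε / m ≤ gammaOf κ * ε ^ 2 / 32 := by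
  have hm' : (0 : ℝ) < m := by positivity
  have hγ : 0 < gammaOf κ := by rw [gammaOf_eq]; positivity
  have hB : (0 : ℝ) < onlineBigB m κ σ ε := by
    have := onlineBigB_ne hm hκ hε hσ
    positivity
  have h1 : 32 * σ ^ 2 / (gammaOf κ * m * ε ^ 2) ≤ onlineBigB m κ σ ε := Nat.le_ceil _
  rw [div_le_iff₀ (by positivity)] at h1
  rw [div_div, div_le_iff₀ (by positivity)]
  linarith

end Main

section Cases

theorem online_case (m dx dy : ℕ) (hm : 2 ≤ m) (hdy : 1 ≤ dy) {Ξ : Type*} [MeasurableSpace Ξ]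
    (D : Fin m → Measure Ξ) [∀ i, IsProbabilityMeasure (D i)]
    (F : Fin m → ZSpace dx dy → Ξ → ℝ) (Y : Set (EuclideanSpace ℝ (Fin dy))) (L μ σ : ℝ)
    (h : ProblemAssumptions D F Y L μ) (hσ : 0 < σ) (hvar : BoundedVariance D F σ)
    (W : Matrix (Fin m) (Fin m) ℝ) (lam2 : ℝ) (hW : Mixes W lam2) (hl0 : 0 ≤ lam2) (hl1 : lam2 < 1)
    (x₀ : EuclideanSpace ℝ (Fin dx)) (y₀ : EuclideanSpace ℝ (Fin dy)) (hy : y₀ ∈ Y)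
    (ε : ℝ) (hε : 0 < ε) :
    let κ : ℝ := L / μ
    let δ : ℝ := 1 - lam2
    let primal := primal Y (globalObj D F)
    let Ψ₀ : ℝ := psi0 Y (globalObj D F) x₀ y₀
    let P : Params := params m L κ δ Ψ₀ ε (onlineBigB m κ σ ε)
    let ν := law P D (onlineBatch D P.bigB)
    Differentiable ℝ primal ∧
    (m * ε ^ 2 * (heterogeneity D F (pair x₀ y₀) + m * σ ^ 2) ≤ κ ^ 2 →
      ExpectationLE ν (fun o => ‖gradient primal (output P W lam2 Y F x₀ y₀ o)‖) ε) ∧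
    (m * ε ^ 2 ≤ κ ^ 2 * σ ^ 2 →
      ExpectationLE ν (sfoCost P W lam2 Y F x₀ y₀)
        (10 ^ 9 * (κ ^ 2 * σ ^ 2 / ε ^ 2 + Ψ₀ * κ ^ 3 * L * σ / ε ^ 3))) ∧
    (ε ^ 2 * (√m + κ * σ / ε + Real.log (1 + κ ^ 2 / ε ^ 2)) ≤ κ ^ 2 * L →
      ExpectationLE ν (commCost P W lam2 Y F x₀ y₀)
        (10 ^ 9 * ((1 + Ψ₀) * κ ^ 2 * L / ε ^ 2 * Real.log m / √δ))) := by
  intro κ δ primal Ψ₀ P ν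
  have hm0 : m ≠ 0 := by omega
  have hm' : (0 : ℝ) < m := by positivity
  have hL := h.L_pos
  have hκ : 0 < κ := div_pos h.L_pos h.mu_pos
  have hB := onlineBigB_ne hm0 hκ hε hσ
  have hBle := mul_onlineBigB_le (σ := σ) hm0 hκ hε
  have ho := h.oracle fun i z => (h.memLp_stochGrad hvar i z).1.integrable one_le_two
  have hQ : IsProbabilityMeasure (onlineBatch D P.bigB) := isProbabilityMeasure_onlineBatch _
  have hset : Setup P D F (onlineBatch D P.bigB) W lam2 Y L μ (σ ^ 2 / P.bigB) :=
    h.setup hm hdy ⟨y₀, hy⟩ ho hl0 hl1 hW hB (Q := onlineBatch D P.bigB) (hQp := hQ)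
      (h.batchVariance_online hvar hB) (by positivity)
  have hΨ : 0 ≤ Ψ₀ := hset.psi0_nonneg hy
  have hσB : σ ^ 2 / P.bigB ≤ σ ^ 2 := div_le_self (sq_nonneg σ) (by
    exact_mod_cast Nat.one_le_iff_ne_zero.2 hB)
  refine ⟨hset.differentiable_primal, fun hH => ?_, fun hc => ?_, fun hc => ?_⟩
  · have : NeZero P.T := ⟨params_T_ne hm hB hL hκ hΨ⟩
    have : NeZero m := ⟨hm0⟩
    refine hset.expectation_norm_gradient_le hy hε le_params_T
      (variance_onlineBigB_le hm0 hκ hε hσ) (mixRate_initialRounds_le hl0 hl1 hm0 hκ hε L Ψ₀)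
      (le_trans ?_ hH)
    gcongr
  · refine (sfo_complexity ho.meas hset.measurable_proj hm hB hL hκ hε hΨ x₀ y₀).le ?_
    -- The hypothesis bounds the summand m by (κσ/ε)², and 193² > 36864 + 1.
    have hs : √((m : ℝ) * onlineBigB m κ σ ε) ≤ 193 * (κ * σ / ε) := by
      refine Real.sqrt_le_iff.2 ⟨by positivity, hBle.trans ?_⟩
      have : (m : ℝ) ≤ (κ * σ / ε) ^ 2 := by
        rw [div_pow, le_div_iff₀ (by positivity), mul_pow]
        exact hc
      have h0 : 0 ≤ (κ * σ / ε) ^ 2 := sq_nonneg _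
      rw [mul_pow]
      linarith
    set S := √((m : ℝ) * onlineBigB m κ σ ε)
    have hS0 : 0 ≤ S := Real.sqrt_nonneg _
    have hA : 0 ≤ Ψ₀ * κ ^ 2 * L / ε ^ 2 := by positivity
    have e1 : κ ^ 2 * σ ^ 2 / ε ^ 2 = (κ * σ / ε) ^ 2 := by ring
    have e2 : Ψ₀ * κ ^ 3 * L * σ / ε ^ 3 = κ * σ / ε * (Ψ₀ * κ ^ 2 * L / ε ^ 2) := by
      field_simp
    rw [e1, e2]
    have a1 : S ^ 2 ≤ (193 * (κ * σ / ε)) ^ 2 := by gcongr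
    have a2 : S * (Ψ₀ * κ ^ 2 * L / ε ^ 2) ≤ 193 * (κ * σ / ε) * (Ψ₀ * κ ^ 2 * L / ε ^ 2) := by
      gcongr
    have a3 : 0 ≤ κ * σ / ε * (Ψ₀ * κ ^ 2 * L / ε ^ 2) := by positivity
    have a4 : 0 ≤ (κ * σ / ε) ^ 2 := sq_nonneg _
    rw [mul_pow] at a1
    rw [mul_assoc 193] at a2
    rw [mul_assoc 2654208 S]
    linarith
  · have hR : √m + κ * σ / ε + Real.log (1 + κ ^ 2 / ε ^ 2) ≤ κ ^ 2 * L / ε ^ 2 := by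
      rw [le_div_iff₀ (by positivity)]
      linarith
    have h1 : 0 ≤ κ * σ / ε := by positivity
    have h2 : 0 ≤ Real.log (1 + κ ^ 2 / ε ^ 2) :=
      Real.log_nonneg (le_add_of_nonneg_right (by positivity))
    have h3 : 1 ≤ √(m : ℝ) := Real.one_le_sqrt.2 (by exact_mod_cast (by omega : 1 ≤ m))
    refine comm_complexity ho.meas hset.measurable_proj hm hB hL hκ hε hΨ (by linarith)
      (by linarith) (by linarith) ?_ (by linarith) x₀ y₀
    -- No bound of m by (κσ/ε)² is available here, so the ceiling contributes √m separately.
    have hs : √((m : ℝ) * onlineBigB m κ σ ε) ≤ 192 * (κ * σ / ε) + √m := by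
      refine Real.sqrt_le_iff.2 ⟨by positivity, hBle.trans ?_⟩
      have h4 := Real.sq_sqrt hm'.le
      have h5 : 0 ≤ κ * σ / ε * √m := by positivity
      have e : (192 * (κ * σ / ε) + √m) ^ 2
        = 36864 * (κ * σ / ε) ^ 2 + 384 * (κ * σ / ε * √m) + √m ^ 2 := by ring
      rw [e, h4]
      linarith
    linarith

theorem offline_case (m dx dy n : ℕ) (hm : 2 ≤ m) (hdy : 1 ≤ dy) (hn : 1 ≤ n)
    (F : Fin m → ZSpace dx dy → Fin n → ℝ) (Y : Set (EuclideanSpace ℝ (Fin dy))) (L μ : ℝ)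
    (h : ProblemAssumptions (offlineLaw m n) F Y L μ)
    (W : Matrix (Fin m) (Fin m) ℝ) (lam2 : ℝ) (hW : Mixes W lam2) (hl0 : 0 ≤ lam2) (hl1 : lam2 < 1)
    (x₀ : EuclideanSpace ℝ (Fin dx)) (y₀ : EuclideanSpace ℝ (Fin dy)) (hy : y₀ ∈ Y)
    (ε : ℝ) (hε : 0 < ε) :
    let D := offlineLaw m n
    let κ : ℝ := L / μ
    let δ : ℝ := 1 - lam2
    let primal := primal Y (globalObj D F)
    let Ψ₀ : ℝ := psi0 Y (globalObj D F) x₀ y₀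
    let P : Params := params m L κ δ Ψ₀ ε n
    let ν := law P D (offlineBatch m n)
    Differentiable ℝ primal ∧
    (m * ε ^ 2 * heterogeneity D F (pair x₀ y₀) ≤ κ ^ 2 →
      ExpectationLE ν (fun o => ‖gradient primal (output P W lam2 Y F x₀ y₀ o)‖) ε) ∧
    ExpectationLE ν (sfoCost P W lam2 Y F x₀ y₀)
      (10 ^ 9 * (m * n + √(m * n) * (Ψ₀ * κ ^ 2 * L / ε ^ 2))) ∧
    (ε ^ 2 * (√(m * n) + Real.log (1 + κ ^ 2 / ε ^ 2)) ≤ κ ^ 2 * L →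
      ExpectationLE ν (commCost P W lam2 Y F x₀ y₀)
        (10 ^ 9 * ((1 + Ψ₀) * κ ^ 2 * L / ε ^ 2 * Real.log m / √δ))) := by
  intro D κ δ primal Ψ₀ P ν
  have hm0 : m ≠ 0 := by omega
  have hn0 : n ≠ 0 := by omega
  have hm' : (0 : ℝ) < m := by positivity
  have hL := h.L_pos
  have hκ : 0 < κ := div_pos h.L_pos h.mu_pos
  have hD : ∀ i, IsProbabilityMeasure (D i) := isProbabilityMeasure_offlineLaw hn0
  have ho : Oracle D F L := h.oracle fun i z => Integrable.of_finite
  have hQ : IsProbabilityMeasure (α := BigBatch m P.bigB (Fin n)) (offlineBatch m n) :=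
    Measure.dirac.isProbabilityMeasure
  have hset : Setup P D F (offlineBatch m n) W lam2 Y L μ 0 :=
    h.setup hm hdy ⟨y₀, hy⟩ ho hl0 hl1 hW hn0 (hQp := hQ)
      (batchVariance_offline h hn0) le_rfl
  have hΨ : 0 ≤ Ψ₀ := hset.psi0_nonneg hy
  obtain ⟨-, -, hS2, hS1⟩ := sqrt_facts hm hn0
  refine ⟨hset.differentiable_primal, fun hH => ?_, ?_, fun hc => ?_⟩
  · have : NeZero P.T := ⟨params_T_ne hm hn0 hL hκ hΨ⟩
    have : NeZero m := ⟨hm0⟩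
    have hγ := hset.gamma_pos
    refine hset.expectation_norm_gradient_le hy hε le_params_T (by rw [zero_div]; positivity)
      (mixRate_initialRounds_le hl0 hl1 hm0 hκ hε L Ψ₀) ?_
    rw [mul_zero, add_zero]
    exact hH
  · refine (sfo_complexity (Q := offlineBatch m n) (hQp := hQ) ho.meas hset.measurable_proj hm hn0 hL hκ hε hΨ
      x₀ y₀).le ?_
    rw [hS2]
    have hA : 0 ≤ √((m : ℝ) * n) * (Ψ₀ * κ ^ 2 * L / ε ^ 2) := by positivity
    have h1 : 0 ≤ (m : ℝ) * n := by positivity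
    rw [mul_assoc 2654208 √((m : ℝ) * n)]
    linarith
  · have hR : √((m : ℝ) * n) + Real.log (1 + κ ^ 2 / ε ^ 2) ≤ κ ^ 2 * L / ε ^ 2 := by
      rw [le_div_iff₀ (by positivity)]
      linarith
    have h2 : 0 ≤ Real.log (1 + κ ^ 2 / ε ^ 2) :=
      Real.log_nonneg (le_add_of_nonneg_right (by positivity))
    exact comm_complexity (Q := offlineBatch m n) (hQp := hQ) ho.meas hset.measurable_proj hm hn0 hL hκ hε hΨ
      (by linarith) (by linarith) (by linarith) (by linarith) (by linarith) x₀ y₀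

end Cases

end

end Dream

theorem theorem1 :
    ∃ C : ℝ, 0 < C ∧
      -- the online case
      (∀ (m dx dy : ℕ) (hm : 2 ≤ m) (_ : 1 ≤ dy) (Ξ : Type*) [MeasurableSpace Ξ]
        (D : Fin m → Measure Ξ) [∀ i, IsProbabilityMeasure (D i)]
        (F : Fin m → Dream.ZSpace dx dy → Ξ → ℝ)
        (Y : Set (EuclideanSpace ℝ (Fin dy))) (L μ σ : ℝ)
        (_ : Dream.ProblemAssumptions D F Y L μ)
        (_ : 0 < σ) (_ : Dream.BoundedVariance D F σ)
        (G : SimpleGraph (Fin m)) (W : Matrix (Fin m) (Fin m) ℝ) (hW : Dream.MixingMatrix G W)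
        (x₀ : EuclideanSpace ℝ (Fin dx)) (y₀ : EuclideanSpace ℝ (Fin dy)) (_ : y₀ ∈ Y)
        (ε : ℝ) (_ : 0 < ε),
        let κ : ℝ := L / μ
        let lam2 : ℝ := Dream.lambda2 hW.posSemidef.isHermitian hm
        let δ : ℝ := 1 - lam2
        let primal := Dream.primal Y (Dream.globalObj D F)
        let Ψ₀ : ℝ := Dream.psi0 Y (Dream.globalObj D F) x₀ y₀
        let P : Dream.Params := Dream.params m L κ δ Ψ₀ ε (Dream.onlineBigB m κ σ ε)
        let ν := Dream.law P D (Dream.onlineBatch D P.bigB)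
        Differentiable ℝ primal ∧
        (m * ε ^ 2 * (Dream.heterogeneity D F (Dream.pair x₀ y₀) + m * σ ^ 2) ≤ κ ^ 2 →
          Dream.ExpectationLE ν
            (fun o => ‖gradient primal (Dream.output P W lam2 Y F x₀ y₀ o)‖) ε) ∧
        (m * ε ^ 2 ≤ κ ^ 2 * σ ^ 2 →
          Dream.ExpectationLE ν (Dream.sfoCost P W lam2 Y F x₀ y₀)
            (C * (κ ^ 2 * σ ^ 2 / ε ^ 2 + Ψ₀ * κ ^ 3 * L * σ / ε ^ 3))) ∧
        (ε ^ 2 * (√m + κ * σ / ε + Real.log (1 + κ ^ 2 / ε ^ 2)) ≤ κ ^ 2 * L →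
          Dream.ExpectationLE ν (Dream.commCost P W lam2 Y F x₀ y₀)
            (C * ((1 + Ψ₀) * κ ^ 2 * L / ε ^ 2 * Real.log m / √δ)))) ∧
      -- the offline case
      (∀ (m dx dy n : ℕ) (hm : 2 ≤ m) (_ : 1 ≤ dy) (_ : 1 ≤ n)
        (F : Fin m → Dream.ZSpace dx dy → Fin n → ℝ)
        (Y : Set (EuclideanSpace ℝ (Fin dy))) (L μ : ℝ)
        (_ : Dream.ProblemAssumptions (Dream.offlineLaw m n) F Y L μ)
        (G : SimpleGraph (Fin m)) (W : Matrix (Fin m) (Fin m) ℝ) (hW : Dream.MixingMatrix G W)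
        (x₀ : EuclideanSpace ℝ (Fin dx)) (y₀ : EuclideanSpace ℝ (Fin dy)) (_ : y₀ ∈ Y)
        (ε : ℝ) (_ : 0 < ε),
        let D := Dream.offlineLaw m n
        let κ : ℝ := L / μ
        let lam2 : ℝ := Dream.lambda2 hW.posSemidef.isHermitian hm
        let δ : ℝ := 1 - lam2
        let primal := Dream.primal Y (Dream.globalObj D F)
        let Ψ₀ : ℝ := Dream.psi0 Y (Dream.globalObj D F) x₀ y₀
        let P : Dream.Params := Dream.params m L κ δ Ψ₀ ε n
        let ν := Dream.law P D (Dream.offlineBatch m n)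
        Differentiable ℝ primal ∧
        (m * ε ^ 2 * Dream.heterogeneity D F (Dream.pair x₀ y₀) ≤ κ ^ 2 →
          Dream.ExpectationLE ν
            (fun o => ‖gradient primal (Dream.output P W lam2 Y F x₀ y₀ o)‖) ε) ∧
        Dream.ExpectationLE ν (Dream.sfoCost P W lam2 Y F x₀ y₀)
          (C * (m * n + √(m * n) * (Ψ₀ * κ ^ 2 * L / ε ^ 2))) ∧
        (ε ^ 2 * (√(m * n) + Real.log (1 + κ ^ 2 / ε ^ 2)) ≤ κ ^ 2 * L →
          Dream.ExpectationLE ν (Dream.commCost P W lam2 Y F x₀ y₀)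
            (C * ((1 + Ψ₀) * κ ^ 2 * L / ε ^ 2 * Real.log m / √δ)))) := by
  -- The largest constant to be dominated is 2654208 · 193, about 5.1 · 10⁸, from the online
  -- gradient count.
  refine ⟨10 ^ 9, by norm_num, ?_, ?_⟩
  · intro m dx dy hm hdy Ξ _ D _ F Y L μ σ h hσ hvar G W hW x₀ y₀ hy ε hε
    exact Dream.online_case m dx dy hm hdy D F Y L μ σ h hσ hvar W _ (hW.mixes hm)
      (Dream.lambda2_nonneg hW.posSemidef hm) (Dream.exists_eigenbasis hW hm).1 x₀ y₀ hy ε hε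
  · intro m dx dy n hm hdy hn F Y L μ h G W hW x₀ y₀ hy ε hε
    exact Dream.offline_case m dx dy n hm hdy hn F Y L μ h W _ (hW.mixes hm)
      (Dream.lambda2_nonneg hW.posSemidef hm) (Dream.exists_eigenbasis hW hm).1 x₀ y₀ hy ε hε
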